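/- **Setting.** There are $M$ monitoring nodes (MNs) with $N$ antennas, an untrusted transmitter (UT) with $N_t$ antennas and an untrusted receiver (UR) with $N_r$ antennas. The variable $\alpha_m\in\{0,1\}$ is $1$ if MN $m$ observes and $0$ if it jams. The powers $\rho_t,\rho_r,\rho_J\ge 0$, fading coefficients $\beta_{tr},\beta_{mr},\beta_{tm},\beta_{mm'}\ge 0$ and diagonal matrices $\Lambda_r,\Pi_{mr}\ge 0$ are deterministic, and $\varrho>0$. The coherence interval is $\tau>0$, with $\tau_t+\tau_r\le\tau$ training symbols. *Channels.* $G_{tr}=\sqrt{\beta_{tr}}H_{tr}\in\mathbb C^{N_t\times N_r}$, $G_{mr}=\sqrt{\beta_{mr}}H_{mr}\in\mathbb C^{N\times N_r}$, $G_{tm}=\sqrt{\beta_{tm}}H_{tm}\in\mathbb C^{N_t\times N}$, $G_{mm'}=\sqrt{\beta_{mm'}}H_{mm'}\in\mathbb C^{N\times N}$ for $m\ne m'$ and $G_{mm}=0$, where each $H$ has i.i.d. $\mathcal{CN}(0,1)$ entries. *Training.* Let $\varphi\in\mathbb C^{\tau_r\times N_r}$ and $\Phi\in\mathbb C^{N_r\times\tau_t}$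 be pilots with $\varphi^H\varphi=I$, $\Phi\Phi^H=I$, and let $\Omega_t,\Omega_m,\Omega'_m$ be noise matrices with i.i.d. $\mathcal{CN}(0,1)$ entries. Put $c(\beta)=\sqrt{\tau_r\rho_r}\,\beta/(\tau_r\rho_r\beta+1)$, and $$\hat G_{tr}=c(\beta_{tr})(\sqrt{\tau_r\rho_r}\,G_{tr}\varphi^H+\Omega_t)\varphi,\qquad \hat G_{mr}=c(\beta_{mr})(\sqrt{\tau_r\rho_r}\,G_{mr}\varphi^H+\Omega_m)\varphi .$$ The precoder $W\in\mathbb C^{N_t\times N_r}$ is a measurable function of $\hat G_{tr}$ with its columns normalized to unit Euclidean norm (a zero column is left zero). Let $A_r=G_{tr}^HW$, $B_m=G_{tm}^HW$, and let $b_p^H$ be the $p$-th row of $B_m$. Let $\tilde y_p^H$ be the $p$-th row of $(\sqrt{\tau_t\rho_t}\,B_m\Phi+\Omega'_m)\Phi^H$, and let $\hat B_m$ have the rows $\hat b_p^H$ with $$\hat b_p=E\{b_p\}+\sqrt{\tau_t\rho_t}\,C_p(\tau_t\rho_tC_p+I)^{-1}(\tilde y_p-\sqrt{\tau_t\rho_t}\,E\{b_p\}),\qquad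 C_p=\mathrm{Cov}(b_p).$$ Put $V_m=\hat B_m(\hat B_m^H\hat B_m+\varrho I)^{-1}$. *Data phase.* The symbols are $x\sim\mathcal{CN}(0,I_{N_r})$, the jamming symbols $x^J$ satisfy $E\{x^J(x^J)^H\}=I_{N_r}$, and the noises $\omega_r\in\mathbb C^{N_r}$, $\omega_m\in\mathbb C^N$ have mean zero and identity covariance, with $\omega_m,\omega_l$ uncorrelated for $m\neq l$. With $s_t=\sqrt{\rho_t}W\Lambda_r^{1/2}x$ and $s^J_m=(1-\alpha_m)\sqrt{\rho_J}\hat G_{mr}\Pi_{mr}^{1/2}x^J$, the UR receives $y_r$, MN $m$ receives $y_m$, and the CPU forms $z_c$: $$y_r=G_{tr}^Hs_t+\sum_mG_{mr}^Hs^J_m+\omega_r,\quad y_m=\alpha_mG_{tm}^Hs_t+\sum_{m'}G_{mm'}^Hs^J_{m'}+\omega_m,\quad z_c=\sum_m\alpha_mV_m^Hy_m .$$ *Side information.* $\Theta_r$ and $\Theta_c$ are random elements of arbitrary measurable spaces such that $x$, $x^J$, $\omega_r$ and the tuple ($\Theta_r$, all channels, all training noise) are mutually independent, and likewise $x$, $x^J$,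 $(\omega_m)_m$ and the tuple ($\Theta_c$, all channels, all training noise). **Notation.** Put $F_r^J=\sum_m(1-\alpha_m)G_{mr}^H\hat G_{mr}\Pi_{mr}^{1/2}$, $F_m^J=\sum_{m'}(1-\alpha_{m'})G_{mm'}^H\hat G_{m'r}\Pi_{m'r}^{1/2}$, $D=\sum_m\alpha_mV_m^HB_m\Lambda_r^{1/2}$, and $$\Psi_r=I+\rho_JE\{F_r^J(F_r^J)^H|\Theta_r\}+\rho_tE\{A_r\Lambda_rA_r^H|\Theta_r\}-\rho_tE\{A_r\Lambda_r^{1/2}|\Theta_r\}E\{A_r\Lambda_r^{1/2}|\Theta_r\}^H,$$ $$\Psi_c=\rho_JE\Big\{\sum_{m,l}\alpha_m\alpha_lV_m^HF_m^J(F_l^J)^HV_l\Big|\Theta_c\Big\}+\rho_tE\{DD^H|\Theta_c\}+E\Big\{\sum_m\alpha_mV_m^HV_m\Big|\Theta_c\Big\}-\rho_tE\{D|\Theta_c\}E\{D^H|\Theta_c\},$$ $$\Upsilon_r=\rho_tE\{\Lambda_r^{1/2}A_r^H|\Theta_r\}\Psi_r^{-1}E\{A_r\Lambda_r^{1/2}|\Theta_r\},\qquad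 \Upsilon_c=\rho_tE\{D^H|\Theta_c\}\Psi_c^{-1}E\{D|\Theta_c\},$$ where $\Upsilon_c$ is set to $0$ wherever $\Psi_c$ is singular. For $(y,\Theta)\in\{(y_r,\Theta_r),(z_c,\Theta_c)\}$ let $\hat x=E\{xy^H|\Theta\}\,E\{yy^H|\Theta\}^{-1}y$ (read as $0$ where the matrix is singular) be the (linear) MMSE detector output and $\epsilon=x-\hat x$ its error. The SE under MMSE detection is $$\Big(1-\frac{\tau_t+\tau_r}{\tau}\Big)E\big\{\log_2\det(\pi eI)-\log_2\det(\pi e\,E\{\epsilon\epsilon^H|\Theta\})\big\},$$ and a rate $R$ is called achievable from an observation $U$ if $R\le(1-\frac{\tau_t+\tau_r}{\tau})I(x;U)$, where $I$ is the mutual information in bits. **Proposition 2.** Let $$\mathrm{SE}_r=\Big(1-\frac{\tau_t+\tau_r}{\tau}\Big)E\{\log_2\det(I+\Upsilon_r)\},\qquad \mathrm{SE}_c=\Big(1-\frac{\tau_t+\tau_r}{\tau}\Big)E\{\log_2\det(I+\Upsilon_c)\}.$$ Both expectations are of integrable random variables. The matrix $\Psi_r$ is almost surely invertible, and if $F_r^J$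 is independent of $\Theta_r$, then almost surely its jamming term is $\rho_JE\{F_r^J(F_r^J)^H\}$. The SE under MMSE detection at the UR equals $\mathrm{SE}_r$; the SE under MMSE detection at the CPU equals $\mathrm{SE}_c$ whenever $\Psi_c$ is almost surely invertible. Moreover $\mathrm{SE}_r$ is achievable from $(\hat x,\Theta_r)$ and from $(y_r,\Theta_r)$, and $\mathrm{SE}_c$ is achievable from $(\hat x,\Theta_c)$ and from $(z_c,\Theta_c)$. -/

import Mathlib

open MeasureTheory ProbabilityTheory Matrix
open scoped ENNReal

noncomputable section

namespace Surveillance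

/-! ### Complex Gaussian laws, matrix expectations, mutual information -/

/-- The circularly symmetric law `CN(0,1)` on `ℂ`: independent real and imaginary parts of law
`N(0,1/2)`. -/
def stdCN : Measure ℂ :=
  ((gaussianReal 0 (1 / 2)).prod (gaussianReal 0 (1 / 2))).map fun q : ℝ × ℝ => (⟨q.1, q.2⟩ : ℂ)

/-- The law `CN(0, I_k)` on `ℂ^k`. -/
def stdCNVec (k : ℕ) : Measure (Fin k → ℂ) := Measure.pi fun _ => stdCN

/-- Matrices carry the product σ-algebra of their entries. -/
instance matrixMeasurableSpace {k l : ℕ} : MeasurableSpace (Matrix (Fin k) (Fin l) ℂ) :=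
  inferInstanceAs (MeasurableSpace (Fin k → Fin l → ℂ))

/-- The law of a `k × l` matrix with i.i.d. `CN(0,1)` entries. -/
def stdCNMat (k l : ℕ) : Measure (Matrix (Fin k) (Fin l) ℂ) :=
  Measure.pi fun _ : Fin k => Measure.pi fun _ : Fin l => stdCN

/-- Entrywise expectation `E{X}` of a random matrix. -/
def expMat {Ω : Type*} [MeasurableSpace Ω] (P : Measure Ω) {k l : ℕ}
    (X : Ω → Matrix (Fin k) (Fin l) ℂ) : Matrix (Fin k) (Fin l) ℂ :=
  Matrix.of fun i j => ∫ ω, X ω i j ∂P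

/-- Entrywise conditional expectation `E{X | Θ}` of a random matrix. -/
def condMat {Ω T : Type*} [MeasurableSpace Ω] [mT : MeasurableSpace T] (P : Measure Ω) (Θ : Ω → T)
    {k l : ℕ} (X : Ω → Matrix (Fin k) (Fin l) ℂ) : Ω → Matrix (Fin k) (Fin l) ℂ :=
  fun ω => Matrix.of fun i j => (P[fun ω' => X ω' i j | mT.comap Θ]) ω

/-- The outer product `u vᴴ`. -/
def outer {k l : ℕ} (u : Fin k → ℂ) (v : Fin l → ℂ) : Matrix (Fin k) (Fin l) ℂ :=
  Matrix.vecMulVec u (star v)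

/-- Mutual information `I(X;Y)` in bits: the Kullback-Leibler divergence of the joint law from the
product of the marginal laws, divided by `ln 2`. -/
def mutualInfo {Ω A B : Type*} [MeasurableSpace Ω] [MeasurableSpace A] [MeasurableSpace B]
    (P : Measure Ω) (X : Ω → A) (Y : Ω → B) : ℝ≥0∞ :=
  InformationTheory.klDiv (P.map fun ω => (X ω, Y ω)) ((P.map X).prod (P.map Y))
    / ENNReal.ofReal (Real.log 2)

/-- The rate `R` (bits per channel use) is supported when a fraction `f` of the channel uses
conveys information `I` each. -/
def IsAchievableSE (f : ℝ) (I : ℝ≥0∞) (R : ℝ) : Prop :=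
  ENNReal.ofReal R ≤ ENNReal.ofReal f * I

/-- `X`, `J`, `N`, `S` are mutually independent, written as a chain. -/
def MutuallyIndep {Ω A B C D : Type*} [MeasurableSpace Ω] [MeasurableSpace A] [MeasurableSpace B]
    [MeasurableSpace C] [MeasurableSpace D] (P : Measure Ω)
    (X : Ω → A) (J : Ω → B) (N : Ω → C) (S : Ω → D) : Prop :=
  IndepFun X (fun ω => (J ω, N ω, S ω)) P ∧ IndepFun J (fun ω => (N ω, S ω)) P ∧ IndepFun N S P

/-! ### MMSE detection with side information -/

section Detection

variable {Ω T : Type*} [MeasurableSpace Ω] [MeasurableSpace T] (P : Measure Ω) {k : ℕ}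

/-- The linear MMSE estimate of `x` from `y` given the side information `Θ`:
`C_{xy|Θ} C_{yy|Θ}⁻¹ y`, with `C_{uv|Θ} = E{u vᴴ | Θ}`. -/
def mmseEstimate (Θ : Ω → T) (x y : Ω → Fin k → ℂ) : Ω → Fin k → ℂ := fun ω =>
  (condMat P Θ (fun ω' => outer (x ω') (y ω')) ω *
    (condMat P Θ (fun ω' => outer (y ω') (y ω')) ω)⁻¹) *ᵥ y ω

/-- The conditional error covariance `E{ε εᴴ | Θ}` of the MMSE estimate. -/
def mmseErrorCov (Θ : Ω → T) (x y : Ω → Fin k → ℂ) : Ω → Matrix (Fin k) (Fin k) ℂ :=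
  condMat P Θ fun ω =>
    outer (x ω - mmseEstimate P Θ x y ω) (x ω - mmseEstimate P Θ x y ω)

/-- The real number `log₂ det X`, for matrices `X` whose determinant is real. -/
def log2det (X : Matrix (Fin k) (Fin k) ℂ) : ℝ := Real.logb 2 X.det.re

/-- The SE under MMSE detection of `x ∼ CN(0, I)` with a fraction `f` of the channel uses:
`f * E{log₂ det (πe I) - log₂ det (πe E{ε εᴴ | Θ})}`. -/
def mmseSE (f : ℝ) (Θ : Ω → T) (x y : Ω → Fin k → ℂ) : ℝ :=
  f * ∫ ω, (log2det (((Real.pi * Real.exp 1 : ℝ) : ℂ) • (1 : Matrix (Fin k) (Fin k) ℂ))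
    - log2det (((Real.pi * Real.exp 1 : ℝ) : ℂ) • mmseErrorCov P Θ x y ω)) ∂P

end Detection

/-! ### The surveillance system -/

/-- Divide every column by its Euclidean norm. -/
def normalizeCols {k l : ℕ} (X : Matrix (Fin k) (Fin l) ℂ) : Matrix (Fin k) (Fin l) ℂ :=
  Matrix.of fun i j => X i j / ((Real.sqrt (∑ i', ‖X i' j‖ ^ 2) : ℝ) : ℂ)

/-- Diagonal matrix with entries `√(d n)`. -/
def sqrtDiag {k : ℕ} (d : Fin k → ℝ) : Matrix (Fin k) (Fin k) ℂ :=
  Matrix.diagonal fun n => ((Real.sqrt (d n) : ℝ) : ℂ)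

/-- Deterministic parameters: `M` monitoring nodes (MNs) with `N` antennas, an untrusted
transmitter (UT) with `Nt` antennas, an untrusted receiver (UR) with `Nr` antennas, `τt` and `τr`
training symbols. -/
structure Params (M N Nt Nr τt τr : ℕ) where
  /-- coherence interval -/
  τ : ℕ
  τ_pos : 0 < τ
  training_le : τt + τr ≤ τ
  /-- `true` for observing mode, `false` for jamming mode -/
  observing : Fin M → Bool
  ρt : ℝ
  ρr : ℝ
  ρJ : ℝ
  ρt_nonneg : 0 ≤ ρt
  ρr_nonneg : 0 ≤ ρr
  ρJ_nonneg : 0 ≤ ρJ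
  /-- regularization of the MMSE combiner -/
  reg : ℝ
  reg_pos : 0 < reg
  /-- large-scale fading UT-UR, MN-UR, UT-MN, MN-MN -/
  βtr : ℝ
  βmr : Fin M → ℝ
  βtm : Fin M → ℝ
  βmm : Fin M → Fin M → ℝ
  βtr_nonneg : 0 ≤ βtr
  βmr_nonneg : ∀ m, 0 ≤ βmr m
  βtm_nonneg : ∀ m, 0 ≤ βtm m
  βmm_nonneg : ∀ m m', 0 ≤ βmm m m'
  /-- power coefficients, the diagonals of `Λ_r` and `Π_{mr}` -/
  lam : Fin Nr → ℝ
  lam_nonneg : ∀ n, 0 ≤ lam n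
  pow : Fin M → Fin Nr → ℝ
  pow_nonneg : ∀ m n, 0 ≤ pow m n
  /-- uplink pilots `φ_n` as columns -/
  φ : Matrix (Fin τr) (Fin Nr) ℂ
  φ_orth : φᴴ * φ = 1
  /-- downlink beamforming pilots -/
  Φ : Matrix (Fin Nr) (Fin τt) ℂ
  Φ_orth : Φ * Φᴴ = 1
  /-- unnormalized precoding vectors `w_n` as a function of the UT's channel estimate -/
  precoder : Matrix (Fin Nt) (Fin Nr) ℂ → Matrix (Fin Nt) (Fin Nr) ℂ
  precoder_meas : Measurable precoder

/-- The random quantities of the system. Every small-scale fading matrix and every training noise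
matrix has i.i.d. `CN(0,1)` entries; nothing is imposed on the dependence between different
matrices. The equations `E{u uᴴ} = I` include that `u` is square integrable. -/
structure Model {Ω : Type*} [MeasurableSpace Ω] (P : Measure Ω) (M N Nt Nr τt τr : ℕ) where
  /-- small-scale fading UT-UR, MN-UR, UT-MN, MN-MN -/
  Htr : Ω → Matrix (Fin Nt) (Fin Nr) ℂ
  Hmr : Ω → Fin M → Matrix (Fin N) (Fin Nr) ℂ
  Htm : Ω → Fin M → Matrix (Fin Nt) (Fin N) ℂ
  Hmm : Ω → Fin M → Fin M → Matrix (Fin N) (Fin N) ℂ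
  /-- noise in the uplink training (at UT and MNs) and in the beamforming training (at MNs) -/
  Wt : Ω → Matrix (Fin Nt) (Fin τr) ℂ
  Wul : Ω → Fin M → Matrix (Fin N) (Fin τr) ℂ
  Wdl : Ω → Fin M → Matrix (Fin N) (Fin τt) ℂ
  /-- untrusted symbols and jamming symbols -/
  x : Ω → Fin Nr → ℂ
  xJ : Ω → Fin Nr → ℂ
  /-- noise in the data phase at the UR and at the MNs -/
  wr : Ω → Fin Nr → ℂ
  wm : Ω → Fin M → Fin N → ℂ
  Htr_meas : Measurable Htr
  Hmr_meas : Measurable Hmr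
  Htm_meas : Measurable Htm
  Hmm_meas : Measurable Hmm
  Wt_meas : Measurable Wt
  Wul_meas : Measurable Wul
  Wdl_meas : Measurable Wdl
  x_meas : Measurable x
  xJ_meas : Measurable xJ
  wr_meas : Measurable wr
  wm_meas : Measurable wm
  Htr_law : P.map Htr = stdCNMat Nt Nr
  Hmr_law : ∀ m, P.map (fun ω => Hmr ω m) = stdCNMat N Nr
  Htm_law : ∀ m, P.map (fun ω => Htm ω m) = stdCNMat Nt N
  Hmm_law : ∀ m m', m ≠ m' → P.map (fun ω => Hmm ω m m') = stdCNMat N N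
  Wt_law : P.map Wt = stdCNMat Nt τr
  Wul_law : ∀ m, P.map (fun ω => Wul ω m) = stdCNMat N τr
  Wdl_law : ∀ m, P.map (fun ω => Wdl ω m) = stdCNMat N τt
  /-- Gaussian signaling -/
  x_law : P.map x = stdCNVec Nr
  xJ_cov : expMat P (fun ω => outer (xJ ω) (xJ ω)) = 1
  wr_mean : ∀ i, ∫ ω, wr ω i ∂P = 0
  wr_cov : expMat P (fun ω => outer (wr ω) (wr ω)) = 1
  wm_mean : ∀ m i, ∫ ω, wm ω m i ∂P = 0
  wm_cov : ∀ m, expMat P (fun ω => outer (wm ω m) (wm ω m)) = 1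
  wm_uncorr : ∀ m l, m ≠ l → expMat P (fun ω => outer (wm ω m) (wm ω l)) = 0

namespace Params

variable {M N Nt Nr τt τr : ℕ} (p : Params M N Nt Nr τt τr)

/-- The binary mode variable `α_m`. -/
def α (m : Fin M) : ℂ := if p.observing m then 1 else 0

/-- The pre-log factor `1 - (τt + τr) / τ`. -/
def prelog : ℝ := 1 - ((τt : ℝ) + (τr : ℝ)) / (p.τ : ℝ)

/-- `Λ_r^{1/2}`. -/
def sqrtLam : Matrix (Fin Nr) (Fin Nr) ℂ := sqrtDiag p.lam

/-- `Λ_r`. -/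
def Lam : Matrix (Fin Nr) (Fin Nr) ℂ := Matrix.diagonal fun n => ((p.lam n : ℝ) : ℂ)

/-- `Π_{mr}^{1/2}`. -/
def sqrtPow (m : Fin M) : Matrix (Fin Nr) (Fin Nr) ℂ := sqrtDiag (p.pow m)

/-- `√(τr ρr)`. -/
def ampUL : ℝ := Real.sqrt (τr * p.ρr)

/-- `√(τt ρt)`. -/
def ampDL : ℝ := Real.sqrt (τt * p.ρt)

/-- The estimation gain `√(τr ρr) β / (τr ρr β + 1)`. -/
def gain (β : ℝ) : ℝ := p.ampUL * β / (τr * p.ρr * β + 1)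

end Params

namespace Model

variable {Ω : Type*} [MeasurableSpace Ω] {P : Measure Ω} {M N Nt Nr τt τr : ℕ}
  (S : Model P M N Nt Nr τt τr) (p : Params M N Nt Nr τt τr)

/-- All channels together with all training noise. -/
def state (ω : Ω) :=
  (S.Htr ω, S.Hmr ω, S.Htm ω, S.Hmm ω, S.Wt ω, S.Wul ω, S.Wdl ω)

/-- Channels between UR and UT, UR and MN `m`, MN `m` and UT, MN `m` and MN `m'`. -/
def Gtr (ω : Ω) : Matrix (Fin Nt) (Fin Nr) ℂ := ((Real.sqrt p.βtr : ℝ) : ℂ) • S.Htr ω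

def Gmr (m : Fin M) (ω : Ω) : Matrix (Fin N) (Fin Nr) ℂ :=
  ((Real.sqrt (p.βmr m) : ℝ) : ℂ) • S.Hmr ω m

def Gtm (m : Fin M) (ω : Ω) : Matrix (Fin Nt) (Fin N) ℂ :=
  ((Real.sqrt (p.βtm m) : ℝ) : ℂ) • S.Htm ω m

def Gmm (m m' : Fin M) (ω : Ω) : Matrix (Fin N) (Fin N) ℂ :=
  if m = m' then 0 else ((Real.sqrt (p.βmm m m') : ℝ) : ℂ) • S.Hmm ω m m'

/-- Pilot matrices received in the uplink training at the UT and at MN `m`. -/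
def Ytr (ω : Ω) : Matrix (Fin Nt) (Fin τr) ℂ := ((p.ampUL : ℝ) : ℂ) • (S.Gtr p ω * p.φᴴ) + S.Wt ω

def Ymr (m : Fin M) (ω : Ω) : Matrix (Fin N) (Fin τr) ℂ :=
  ((p.ampUL : ℝ) : ℂ) • (S.Gmr p m ω * p.φᴴ) + S.Wul ω m

/-- Channel estimates `Ĝ_{tr}` at the UT and `Ĝ_{mr}` at MN `m`. -/
def Gtrhat (ω : Ω) : Matrix (Fin Nt) (Fin Nr) ℂ := ((p.gain p.βtr : ℝ) : ℂ) • (S.Ytr p ω * p.φ)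

def Gmrhat (m : Fin M) (ω : Ω) : Matrix (Fin N) (Fin Nr) ℂ :=
  ((p.gain (p.βmr m) : ℝ) : ℂ) • (S.Ymr p m ω * p.φ)

/-- The precoding matrix with normalized columns. -/
def W (ω : Ω) : Matrix (Fin Nt) (Fin Nr) ℂ := normalizeCols (p.precoder (S.Gtrhat p ω))

/-- Effective channels `A_r = G_{tr}ᴴ W` and `B_m = G_{tm}ᴴ W`. -/
def A (ω : Ω) : Matrix (Fin Nr) (Fin Nr) ℂ := (S.Gtr p ω)ᴴ * S.W p ω

def B (m : Fin M) (ω : Ω) : Matrix (Fin N) (Fin Nr) ℂ := (S.Gtm p m ω)ᴴ * S.W p ω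

/-- The beamforming pilots received at MN `m`, projected on `Φ`. -/
def Ymt (m : Fin M) (ω : Ω) : Matrix (Fin N) (Fin Nr) ℂ :=
  (((p.ampDL : ℝ) : ℂ) • ((S.Gtm p m ω)ᴴ * S.W p ω * p.Φ) + S.Wdl ω m) * p.Φᴴ

/-- `b_i`, where `b_iᴴ` is the `i`-th row of `B_m`. -/
def b (m : Fin M) (i : Fin N) (ω : Ω) : Fin Nr → ℂ := star (S.B p m ω i)

/-- `E{b_i}`. -/
def bMean (m : Fin M) (i : Fin N) : Fin Nr → ℂ := fun n => ∫ ω, S.b p m i ω n ∂P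

/-- The covariance matrix of `b_i`. -/
def bCov (m : Fin M) (i : Fin N) : Matrix (Fin Nr) (Fin Nr) ℂ :=
  expMat P fun ω => outer (S.b p m i ω - S.bMean p m i) (S.b p m i ω - S.bMean p m i)

/-- The MMSE estimate of `b_i` from the observation `√(τt ρt) b_i + noise`. -/
def bhat (m : Fin M) (i : Fin N) (ω : Ω) : Fin Nr → ℂ :=
  S.bMean p m i + ((p.ampDL : ℝ) : ℂ) •
    ((S.bCov p m i * (((τt * p.ρt : ℝ) : ℂ) • S.bCov p m i + 1)⁻¹) *ᵥ
      (star (S.Ymt p m ω i) - ((p.ampDL : ℝ) : ℂ) • S.bMean p m i))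

/-- `B̂_m`, with rows `b̂_iᴴ`. -/
def Bhat (m : Fin M) (ω : Ω) : Matrix (Fin N) (Fin Nr) ℂ :=
  Matrix.of fun i => star (S.bhat p m i ω)

/-- The MMSE combining matrix of MN `m`. -/
def V (m : Fin M) (ω : Ω) : Matrix (Fin N) (Fin Nr) ℂ :=
  S.Bhat p m ω * ((S.Bhat p m ω)ᴴ * S.Bhat p m ω + ((p.reg : ℝ) : ℂ) • 1)⁻¹

/-- The signal transmitted by the UT. -/
def st (ω : Ω) : Fin Nt → ℂ :=
  ((Real.sqrt p.ρt : ℝ) : ℂ) • ((S.W p ω * p.sqrtLam) *ᵥ S.x ω)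

/-- The jamming signal transmitted by MN `m`. -/
def sJ (m : Fin M) (ω : Ω) : Fin N → ℂ :=
  ((1 - p.α m) * ((Real.sqrt p.ρJ : ℝ) : ℂ)) • ((S.Gmrhat p m ω * p.sqrtPow m) *ᵥ S.xJ ω)

/-- The signal received at the UR. -/
def yr (ω : Ω) : Fin Nr → ℂ :=
  (S.Gtr p ω)ᴴ *ᵥ S.st p ω + ∑ m, (S.Gmr p m ω)ᴴ *ᵥ S.sJ p m ω + S.wr ω

/-- The signal received at MN `m`. -/
def ym (m : Fin M) (ω : Ω) : Fin N → ℂ :=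
  p.α m • ((S.Gtm p m ω)ᴴ *ᵥ S.st p ω) + ∑ m', (S.Gmm p m m' ω)ᴴ *ᵥ S.sJ p m' ω + S.wm ω m

/-- The signal aggregated at the CPU. -/
def zc (ω : Ω) : Fin Nr → ℂ := ∑ m, p.α m • ((S.V p m ω)ᴴ *ᵥ S.ym p m ω)

/-- Effective jamming channel to the UR. -/
def FJr (ω : Ω) : Matrix (Fin Nr) (Fin Nr) ℂ :=
  ∑ m, (1 - p.α m) • ((S.Gmr p m ω)ᴴ * S.Gmrhat p m ω * p.sqrtPow m)

/-- Effective jamming channel to MN `m`. -/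
def FJm (m : Fin M) (ω : Ω) : Matrix (Fin N) (Fin Nr) ℂ :=
  ∑ m', (1 - p.α m') • ((S.Gmm p m m' ω)ᴴ * S.Gmrhat p m' ω * p.sqrtPow m')

/-- `D = ∑ m, α_m V_mᴴ B_m Λ_r^{1/2}`. -/
def D (ω : Ω) : Matrix (Fin Nr) (Fin Nr) ℂ :=
  ∑ m, p.α m • ((S.V p m ω)ᴴ * S.B p m ω * p.sqrtLam)

section SideInformation

variable {T : Type*} [MeasurableSpace T] (Θ : Ω → T)

/-- The effective noise covariance at the UR. -/
def Psir (ω : Ω) : Matrix (Fin Nr) (Fin Nr) ℂ :=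
  1 + (p.ρJ : ℂ) • condMat P Θ (fun ω' => S.FJr p ω' * (S.FJr p ω')ᴴ) ω
    + (p.ρt : ℂ) • condMat P Θ (fun ω' => S.A p ω' * p.Lam * (S.A p ω')ᴴ) ω
    - (p.ρt : ℂ) • (condMat P Θ (fun ω' => S.A p ω' * p.sqrtLam) ω *
        (condMat P Θ (fun ω' => S.A p ω' * p.sqrtLam) ω)ᴴ)

/-- `Psir` with the unconditional jamming covariance. -/
def PsirUncond (ω : Ω) : Matrix (Fin Nr) (Fin Nr) ℂ :=
  1 + (p.ρJ : ℂ) • expMat P (fun ω' => S.FJr p ω' * (S.FJr p ω')ᴴ)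
    + (p.ρt : ℂ) • condMat P Θ (fun ω' => S.A p ω' * p.Lam * (S.A p ω')ᴴ) ω
    - (p.ρt : ℂ) • (condMat P Θ (fun ω' => S.A p ω' * p.sqrtLam) ω *
        (condMat P Θ (fun ω' => S.A p ω' * p.sqrtLam) ω)ᴴ)

def Upsilonr (ω : Ω) : Matrix (Fin Nr) (Fin Nr) ℂ :=
  (p.ρt : ℂ) • (condMat P Θ (fun ω' => p.sqrtLam * (S.A p ω')ᴴ) ω * (S.Psir p Θ ω)⁻¹ *
    condMat P Θ (fun ω' => S.A p ω' * p.sqrtLam) ω)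

/-- The effective noise covariance at the CPU. -/
def Psic (ω : Ω) : Matrix (Fin Nr) (Fin Nr) ℂ :=
  (p.ρJ : ℂ) • condMat P Θ (fun ω' => ∑ m, ∑ l, (p.α m * p.α l) •
      ((S.V p m ω')ᴴ * S.FJm p m ω' * (S.FJm p l ω')ᴴ * S.V p l ω')) ω
    + (p.ρt : ℂ) • condMat P Θ (fun ω' => S.D p ω' * (S.D p ω')ᴴ) ω
    + condMat P Θ (fun ω' => ∑ m, p.α m • ((S.V p m ω')ᴴ * S.V p m ω')) ω
    - (p.ρt : ℂ) • (condMat P Θ (S.D p) ω * condMat P Θ (fun ω' => (S.D p ω')ᴴ) ω)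

def Upsilonc (ω : Ω) : Matrix (Fin Nr) (Fin Nr) ℂ :=
  (p.ρt : ℂ) • (condMat P Θ (fun ω' => (S.D p ω')ᴴ) ω * (S.Psic p Θ ω)⁻¹ *
    condMat P Θ (S.D p) ω)

/-- The SE expression `(1 - (τt + τr)/τ) E{log₂ det (I + Υ_r)}` at the UR. -/
def SEr : ℝ := p.prelog * ∫ ω, log2det (1 + S.Upsilonr p Θ ω) ∂P

/-- The SE expression `(1 - (τt + τr)/τ) E{log₂ det (I + Υ_c)}` at the CPU. -/
def SEc : ℝ := p.prelog * ∫ ω, log2det (1 + S.Upsilonc p Θ ω) ∂P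

end SideInformation

end Model

end Surveillance

end

/-
With the symbols, the jamming symbols and the noise stacked into one white vector `u`, both
observations have the form `y = R u`, where the random matrix `R` and the side information are
independent of `u`. Conditionally on the side information, `y` therefore has the covariance
`E{R Rᴴ | Θ} = Ψ + Ḡ Ḡᴴ`, with `Ḡ` the conditional mean of the gain, and the matrix inversion lemma
identifies the conditional error covariance of the linear MMSE detector as `Q⁻¹`,
where `Q = I + Ḡᴴ Ψ⁻¹ Ḡ = I + Υ`.

For achievability, the Donsker–Varadhan inequality compares the joint law of `x` and the detector
output with the auxiliary Gaussian posterior `CN(x̂, Q⁻¹)`. Both quadratic forms in its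
log-likelihood ratio to the prior have expectation `N_r`, so that `E{log det Q}` remains as a lower
bound on the mutual information, whatever the true posterior is.

Integrability of `log det Q` holds because the noise reaching the detector passes through the same
matrix `L` as the useful signal `L B x`; hence `Υ ≤ E{Bᴴ B | Θ}`, even where `Ψ` is singular.
-/

namespace Surveillance

section MatrixAlgebra

open scoped ComplexOrder

variable {𝕜 ι κ : Type*} [RCLike 𝕜]

lemma posSemidef_sub_mul_conjTranspose [Finite ι] [Fintype κ] [DecidableEq κ] {A : Matrix ι ι 𝕜}
    {E : Matrix ι κ 𝕜} (h : (fromBlocks A E Eᴴ (1 : Matrix κ κ 𝕜)).PosSemidef) :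
    (A - E * Eᴴ).PosSemidef := by
  have := Fintype.ofFinite ι
  have : Invertible (1 : Matrix κ κ 𝕜) := invertibleOne
  simpa using (PosDef.fromBlocks₂₂ A E PosDef.one).1 h

lemma posSemidef_fromBlocks_diagonal [Finite ι] [Finite κ] {A : Matrix ι ι 𝕜} {B : Matrix κ κ 𝕜}
    (hA : A.PosSemidef) (hB : B.PosSemidef) : (fromBlocks A 0 0 B).PosSemidef := by
  classical
  have := Fintype.ofFinite ι
  have := Fintype.ofFinite κ
  have h : fromBlocks A 0 0 B
      = fromRows (1 : Matrix ι ι 𝕜) (0 : Matrix κ ι 𝕜) * A *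
          (fromRows (1 : Matrix ι ι 𝕜) (0 : Matrix κ ι 𝕜))ᴴ
        + fromRows (0 : Matrix ι κ 𝕜) (1 : Matrix κ κ 𝕜) * B *
          (fromRows (0 : Matrix ι κ 𝕜) (1 : Matrix κ κ 𝕜))ᴴ := by
    rw [fromRows_mul _ _ A, fromRows_mul _ _ B]
    simp [conjTranspose_fromRows_eq_fromCols_conjTranspose, fromRows_mul_fromCols, fromBlocks_add,
      -fromRows_mul, -mul_fromCols]
  rw [h]
  exact (hA.mul_mul_conjTranspose_same _).add (hB.mul_mul_conjTranspose_same _)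

lemma trace_re_le_of_posSemidef_sub [Fintype ι] {A B : Matrix ι ι ℂ} (h : (B - A).PosSemidef) :
    A.trace.re ≤ B.trace.re := by
  simpa [trace_sub] using (Complex.nonneg_iff.1 h.trace_nonneg).1

variable [Fintype ι] [DecidableEq ι]

lemma posSemidef_sub_conjTranspose_mul_inv_mul [Finite κ] {Ψ K : Matrix ι ι 𝕜} {E : Matrix ι κ 𝕜}
    {G : Matrix κ κ 𝕜} (hΨ : Ψ.PosDef) (hK : (Ψ - K).PosSemidef)
    (h : (fromBlocks K E Eᴴ G).PosSemidef) : (G - Eᴴ * Ψ⁻¹ * E).PosSemidef := by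
  have := Fintype.ofFinite κ
  have := hΨ.isUnit.invertible
  rw [← PosDef.fromBlocks₁₁ E G hΨ]
  simpa only [fromBlocks_add, add_sub_cancel, add_zero] using
    h.add (posSemidef_fromBlocks_diagonal hK (PosSemidef.zero (n := κ)))

lemma ofReal_det_re {Q : Matrix ι ι ℂ} (hQ : Q.IsHermitian) : ((Q.det.re : ℝ) : ℂ) = Q.det := by
  rw [hQ.det_eq_prod_eigenvalues]
  norm_cast

lemma det_re_pos {Q : Matrix ι ι ℂ} (hQ : Q.PosDef) : 0 < Q.det.re :=
  (Complex.pos_iff.1 hQ.det_pos).1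

lemma det_inv_re {Q : Matrix ι ι ℂ} (hQ : Q.IsHermitian) : (Q⁻¹).det.re = (Q.det.re)⁻¹ := by
  rw [det_nonsing_inv, Ring.inverse_eq_inv', ← ofReal_det_re hQ, ← Complex.ofReal_inv,
    Complex.ofReal_re, Complex.ofReal_re]

lemma log_det_le_trace_sub_card {Q : Matrix ι ι ℂ} (hQ : Q.PosDef) :
    Real.log Q.det.re ≤ Q.trace.re - Fintype.card ι := by
  rw [hQ.1.det_eq_prod_eigenvalues, hQ.1.trace_eq_sum_eigenvalues]
  simp only [Complex.coe_algebraMap, ← Complex.ofReal_prod, ← Complex.ofReal_sum,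
    Complex.ofReal_re]
  rw [Real.log_prod fun i _ => (hQ.eigenvalues_pos i).ne']
  calc ∑ i, Real.log (hQ.1.eigenvalues i) ≤ ∑ i, (hQ.1.eigenvalues i - 1) :=
        Finset.sum_le_sum fun i _ => Real.log_le_sub_one_of_pos (hQ.eigenvalues_pos i)
    _ = ∑ i, hQ.1.eigenvalues i - Fintype.card ι := by simp

lemma card_sub_trace_inv_le_log_det {Q : Matrix ι ι ℂ} (hQ : Q.PosDef) :
    Fintype.card ι - (Q⁻¹).trace.re ≤ Real.log Q.det.re := by
  have h := log_det_le_trace_sub_card hQ.inv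
  rw [det_inv_re hQ.1, Real.log_inv] at h
  linarith

end MatrixAlgebra

section EntryMeasurable

variable {Ω ι κ η : Type*} {m : MeasurableSpace Ω}

/-- A random matrix all of whose entries are measurable. A predicate rather than `Measurable`, so
that it applies to every σ-algebra on `Ω` and every index type. -/
def EntryMeasurable (m : MeasurableSpace Ω) (X : Ω → Matrix ι κ ℂ) : Prop :=
  ∀ i j, Measurable[m] fun ω => X ω i j

namespace EntryMeasurable

lemma mono {m' : MeasurableSpace Ω} {X : Ω → Matrix ι κ ℂ} (hX : EntryMeasurable m X)
    (hm : m ≤ m') : EntryMeasurable m' X := fun i j => (hX i j).mono hm le_rfl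

lemma const (A : Matrix ι κ ℂ) : EntryMeasurable m fun _ => A := fun _ _ => measurable_const

lemma add {X Y : Ω → Matrix ι κ ℂ} (hX : EntryMeasurable m X) (hY : EntryMeasurable m Y) :
    EntryMeasurable m fun ω => X ω + Y ω := fun i j => (hX i j).add (hY i j)

lemma sub {X Y : Ω → Matrix ι κ ℂ} (hX : EntryMeasurable m X) (hY : EntryMeasurable m Y) :
    EntryMeasurable m fun ω => X ω - Y ω := fun i j => (hX i j).sub (hY i j)

lemma smul {X : Ω → Matrix ι κ ℂ} (c : ℂ) (hX : EntryMeasurable m X) :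
    EntryMeasurable m fun ω => c • X ω := fun i j => (hX i j).const_mul c

lemma conjTranspose {X : Ω → Matrix ι κ ℂ} (hX : EntryMeasurable m X) :
    EntryMeasurable m fun ω => (X ω)ᴴ := fun i j =>
  Complex.continuous_conj.measurable.comp (hX j i)

lemma mul [Fintype κ] {X : Ω → Matrix ι κ ℂ} {Y : Ω → Matrix κ η ℂ} (hX : EntryMeasurable m X)
    (hY : EntryMeasurable m Y) : EntryMeasurable m fun ω => X ω * Y ω := fun i j => by
  simp only [mul_apply]
  exact Finset.measurable_fun_sum _ fun l _ => (hX i l).mul (hY l j)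

lemma sum {ν : Type*} (s : Finset ν) {X : ν → Ω → Matrix ι κ ℂ}
    (hX : ∀ a, EntryMeasurable m (X a)) :
    EntryMeasurable m fun ω => ∑ a ∈ s, X a ω := fun i j => by
  simp only [Matrix.sum_apply]
  exact Finset.measurable_fun_sum _ fun a _ => hX a i j

lemma trace [Fintype ι] {X : Ω → Matrix ι ι ℂ} (hX : EntryMeasurable m X) :
    Measurable[m] fun ω => (X ω).trace := Finset.measurable_fun_sum _ fun i _ => hX i i

lemma det [Fintype ι] [DecidableEq ι] {X : Ω → Matrix ι ι ℂ} (hX : EntryMeasurable m X) :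
    Measurable[m] fun ω => (X ω).det := by
  simp only [det_apply]
  exact Finset.measurable_fun_sum _ fun σ _ =>
    (Finset.measurable_fun_prod _ fun i _ => hX (σ i) i).const_smul _

lemma inv [Fintype ι] [DecidableEq ι] {X : Ω → Matrix ι ι ℂ} (hX : EntryMeasurable m X) :
    EntryMeasurable m fun ω => (X ω)⁻¹ := fun i j => by
  simp only [inv_def, Ring.inverse_eq_inv', Matrix.smul_apply, adjugate_apply, smul_eq_mul]
  refine hX.det.inv.mul (det fun a b => ?_)
  simp only [updateRow_apply]
  split_ifs
  exacts [measurable_const, hX a b]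

lemma mulVec [Fintype κ] {X : Ω → Matrix ι κ ℂ} {v : Ω → κ → ℂ} (hX : EntryMeasurable m X)
    (hv : Measurable[m] v) : Measurable[m] fun ω => X ω *ᵥ v ω :=
  measurable_pi_lambda _ fun i => Finset.measurable_fun_sum _ fun j _ =>
    (hX i j).mul ((measurable_pi_apply j).comp hv)

lemma exists_eq_comp {T : Type*} [mT : MeasurableSpace T] {Θ : Ω → T} {X : Ω → Matrix ι κ ℂ}
    (hX : EntryMeasurable (mT.comap Θ) X) :
    ∃ X' : T → Matrix ι κ ℂ, EntryMeasurable mT X' ∧ X = X' ∘ Θ := by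
  choose f hf h using fun i j => (hX i j).exists_eq_measurable_comp
  refine ⟨fun t => Matrix.of fun i j => f i j t, hf, ?_⟩
  ext ω i j
  exact congr_fun (h i j) ω

end EntryMeasurable

end EntryMeasurable

section EntryMemLp

variable {Ω ι κ η : Type*} {mΩ : MeasurableSpace Ω} {P : Measure Ω} {p q r : ℝ≥0∞}

/-- A random matrix all of whose entries are in `L^p`. -/
def EntryMemLp (X : Ω → Matrix ι κ ℂ) (p : ℝ≥0∞) (P : Measure Ω) : Prop :=
  ∀ i j, MemLp (fun ω => X ω i j) p P

namespace EntryMemLp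

lemma const [IsFiniteMeasure P] (A : Matrix ι κ ℂ) : EntryMemLp (fun _ : Ω => A) p P :=
  fun i j => memLp_const (A i j)

lemma add {X Y : Ω → Matrix ι κ ℂ} (hX : EntryMemLp X p P) (hY : EntryMemLp Y p P) :
    EntryMemLp (fun ω => X ω + Y ω) p P := fun i j => (hX i j).add (hY i j)

lemma sub {X Y : Ω → Matrix ι κ ℂ} (hX : EntryMemLp X p P) (hY : EntryMemLp Y p P) :
    EntryMemLp (fun ω => X ω - Y ω) p P := fun i j => (hX i j).sub (hY i j)

lemma smul {X : Ω → Matrix ι κ ℂ} (hX : EntryMemLp X p P) (c : ℂ) :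
    EntryMemLp (fun ω => c • X ω) p P := fun i j => (hX i j).const_mul c

lemma conjTranspose {X : Ω → Matrix ι κ ℂ} (hX : EntryMemLp X p P) :
    EntryMemLp (fun ω => (X ω)ᴴ) p P := fun i j => (hX j i).star

lemma mul [Fintype κ] [ENNReal.HolderTriple p q r] {X : Ω → Matrix ι κ ℂ} {Y : Ω → Matrix κ η ℂ}
    (hX : EntryMemLp X p P) (hY : EntryMemLp Y q P) : EntryMemLp (fun ω => X ω * Y ω) r P :=
  fun i j => by
    simp only [mul_apply]
    exact memLp_finsetSum _ fun l _ => (hY l j).mul (hX i l)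

lemma sum {ν : Type*} (s : Finset ν) {X : ν → Ω → Matrix ι κ ℂ}
    (hX : ∀ a, EntryMemLp (X a) p P) : EntryMemLp (fun ω => ∑ a ∈ s, X a ω) p P := fun i j => by
  simp only [Matrix.sum_apply]
  exact memLp_finsetSum _ fun a _ => hX a i j

lemma fromRows {X : Ω → Matrix ι η ℂ} {Y : Ω → Matrix κ η ℂ} (hX : EntryMemLp X p P)
    (hY : EntryMemLp Y p P) : EntryMemLp (fun ω => (X ω).fromRows (Y ω)) p P := fun i j => by
  cases i
  exacts [hX _ j, hY _ j]

lemma integrable {X : Ω → Matrix ι κ ℂ} (hX : EntryMemLp X 1 P) (i : ι) (j : κ) :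
    Integrable (fun ω => X ω i j) P := memLp_one_iff_integrable.1 (hX i j)

lemma integrable_trace [Fintype ι] {X : Ω → Matrix ι ι ℂ} (hX : EntryMemLp X 1 P) :
    Integrable (fun ω => (X ω).trace) P := integrable_finsetSum _ fun i _ => hX.integrable i i

end EntryMemLp

end EntryMemLp

section BilinearPairing

variable {Ω E F G : Type*} {m mΩ : MeasurableSpace Ω} {P : Measure Ω}
  [NormedAddCommGroup E] [NormedSpace ℝ E] [NormedAddCommGroup F] [NormedSpace ℝ F]
  [NormedAddCommGroup G] [NormedSpace ℝ G] {f : Ω → F} {g : Ω → E}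

lemma integrable_bilin_of_norm_le (B : F →L[ℝ] E →L[ℝ] G) (hf : AEStronglyMeasurable f P)
    (hg : Integrable g P) {C : ℝ} (hC : ∀ ω, ‖f ω‖ ≤ C) :
    Integrable (fun ω => B (f ω) (g ω)) P :=
  (hg.norm.const_mul (‖B‖ * C)).mono' (B.aestronglyMeasurable_comp₂ hf hg.1)
    (.of_forall fun ω => (B.le_opNorm₂ _ _).trans (by gcongr; exact hC ω))

lemma setIntegral_bilin_condExp [CompleteSpace E] [CompleteSpace G] (B : F →L[ℝ] E →L[ℝ] G)
    (hm : m ≤ mΩ) [SigmaFinite (P.trim hm)] (hf : StronglyMeasurable[m] f) (hg : Integrable g P)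
    {C : ℝ} (hC : ∀ ω, ‖f ω‖ ≤ C) {s : Set Ω} (hs : MeasurableSet[m] s) :
    ∫ ω in s, B (f ω) ((P[g | m]) ω) ∂P = ∫ ω in s, B (f ω) (g ω) ∂P := by
  have hint := integrable_bilin_of_norm_le B (hf.mono hm).aestronglyMeasurable hg hC
  rw [← setIntegral_condExp hm hint hs]
  exact setIntegral_congr_ae (hm _ hs)
    ((condExp_bilin_of_stronglyMeasurable_left B hf hint hg).mono fun _ h _ => h.symm)

/-- Truncating `f` makes the pairing integrable; positivity turns the truncated integrals into
integrals of norms, which the integral of `B f (P[g | m])` bounds. -/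
lemma integrable_bilin_of_nonneg [CompleteSpace E] (B : F →L[ℝ] E →L[ℝ] ℝ) (hm : m ≤ mΩ)
    [SigmaFinite (P.trim hm)] (hf : StronglyMeasurable[m] f) (hg : Integrable g P)
    (hpos : ∀ᵐ ω ∂P, 0 ≤ B (f ω) (g ω))
    (hint : Integrable (fun ω => B (f ω) ((P[g | m]) ω)) P) :
    Integrable (fun ω => B (f ω) (g ω)) P := by
  let s : ℕ → Set Ω := fun n => {ω | ‖f ω‖ ≤ n}
  have hs : ∀ n, MeasurableSet[m] (s n) := fun n => hf.norm.measurable measurableSet_Iic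
  have hcover : AECover P Filter.atTop s := ⟨.of_forall fun ω =>
    (Filter.eventually_ge_atTop ⌈‖f ω‖⌉₊).mono fun n hn => Nat.ceil_le.1 hn, fun n => hm _ (hs n)⟩
  have hbdd : ∀ n ω, ‖(s n).indicator f ω‖ ≤ n := fun n ω => by
    by_cases h : ω ∈ s n
    · rw [Set.indicator_of_mem h]
      exact h
    · simp [Set.indicator_of_notMem h]
  have htrunc : ∀ n (h : Ω → E),
      Set.EqOn (fun ω => B ((s n).indicator f ω) (h ω)) (fun ω => B (f ω) (h ω)) (s n) :=
    fun n h ω hω => by simp [hω]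
  have hind : ∀ n, StronglyMeasurable[m] ((s n).indicator f) := fun n => hf.indicator (hs n)
  have hfi : ∀ n, IntegrableOn (fun ω => B (f ω) (g ω)) (s n) P := fun n =>
    (integrable_bilin_of_norm_le B ((hind n).mono hm).aestronglyMeasurable hg
      (hbdd n)).integrableOn.congr_fun (htrunc n g) (hm _ (hs n))
  refine hcover.integrable_of_integral_norm_bounded
    (∫ ω, ‖B (f ω) ((P[g | m]) ω)‖ ∂P) hfi (.of_forall fun n => ?_)
  calc ∫ ω in s n, ‖B (f ω) (g ω)‖ ∂P = ∫ ω in s n, B (f ω) (g ω) ∂P :=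
        setIntegral_congr_ae (hm _ (hs n)) (hpos.mono fun ω h _ => Real.norm_of_nonneg h)
    _ = ∫ ω in s n, B (f ω) ((P[g | m]) ω) ∂P := by
        rw [← setIntegral_congr_fun (hm _ (hs n)) (htrunc n g),
          ← setIntegral_congr_fun (hm _ (hs n)) (htrunc n _)]
        exact (setIntegral_bilin_condExp B hm (hind n) hg (hbdd n) (hs n)).symm
    _ ≤ ‖∫ ω in s n, B (f ω) ((P[g | m]) ω) ∂P‖ := Real.le_norm_self _
    _ ≤ ∫ ω in s n, ‖B (f ω) ((P[g | m]) ω)‖ ∂P := norm_integral_le_integral_norm _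
    _ ≤ ∫ ω, ‖B (f ω) ((P[g | m]) ω)‖ ∂P :=
        setIntegral_le_integral hint.norm (.of_forall fun _ => norm_nonneg _)

end BilinearPairing

section CondExpMat

variable {Ω : Type*} {m 𝓢 mΩ : MeasurableSpace Ω} {P : Measure Ω} {ι κ ν η : Type*}

/-- Entrywise conditional expectation of a random matrix given a σ-algebra; `condMat P Θ` is the
case of the σ-algebra generated by `Θ`. -/
noncomputable def condExpMat (P : Measure Ω) (m : MeasurableSpace Ω) (X : Ω → Matrix ι κ ℂ) :
    Ω → Matrix ι κ ℂ :=
  fun ω => Matrix.of fun i j => (P[fun ω' => X ω' i j | m]) ω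

lemma EntryMeasurable.condExpMat (P : Measure Ω) (X : Ω → Matrix ι κ ℂ) :
    EntryMeasurable m (condExpMat P m X) := fun _ _ => stronglyMeasurable_condExp.measurable

lemma EntryMemLp.condExpMat {X : Ω → Matrix ι κ ℂ} : EntryMemLp (condExpMat P m X) 1 P :=
  fun _ _ => memLp_one_iff_integrable.2 integrable_condExp

lemma condExpMat_ae_eq_iff [Finite ι] [Finite κ] {X Y : Ω → Matrix ι κ ℂ} :
    condExpMat P m X =ᵐ[P] Y ↔
      ∀ i j, P[fun ω => X ω i j | m] =ᵐ[P] fun ω => Y ω i j := by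
  simp only [Filter.EventuallyEq, ← Matrix.ext_iff, ae_all_iff]
  rfl

lemma condExpMat_const [IsFiniteMeasure P] (hm : m ≤ mΩ) (A : Matrix ι κ ℂ) :
    condExpMat P m (fun _ => A) = fun _ => A := by
  ext ω i j
  exact congr_fun (condExp_const hm (A i j)) ω

section Linear

variable [Finite ι] [Finite κ] {X Y : Ω → Matrix ι κ ℂ}

lemma condExpMat_congr_ae (h : X =ᵐ[P] Y) : condExpMat P m X =ᵐ[P] condExpMat P m Y :=
  condExpMat_ae_eq_iff.2 fun i j =>
    condExp_congr_ae (h.mono fun _ hω => congr_fun (congr_fun hω i) j)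

lemma condExpMat_condExpMat_of_le (hm : m ≤ 𝓢) (h𝓢 : 𝓢 ≤ mΩ) [SigmaFinite (P.trim h𝓢)] :
    condExpMat P m (condExpMat P 𝓢 X) =ᵐ[P] condExpMat P m X :=
  condExpMat_ae_eq_iff.2 fun _ _ => condExp_condExp_of_le hm h𝓢

lemma condExpMat_conjTranspose (hX : EntryMemLp X 1 P) :
    condExpMat P m (fun ω => (X ω)ᴴ) =ᵐ[P] fun ω => (condExpMat P m X ω)ᴴ :=
  condExpMat_ae_eq_iff.2 fun i j =>
    (Complex.conjCLE.toContinuousLinearMap.comp_condExp_comm (hX.integrable j i)).symm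

lemma condExpMat_smul (c : ℂ) (X : Ω → Matrix ι κ ℂ) :
    condExpMat P m (fun ω => c • X ω) =ᵐ[P] fun ω => c • condExpMat P m X ω :=
  condExpMat_ae_eq_iff.2 fun i j => condExp_smul c (fun ω => X ω i j) m

lemma condExpMat_add (hX : EntryMemLp X 1 P) (hY : EntryMemLp Y 1 P) :
    condExpMat P m (fun ω => X ω + Y ω) =ᵐ[P] fun ω => condExpMat P m X ω + condExpMat P m Y ω :=
  condExpMat_ae_eq_iff.2 fun i j => condExp_add (hX.integrable i j) (hY.integrable i j) m

lemma condExpMat_sub (hX : EntryMemLp X 1 P) (hY : EntryMemLp Y 1 P) :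
    condExpMat P m (fun ω => X ω - Y ω) =ᵐ[P] fun ω => condExpMat P m X ω - condExpMat P m Y ω :=
  condExpMat_ae_eq_iff.2 fun i j => condExp_sub (hX.integrable i j) (hY.integrable i j) m

end Linear

section PullOut

variable [Fintype κ] [Fintype ν]

/-- The trace pairing `(A, X) ↦ tr (A X)`, with matrices vectorized so that they carry a norm. -/
noncomputable def tracePairing (κ ν : Type*) [Fintype κ] [Fintype ν] :
    (κ × ν → ℂ) →L[ℝ] (κ × ν → ℂ) →L[ℝ] ℂ :=
  (dotProductBilin ℝ ℝ).toContinuousBilinearMap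

lemma tracePairing_vec (A : Matrix κ ν ℂ) (X : Matrix ν κ ℂ) :
    tracePairing κ ν (vec Aᵀ) (vec X) = (A * X).trace := by
  rw [← transpose_transpose A, ← vec_dotProduct_vec, transpose_transpose]
  rfl

omit [Fintype κ] [Fintype ν] in
lemma EntryMeasurable.stronglyMeasurable_vec [Finite κ] [Finite ν] {A : Ω → Matrix κ ν ℂ}
    (hA : EntryMeasurable m A) : StronglyMeasurable[m] fun ω => vec (A ω) :=
  (measurable_pi_iff.2 fun q : ν × κ => hA q.2 q.1).stronglyMeasurable

lemma EntryMemLp.integrable_vec {X : Ω → Matrix κ ν ℂ} (hX : EntryMemLp X 1 P) :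
    Integrable (fun ω => vec (X ω)) P := .of_eval fun q => hX.integrable q.2 q.1

lemma condExp_vec {X : Ω → Matrix κ ν ℂ} (hX : EntryMemLp X 1 P) :
    P[fun ω => vec (X ω) | m] =ᵐ[P] fun ω => vec (condExpMat P m X ω) := by
  filter_upwards [ae_all_iff.2 fun q : ν × κ => (ContinuousLinearMap.proj (R := ℝ)
    (φ := fun _ : ν × κ => ℂ) q).comp_condExp_comm (m := m) hX.integrable_vec] with ω h
  exact funext h

variable {A : Ω → Matrix κ ν ℂ} {X : Ω → Matrix ν κ ℂ}

lemma condExp_trace_mul (hA : EntryMeasurable m A) (hX : EntryMemLp X 1 P)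
    (hAX : Integrable (fun ω => (A ω * X ω).trace) P) :
    P[fun ω => (A ω * X ω).trace | m] =ᵐ[P] fun ω => (A ω * condExpMat P m X ω).trace := by
  simp only [← tracePairing_vec] at hAX ⊢
  filter_upwards [condExp_bilin_of_stronglyMeasurable_left (tracePairing κ ν)
    (EntryMeasurable.stronglyMeasurable_vec (A := fun ω => (A ω)ᵀ) fun i j => hA j i) hAX
    hX.integrable_vec,
    condExp_vec (m := m) hX] with ω h h'
  rw [h, h']

open scoped ComplexOrder in
lemma integrable_trace_mul_of_nonneg (hm : m ≤ mΩ) [SigmaFinite (P.trim hm)]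
    (hA : EntryMeasurable m A) (hX : EntryMemLp X 1 P) (hpos : ∀ᵐ ω ∂P, 0 ≤ (A ω * X ω).trace)
    (hint : Integrable (fun ω => (A ω * condExpMat P m X ω).trace) P) :
    Integrable (fun ω => (A ω * X ω).trace) P := by
  let B := (ContinuousLinearMap.compL ℝ _ ℂ ℝ Complex.reCLM).comp (tracePairing κ ν)
  have hB : ∀ A' X', B (vec A'ᵀ) (vec X') = (A' * X').trace.re := fun A' X' =>
    congr_arg Complex.re (tracePairing_vec A' X')
  have hre : Integrable (fun ω => (A ω * X ω).trace.re) P := by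
    simp only [← hB]
    refine integrable_bilin_of_nonneg B hm
      (EntryMeasurable.stronglyMeasurable_vec (A := fun ω => (A ω)ᵀ) fun i j => hA j i)
      hX.integrable_vec ?_ ?_
    · filter_upwards [hpos] with ω h
      rw [hB]
      exact (Complex.nonneg_iff.1 h).1
    · refine hint.re.congr ?_
      filter_upwards [condExp_vec (m := m) hX] with ω h
      rw [h, hB]
      rfl
  exact hre.ofReal.congr
    (hpos.mono fun ω h => (Complex.eq_re_of_ofReal_le h).symm)

lemma mul_mul_apply_eq_trace (A : Matrix ι κ ℂ) (X : Matrix κ ν ℂ) (C : Matrix ν η ℂ) (i : ι)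
    (j : η) : (A * X * C) i j = (vecMulVec (C.col j) (A.row i) * X).trace := by
  rw [vecMulVec_mul, trace_vecMulVec, dotProduct_comm]
  rfl

lemma condExpMat_mul_mul [Finite ι] [Finite η] {A : Ω → Matrix ι κ ℂ} {X : Ω → Matrix κ ν ℂ}
    {C : Ω → Matrix ν η ℂ} (hA : EntryMeasurable m A) (hX : EntryMemLp X 1 P)
    (hC : EntryMeasurable m C) (h : EntryMemLp (fun ω => A ω * X ω * C ω) 1 P) :
    condExpMat P m (fun ω => A ω * X ω * C ω) =ᵐ[P] fun ω => A ω * condExpMat P m X ω * C ω := by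
  refine condExpMat_ae_eq_iff.2 fun i j => ?_
  have hij := h.integrable i j
  simp only [mul_mul_apply_eq_trace] at hij ⊢
  exact condExp_trace_mul (fun k l => (hC k j).mul (hA i l)) hX hij

omit [Fintype ν] in
lemma condExpMat_mul_left [Finite ι] [Finite ν] {A : Ω → Matrix ι κ ℂ} {X : Ω → Matrix κ ν ℂ}
    (hA : EntryMeasurable m A) (hX : EntryMemLp X 1 P)
    (h : EntryMemLp (fun ω => A ω * X ω) 1 P) :
    condExpMat P m (fun ω => A ω * X ω) =ᵐ[P] fun ω => A ω * condExpMat P m X ω := by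
  classical
  have := Fintype.ofFinite ν
  simpa only [Matrix.mul_one] using
    condExpMat_mul_mul hA hX (.const (1 : Matrix ν ν ℂ)) (by simpa only [Matrix.mul_one] using h)

end PullOut

section Positivity

open scoped ComplexOrder

lemma condExp_nonneg_of_nonneg {f : Ω → ℂ} (hf : Integrable f P) (hpos : ∀ᵐ ω ∂P, 0 ≤ f ω) :
    ∀ᵐ ω ∂P, 0 ≤ (P[f | m]) ω := by
  have hre : f =ᵐ[P] fun ω => ((f ω).re : ℂ) :=
    hpos.mono fun ω h => Complex.eq_re_of_ofReal_le h
  filter_upwards [(condExp_congr_ae hre).trans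
      (Complex.ofRealCLM.comp_condExp_comm (m := m) hf.re).symm,
    condExp_nonneg (m := m) (hpos.mono fun ω h => (Complex.nonneg_iff.1 h).1)] with ω h h'
  rw [h]
  exact Complex.zero_le_real.2 h'

variable {X : Ω → Matrix ι ι ℂ}

lemma condExpMat_isHermitian [Finite ι] (hX : EntryMemLp X 1 P) (h : ∀ᵐ ω ∂P, (X ω).IsHermitian) :
    ∀ᵐ ω ∂P, (condExpMat P m X ω).IsHermitian :=
  (condExpMat_conjTranspose hX).symm.trans (condExpMat_congr_ae h)

lemma condExpMat_quadraticForm_nonneg [Fintype ι] (hX : EntryMemLp X 1 P)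
    (hpos : ∀ᵐ ω ∂P, (X ω).PosSemidef) (v : ι → ℂ) :
    ∀ᵐ ω ∂P, 0 ≤ star v ⬝ᵥ (condExpMat P m X ω *ᵥ v) := by
  have htrace : ∀ A : Matrix ι ι ℂ, (vecMulVec v (star v) * A).trace = star v ⬝ᵥ (A *ᵥ v) :=
    fun A => by rw [vecMulVec_mul, trace_vecMulVec, dotProduct_comm, ← dotProduct_mulVec]
  have hint : Integrable (fun ω => (vecMulVec v (star v) * X ω).trace) P := by
    simp only [htrace, dotProduct, Matrix.mulVec, Pi.star_apply]
    exact integrable_finsetSum _ fun i _ =>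
      (integrable_finsetSum _ fun j _ => (hX.integrable i j).mul_const _).const_mul _
  filter_upwards [condExp_trace_mul (m := m) (.const _) hX hint,
    condExp_nonneg_of_nonneg (m := m) hint (hpos.mono fun ω h => by
      rw [htrace]
      exact h.dotProduct_mulVec_nonneg v)] with ω h h'
  rwa [h, htrace] at h'

lemma condExpMat_posSemidef [Finite ι] (hX : EntryMemLp X 1 P)
    (hpos : ∀ᵐ ω ∂P, (X ω).PosSemidef) : ∀ᵐ ω ∂P, (condExpMat P m X ω).PosSemidef := by
  have := Fintype.ofFinite ι
  filter_upwards [condExpMat_isHermitian (m := m) hX (hpos.mono fun _ h => h.1),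
    ae_all_iff.2 fun n => condExpMat_quadraticForm_nonneg (m := m) hX hpos
      (TopologicalSpace.denseSeq (ι → ℂ) n)] with ω hherm hquad
  refine .of_dotProduct_mulVec_nonneg hherm fun v => ?_
  have hclosed : IsClosed {v : ι → ℂ | 0 ≤ star v ⬝ᵥ (condExpMat P m X ω *ᵥ v)} :=
    isClosed_le continuous_const
      (continuous_star.dotProduct (continuous_const.matrix_mulVec continuous_id))
  exact hclosed.closure_subset_iff.2 (Set.range_subset_iff.2 hquad)
    (TopologicalSpace.denseRange_denseSeq (ι → ℂ) v)

lemma condExpMat_gram_posSemidef [Fintype ι] [Finite κ] [Finite ν] {L : Ω → Matrix κ ι ℂ}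
    {B : Ω → Matrix ν ι ℂ} (hL : EntryMemLp L 2 P) (hB : EntryMemLp B 2 P) :
    ∀ᵐ ω ∂P, (fromBlocks (condExpMat P m (fun ω => L ω * (L ω)ᴴ) ω)
      (condExpMat P m (fun ω => L ω * (B ω)ᴴ) ω) (condExpMat P m (fun ω => L ω * (B ω)ᴴ) ω)ᴴ
      (condExpMat P m (fun ω => B ω * (B ω)ᴴ) ω)).PosSemidef := by
  let Z : Ω → Matrix (κ ⊕ ν) ι ℂ := fun ω => fromRows (L ω) (B ω)
  have hZ : EntryMemLp Z 2 P := hL.fromRows hB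
  have hblocks : ∀ ω, Z ω * (Z ω)ᴴ = fromBlocks (L ω * (L ω)ᴴ) (L ω * (B ω)ᴴ) (B ω * (L ω)ᴴ)
      (B ω * (B ω)ᴴ) := fun ω => by
    rw [conjTranspose_fromRows_eq_fromCols_conjTranspose, fromRows_mul_fromCols]
  filter_upwards [condExpMat_posSemidef (m := m) (hZ.mul hZ.conjTranspose)
      (.of_forall fun ω => posSemidef_self_mul_conjTranspose (Z ω)),
    condExpMat_conjTranspose (m := m) (hL.mul hB.conjTranspose)] with ω hpos hstar
  simp only [conjTranspose_mul, conjTranspose_conjTranspose] at hstar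
  rw [← hstar]
  convert hpos using 1
  ext (i | i) (j | j) <;> simp only [condExpMat, hblocks] <;> rfl

end Positivity

end CondExpMat

section Gaussian

lemma measurable_complex_mk : Measurable fun q : ℝ × ℝ => (⟨q.1, q.2⟩ : ℂ) :=
  Complex.measurableEquivRealProd.symm.measurable

instance isProbabilityMeasure_stdCN : IsProbabilityMeasure stdCN :=
  Measure.isProbabilityMeasure_map measurable_complex_mk.aemeasurable

instance isProbabilityMeasure_stdCNVec (k : ℕ) : IsProbabilityMeasure (stdCNVec k) :=
  inferInstanceAs (IsProbabilityMeasure (Measure.pi fun _ => stdCN))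

/-- The density of `CN(0, 1)` with respect to Lebesgue measure on `ℂ`. -/
noncomputable def stdCNDensity (z : ℂ) : ℝ := Real.pi⁻¹ * Real.exp (-‖z‖ ^ 2)

lemma stdCNDensity_nonneg (z : ℂ) : 0 ≤ stdCNDensity z := by
  unfold stdCNDensity
  positivity

lemma measurable_stdCNDensity : Measurable stdCNDensity := by
  unfold stdCNDensity
  fun_prop

lemma gaussianPDF_mul_gaussianPDF (a b : ℝ) :
    gaussianPDF 0 (1 / 2) a * gaussianPDF 0 (1 / 2) b = ENNReal.ofReal (stdCNDensity ⟨a, b⟩) := by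
  have hsqrt : √(2 * Real.pi * ((1 / 2 : NNReal) : ℝ)) = √Real.pi := by
    congr 1
    push_cast
    ring
  rw [gaussianPDF, gaussianPDF, ← ENNReal.ofReal_mul (gaussianPDFReal_nonneg _ _ _)]
  simp only [gaussianPDFReal, stdCNDensity]
  rw [hsqrt, ← Complex.normSq_eq_norm_sq, Complex.normSq_mk, mul_mul_mul_comm, ← Real.exp_add,
    ← mul_inv, Real.mul_self_sqrt Real.pi_pos.le]
  congr 3
  push_cast
  ring

lemma stdCN_eq_withDensity :
    stdCN = (volume : Measure ℂ).withDensity fun z => ENNReal.ofReal (stdCNDensity z) := by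
  have hvar : (1 / 2 : NNReal) ≠ 0 := by norm_num
  ext s hs
  rw [stdCN, gaussianReal_of_var_ne_zero _ hvar,
    prod_withDensity (measurable_gaussianPDF _ _) (measurable_gaussianPDF _ _),
    Measure.map_apply measurable_complex_mk hs, withDensity_apply _ (measurable_complex_mk hs),
    withDensity_apply _ hs]
  simp only [gaussianPDF_mul_gaussianPDF]
  exact Complex.volume_preserving_equiv_real_prod.symm.setLIntegral_comp_preimage hs
    measurable_stdCNDensity.ennreal_ofReal

lemma integrable_stdCNDensity : Integrable stdCNDensity := by
  have h := measure_univ (μ := stdCN)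
  rw [stdCN_eq_withDensity, withDensity_apply _ .univ, setLIntegral_univ] at h
  refine ⟨measurable_stdCNDensity.aestronglyMeasurable, ?_⟩
  rw [hasFiniteIntegral_iff_ofReal (.of_forall stdCNDensity_nonneg), h]
  exact ENNReal.one_lt_top

variable {k : ℕ}

/-- The density of `CN(0, I_k)` with respect to Lebesgue measure on `ℂ^k`. -/
noncomputable def stdCNVecDensity (x : Fin k → ℂ) : ℝ := ∏ i, stdCNDensity (x i)

lemma stdCNVecDensity_eq (x : Fin k → ℂ) :
    stdCNVecDensity x = (Real.pi⁻¹) ^ k * Real.exp (-∑ i, ‖x i‖ ^ 2) := by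
  simp [stdCNVecDensity, stdCNDensity, Finset.prod_mul_distrib, ← Real.exp_sum]

lemma stdCNVecDensity_nonneg (x : Fin k → ℂ) : 0 ≤ stdCNVecDensity x :=
  Finset.prod_nonneg fun _ _ => stdCNDensity_nonneg _

lemma measurable_stdCNVecDensity : Measurable (stdCNVecDensity (k := k)) :=
  Finset.measurable_fun_prod _ fun i _ => measurable_stdCNDensity.comp (measurable_pi_apply i)

lemma stdCNVec_eq_withDensity (k : ℕ) :
    stdCNVec k = (volume : Measure (Fin k → ℂ)).withDensity
      fun x => ENNReal.ofReal (stdCNVecDensity x) := by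
  refine Measure.pi_eq fun s hs => ?_
  rw [withDensity_apply _ (MeasurableSet.univ_pi hs), volume_pi, Measure.restrict_pi_pi,
    ← ofReal_integral_eq_lintegral_ofReal (f := stdCNVecDensity)
      (.fintype_prod fun i => integrable_stdCNDensity.integrableOn)
      (.of_forall stdCNVecDensity_nonneg)]
  unfold stdCNVecDensity
  rw [integral_fintype_prod_eq_prod,
    ENNReal.ofReal_prod_of_nonneg fun i _ => integral_nonneg stdCNDensity_nonneg]
  refine Finset.prod_congr rfl fun i _ => ?_
  rw [stdCN_eq_withDensity, withDensity_apply _ (hs i), ofReal_integral_eq_lintegral_ofReal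
    integrable_stdCNDensity.integrableOn (.of_forall stdCNDensity_nonneg)]

lemma lintegral_stdCNVecDensity :
    ∫⁻ x : Fin k → ℂ, ENNReal.ofReal (stdCNVecDensity x) = 1 := by
  have h := measure_univ (μ := stdCNVec k)
  rwa [stdCNVec_eq_withDensity, withDensity_apply _ .univ, setLIntegral_univ] at h

/-- The change of variables `x ↦ R (x - c)` has real Jacobian `‖det R‖ ^ 2`. -/
lemma lintegral_stdCNVecDensity_mulVec {R : Matrix (Fin k) (Fin k) ℂ} (hR : IsUnit R)
    (c : Fin k → ℂ) :
    ∫⁻ x, ENNReal.ofReal (‖R.det‖ ^ 2) * ENNReal.ofReal (stdCNVecDensity (R *ᵥ (x - c))) = 1 := by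
  let L : (Fin k → ℂ) →L[ℝ] (Fin k → ℂ) :=
    ((Matrix.toLin' R).restrictScalars ℝ).toContinuousLinearMap
  have hdet : |L.det| = ‖R.det‖ ^ 2 := by
    rw [show L.det = ‖R.det‖ ^ 2 by
      rw [LinearMap.det_toContinuousLinearMap, LinearMap.det_restrictScalars,
        LinearMap.det_toLin', Algebra.norm_complex_apply, Complex.normSq_eq_norm_sq]]
    exact abs_of_nonneg (by positivity)
  have hbij : Function.Bijective fun x => R *ᵥ (x - c) :=
    ⟨(mulVec_injective_of_isUnit hR).comp (Equiv.subRight c).injective,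
      (mulVec_surjective_iff_isUnit.2 hR).comp (Equiv.subRight c).surjective⟩
  have hderiv : ∀ x ∈ Set.univ, HasFDerivWithinAt (fun x => R *ᵥ (x - c)) L Set.univ x :=
    fun x _ => (L.hasFDerivAt.comp x ((hasFDerivAt_id x).sub_const c)).hasFDerivWithinAt
  have h := lintegral_image_eq_lintegral_abs_det_fderiv_mul volume .univ hderiv
    hbij.injective.injOn fun x => ENNReal.ofReal (stdCNVecDensity x)
  simpa only [Set.image_univ, hbij.surjective.range_eq, setLIntegral_univ,
    lintegral_stdCNVecDensity, hdet] using h.symm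

/-- The log-likelihood ratio of a Gaussian posterior `CN(c, Q⁻¹)` to the prior `CN(0, I_k)`, at
the point `x`. -/
noncomputable def posteriorLogRatio (Q : Matrix (Fin k) (Fin k) ℂ) (c x : Fin k → ℂ) : ℝ :=
  Real.log Q.det.re - (star (x - c) ⬝ᵥ (Q *ᵥ (x - c))).re + ∑ i, ‖x i‖ ^ 2

lemma measurable_posteriorLogRatio {𝒰 : Type*} [MeasurableSpace 𝒰]
    {Q : 𝒰 → Matrix (Fin k) (Fin k) ℂ} (hQ : EntryMeasurable inferInstance Q)
    {c : 𝒰 → Fin k → ℂ} (hc : Measurable c) {x : 𝒰 → Fin k → ℂ} (hx : Measurable x) :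
    Measurable fun u => posteriorLogRatio (Q u) (c u) (x u) := by
  have hdet := hQ.det
  have hquad := hQ.mulVec (hx.sub hc)
  unfold posteriorLogRatio
  simp only [dotProduct, Pi.star_apply]
  fun_prop

lemma re_star_dotProduct_self (v : Fin k → ℂ) : (star v ⬝ᵥ v).re = ∑ i, ‖v i‖ ^ 2 := by
  simp [dotProduct, ← Complex.normSq_eq_norm_sq, Complex.normSq_apply]

lemma stdCNVecDensity_mul_exp_posteriorLogRatio {R : Matrix (Fin k) (Fin k) ℂ} (hR : IsUnit R)
    (c x : Fin k → ℂ) :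
    stdCNVecDensity x * Real.exp (posteriorLogRatio (Rᴴ * R) c x)
      = ‖R.det‖ ^ 2 * stdCNVecDensity (R *ᵥ (x - c)) := by
  have hdet : (Rᴴ * R).det.re = ‖R.det‖ ^ 2 := by
    rw [det_mul, det_conjTranspose, ← Complex.normSq_eq_norm_sq]
    simp [Complex.normSq_apply]
  have hdet_ne : R.det ≠ 0 := ((isUnit_iff_isUnit_det R).1 hR).ne_zero
  have hquad : star (x - c) ⬝ᵥ ((Rᴴ * R) *ᵥ (x - c))
      = star (R *ᵥ (x - c)) ⬝ᵥ (R *ᵥ (x - c)) := by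
    rw [star_mulVec, ← mulVec_mulVec, dotProduct_mulVec]
  rw [posteriorLogRatio, stdCNVecDensity_eq, stdCNVecDensity_eq, hquad, re_star_dotProduct_self,
    hdet, Real.exp_add, Real.exp_sub, Real.exp_log (by positivity), Real.exp_neg, Real.exp_neg]
  field_simp

open scoped ComplexOrder MatrixOrder in
lemma lintegral_exp_posteriorLogRatio {Q : Matrix (Fin k) (Fin k) ℂ} (hQ : Q.PosDef)
    (c : Fin k → ℂ) :
    ∫⁻ x, ENNReal.ofReal (Real.exp (posteriorLogRatio Q c x)) ∂(stdCNVec k) = 1 := by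
  obtain ⟨R, hR, rfl⟩ :=
    CStarAlgebra.isStrictlyPositive_iff_eq_star_mul_self.mp hQ.isStrictlyPositive
  have hmeas : Measurable fun x => posteriorLogRatio (star R * R) c x :=
    measurable_posteriorLogRatio (.const _) measurable_const measurable_id
  rw [stdCNVec_eq_withDensity, lintegral_withDensity_eq_lintegral_mul _
    measurable_stdCNVecDensity.ennreal_ofReal hmeas.exp.ennreal_ofReal,
    ← lintegral_stdCNVecDensity_mulVec hR c]
  refine lintegral_congr fun x => ?_
  simp only [Pi.mul_apply]
  rw [← ENNReal.ofReal_mul (stdCNVecDensity_nonneg x), ← ENNReal.ofReal_mul (by positivity),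
    star_eq_conjTranspose, stdCNVecDensity_mul_exp_posteriorLogRatio hR]

end Gaussian

section Information

open InformationTheory

/-- Donsker–Varadhan: compare `μ` with the tilted measure `exp f • ν`. -/
lemma ofReal_integral_le_klDiv {α : Type*} [MeasurableSpace α] {μ ν : Measure α}
    [IsProbabilityMeasure μ] [IsProbabilityMeasure ν] {f : α → ℝ} (hf : Integrable f μ)
    (hfm : Measurable f) (hexp : ∫⁻ a, ENNReal.ofReal (Real.exp (f a)) ∂ν = 1) :
    ENNReal.ofReal (∫ a, f a ∂μ) ≤ klDiv μ ν := by
  by_cases htop : klDiv μ ν = ∞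
  · exact htop ▸ le_top
  obtain ⟨hac, hllr⟩ := klDiv_ne_top_iff.1 htop
  have hnn : 0 ≤ᵐ[ν] fun a => Real.exp (f a) := .of_forall fun a => (Real.exp_pos _).le
  have hint : Integrable (fun a => Real.exp (f a)) ν :=
    ⟨hfm.exp.aestronglyMeasurable,
      by rw [hasFiniteIntegral_iff_ofReal hnn, hexp]; exact ENNReal.one_lt_top⟩
  have hone : ∫ a, Real.exp (f a) ∂ν = 1 := by
    rw [integral_eq_lintegral_of_nonneg_ae hnn hint.aestronglyMeasurable, hexp, ENNReal.toReal_one]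
  have := isProbabilityMeasure_tilted hint
  have hgibbs := integral_llr_add_sub_measure_univ_nonneg
    (hac.trans (absolutelyContinuous_tilted hint)) (integrable_llr_tilted_right hac hf hllr hint)
  rw [integral_llr_tilted_right hac hf hint hllr, hone, Real.log_one] at hgibbs
  simp only [probReal_univ] at hgibbs
  rw [← ENNReal.ofReal_toReal htop, toReal_klDiv_of_measure_eq hac (by simp)]
  exact ENNReal.ofReal_le_ofReal (by linarith)

open scoped ComplexOrder in
lemma ofReal_integral_posteriorLogRatio_le_klDiv {Ω 𝒰 : Type*} [MeasurableSpace Ω]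
    [MeasurableSpace 𝒰] {P : Measure Ω} [IsProbabilityMeasure P] {k : ℕ} {x : Ω → Fin k → ℂ}
    (hx : Measurable x) (hlaw : P.map x = stdCNVec k) {U : Ω → 𝒰} (hU : Measurable U)
    {Q : 𝒰 → Matrix (Fin k) (Fin k) ℂ} (hQm : EntryMeasurable inferInstance Q)
    {c : 𝒰 → Fin k → ℂ} (hc : Measurable c) (hQ : ∀ᵐ ω ∂P, (Q (U ω)).PosDef)
    (hint : Integrable (fun ω => posteriorLogRatio (Q (U ω)) (c (U ω)) (x ω)) P) :
    ENNReal.ofReal (∫ ω, posteriorLogRatio (Q (U ω)) (c (U ω)) (x ω) ∂P)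
      ≤ klDiv (P.map fun ω => (x ω, U ω)) ((P.map x).prod (P.map U)) := by
  have := Measure.isProbabilityMeasure_map (μ := P) hx.aemeasurable
  have := Measure.isProbabilityMeasure_map (μ := P) hU.aemeasurable
  have hxU := hx.prodMk hU
  have := Measure.isProbabilityMeasure_map (μ := P) hxU.aemeasurable
  have hm : Measurable fun q : (Fin k → ℂ) × 𝒰 => posteriorLogRatio (Q q.2) (c q.2) q.1 :=
    measurable_posteriorLogRatio (fun i j => (hQm i j).comp measurable_snd)
      (hc.comp measurable_snd) measurable_fst
  rw [← integral_map (f := fun q : (Fin k → ℂ) × 𝒰 => posteriorLogRatio (Q q.2) (c q.2) q.1)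
    hxU.aemeasurable hm.aestronglyMeasurable]
  refine ofReal_integral_le_klDiv
    ((integrable_map_measure hm.aestronglyMeasurable hxU.aemeasurable).2 hint) hm ?_
  rw [lintegral_prod_symm _ hm.exp.ennreal_ofReal.aemeasurable,
    lintegral_map hm.exp.ennreal_ofReal.lintegral_prod_left' hU, hlaw]
  calc ∫⁻ ω, ∫⁻ x, ENNReal.ofReal (Real.exp (posteriorLogRatio (Q (U ω)) (c (U ω)) x)) ∂stdCNVec k
        ∂P = ∫⁻ _, 1 ∂P :=
        lintegral_congr_ae (hQ.mono fun ω h => lintegral_exp_posteriorLogRatio h _)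
    _ = 1 := by simp

end Information

section WhiteSource

variable {Ω ν ι κ : Type*} {m 𝓢 mΩ : MeasurableSpace Ω} {P : Measure Ω}

lemma measurable_apply_comap (u : Ω → ν → ℂ) (a : ν) :
    Measurable[MeasurableSpace.comap u inferInstance] fun ω => u ω a :=
  (measurable_pi_apply a).comp (comap_measurable u)

variable [DecidableEq ν]

/-- The normalization `E{u uᴴ} = I` of a random vector, which is that of the symbols and of the
noise. -/
def IsWhite (P : Measure Ω) (u : Ω → ν → ℂ) : Prop :=
  ∀ a b, ∫ ω, u ω a * star (u ω b) ∂P = (1 : Matrix ν ν ℂ) a b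

lemma IsWhite.memLp {u : Ω → ν → ℂ} (h : IsWhite P u) (hu : Measurable[mΩ] u) (a : ν) :
    MemLp (fun ω => u ω a) 2 P := by
  have hint : Integrable (fun ω => u ω a * star (u ω a)) P := by
    refine .of_integral_ne_zero ?_
    rw [h a a, one_apply_eq]
    exact one_ne_zero
  refine (memLp_two_iff_integrable_sq_norm
    ((measurable_pi_apply a).comp hu).aestronglyMeasurable).2
    (hint.re.congr (.of_forall fun ω => ?_))
  exact congrArg Complex.re (Complex.mul_conj' (u ω a)) |>.trans (by norm_cast)

/-- A white random vector that is independent of the σ-algebra `𝓢`, which describes the state of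
the channel. -/
structure WhiteSource (P : Measure Ω) (𝓢 : MeasurableSpace Ω) (u : Ω → ν → ℂ) : Prop where
  state_le : 𝓢 ≤ mΩ
  measurable : Measurable[mΩ] u
  indep : Indep (MeasurableSpace.comap u inferInstance) 𝓢 P
  white : IsWhite P u

namespace WhiteSource

variable {u : Ω → ν → ℂ}

lemma memLp (h : WhiteSource P 𝓢 u) (a : ν) : MemLp (fun ω => u ω a) 2 P :=
  h.white.memLp h.measurable a

lemma entryMemLp_vecMulVec (h : WhiteSource P 𝓢 u) :
    EntryMemLp (fun ω => vecMulVec (u ω) (star (u ω))) 1 P :=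
  fun a b => (h.memLp b).star.mul (h.memLp a)

lemma integrable_norm_sq (h : WhiteSource P 𝓢 u) (a : ν) :
    Integrable (fun ω => ‖u ω a‖ ^ 2) P :=
  (memLp_two_iff_integrable_sq_norm (h.memLp a).1).1 (h.memLp a)

lemma integral_norm_sq (h : WhiteSource P 𝓢 u) (a : ν) : ∫ ω, ‖u ω a‖ ^ 2 ∂P = 1 := by
  have hwhite := h.white a a
  simp only [Complex.star_def, Complex.mul_conj, Complex.normSq_eq_norm_sq, one_apply_eq,
    integral_complex_ofReal] at hwhite
  exact_mod_cast hwhite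

lemma condExpMat_vecMulVec [IsProbabilityMeasure P] [Finite ν] (h : WhiteSource P 𝓢 u) :
    condExpMat P 𝓢 (fun ω => vecMulVec (u ω) (star (u ω))) =ᵐ[P] fun _ => 1 := by
  refine condExpMat_ae_eq_iff.2 fun a b => ?_
  have hmeas : Measurable[MeasurableSpace.comap u inferInstance]
      fun ω => u ω a * star (u ω b) :=
    (measurable_apply_comap u a).mul
      (Complex.continuous_conj.measurable.comp (measurable_apply_comap u b))
  filter_upwards [condExp_indep_eq h.measurable.comap_le h.state_le hmeas.stronglyMeasurable
    h.indep] with ω hω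
  exact hω.trans (h.white a b)

variable [Fintype ν] {A : Ω → Matrix ι ν ℂ} {B : Ω → Matrix κ ν ℂ}

lemma memLp_mulVec (h : WhiteSource P 𝓢 u) (hA : EntryMeasurable 𝓢 A) (hA2 : EntryMemLp A 2 P)
    (i : ι) : MemLp (fun ω => (A ω *ᵥ u ω) i) 2 P := by
  refine memLp_finsetSum _ fun a _ => ?_
  have hindep : IndepFun (fun ω => A ω i a) (fun ω => u ω a) P :=
    (IndepFun_iff_Indep _ _ _).2 (indep_of_indep_of_le_left (indep_of_indep_of_le_right
      h.indep.symm (measurable_apply_comap u a).comap_le) (hA i a).comap_le)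
  refine (memLp_two_iff_integrable_sq_norm ((hA2 i a).1.mul (h.memLp a).1)).2 ?_
  simp only [Pi.mul_apply, norm_mul, mul_pow]
  exact (hindep.comp (measurable_norm.pow_const 2) (measurable_norm.pow_const 2)).integrable_mul
    ((memLp_two_iff_integrable_sq_norm (hA2 i a).1).1 (hA2 i a))
    (h.integrable_norm_sq a)

lemma entryMemLp_vecMulVec_mulVec (h : WhiteSource P 𝓢 u) (hA : EntryMeasurable 𝓢 A)
    (hA2 : EntryMemLp A 2 P) (hB : EntryMeasurable 𝓢 B) (hB2 : EntryMemLp B 2 P) :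
    EntryMemLp (fun ω => vecMulVec (A ω *ᵥ u ω) (star (B ω *ᵥ u ω))) 1 P :=
  fun i j => (h.memLp_mulVec hB hB2 j).star.mul (h.memLp_mulVec hA hA2 i)

lemma condExpMat_vecMulVec_mulVec [IsProbabilityMeasure P] [Finite ι] [Finite κ]
    (h : WhiteSource P 𝓢 u) (hm : m ≤ 𝓢) (hA : EntryMeasurable 𝓢 A) (hA2 : EntryMemLp A 2 P)
    (hB : EntryMeasurable 𝓢 B) (hB2 : EntryMemLp B 2 P) :
    condExpMat P m (fun ω => vecMulVec (A ω *ᵥ u ω) (star (B ω *ᵥ u ω)))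
      =ᵐ[P] condExpMat P m (fun ω => A ω * (B ω)ᴴ) := by
  have hsandwich : ∀ ω, vecMulVec (A ω *ᵥ u ω) (star (B ω *ᵥ u ω))
      = A ω * vecMulVec (u ω) (star (u ω)) * (B ω)ᴴ := fun ω => by
    rw [mul_vecMulVec, vecMulVec_mul, star_mulVec]
  have hint := h.entryMemLp_vecMulVec_mulVec hA hA2 hB hB2
  refine (condExpMat_condExpMat_of_le hm h.state_le).symm.trans (condExpMat_congr_ae ?_)
  simp only [hsandwich] at hint ⊢
  filter_upwards [condExpMat_mul_mul hA h.entryMemLp_vecMulVec hB.conjTranspose hint,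
    h.condExpMat_vecMulVec] with ω hpull hwhite
  rw [hpull, hwhite, Matrix.mul_one]

end WhiteSource

end WhiteSource

section LinearMMSE

variable {Ω ι κ η : Type*} {m 𝓢 mΩ : MeasurableSpace Ω} {P : Measure Ω}

/-- The conditional mean `E{R₁ | m}` of the signal part of the channel matrix `R = [R₁ R₂]`. -/
noncomputable def meanGain (P : Measure Ω) (m : MeasurableSpace Ω)
    (R : Ω → Matrix κ (ι ⊕ η) ℂ) : Ω → Matrix κ ι ℂ :=
  condExpMat P m fun ω => (R ω).toCols₁

variable [Fintype ι] [Fintype η]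

/-- The conditional covariance `E{R Rᴴ | m}` of the observation of a white vector through `R`. -/
noncomputable def obsCov (P : Measure Ω) (m : MeasurableSpace Ω)
    (R : Ω → Matrix κ (ι ⊕ η) ℂ) : Ω → Matrix κ κ ℂ :=
  condExpMat P m fun ω => R ω * (R ω)ᴴ

/-- The effective noise covariance `Ψ` (`Ψ_r` at the receiver, `Ψ_c` at the CPU): the covariance
of the observation less the contribution of the mean gain, so that the uncertainty about the gain
counts as noise. -/
noncomputable def effNoise (P : Measure Ω) (m : MeasurableSpace Ω)
    (R : Ω → Matrix κ (ι ⊕ η) ℂ) : Ω → Matrix κ κ ℂ :=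
  fun ω => obsCov P m R ω - meanGain P m R ω * (meanGain P m R ω)ᴴ

lemma entryMeasurable_effNoise (R : Ω → Matrix κ (ι ⊕ η) ℂ) :
    EntryMeasurable m (effNoise P m R) :=
  (EntryMeasurable.condExpMat P _).sub
    ((EntryMeasurable.condExpMat P _).mul (EntryMeasurable.condExpMat P _).conjTranspose)

variable {R : Ω → Matrix κ (ι ⊕ η) ℂ}

lemma obsCov_ae_eq_add [Finite κ] (hR : EntryMemLp R 2 P) :
    obsCov P m R =ᵐ[P] fun ω => condExpMat P m (fun ω => (R ω).toCols₁ * (R ω).toCols₁ᴴ) ω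
      + condExpMat P m (fun ω => (R ω).toCols₂ * (R ω).toCols₂ᴴ) ω := by
  have hsplit : ∀ ω, R ω * (R ω)ᴴ
      = (R ω).toCols₁ * (R ω).toCols₁ᴴ + (R ω).toCols₂ * (R ω).toCols₂ᴴ := fun ω => by
    conv_lhs => rw [← fromCols_toCols (R ω), conjTranspose_fromCols_eq_fromRows_conjTranspose,
      fromCols_mul_fromRows]
  have hR₁ : EntryMemLp (fun ω => (R ω).toCols₁) 2 P := fun i j => hR i (.inl j)
  have hR₂ : EntryMemLp (fun ω => (R ω).toCols₂) 2 P := fun i j => hR i (.inr j)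
  simp only [obsCov, hsplit]
  exact condExpMat_add (hR₁.mul hR₁.conjTranspose) (hR₂.mul hR₂.conjTranspose)

section PosSemidef

open scoped ComplexOrder

variable [IsProbabilityMeasure P]

/-- The conditional covariance of the gain is positive semidefinite, so the effective noise
dominates the interference and noise. -/
lemma effNoise_sub_posSemidef [Finite κ] (hm : m ≤ mΩ) (hR : EntryMemLp R 2 P) :
    ∀ᵐ ω ∂P, (effNoise P m R ω
      - condExpMat P m (fun ω => (R ω).toCols₂ * (R ω).toCols₂ᴴ) ω).PosSemidef := by
  classical
  have hR₁ : EntryMemLp (fun ω => (R ω).toCols₁) 2 P := fun i j => hR i (.inl j)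
  filter_upwards [obsCov_ae_eq_add (m := m) hR,
    condExpMat_gram_posSemidef (m := m) hR₁ (.const (1 : Matrix ι ι ℂ))] with ω hsplit hgram
  simp only [conjTranspose_one, Matrix.mul_one, condExpMat_const hm] at hgram
  have hvar : effNoise P m R ω - condExpMat P m (fun ω => (R ω).toCols₂ * (R ω).toCols₂ᴴ) ω
      = condExpMat P m (fun ω => (R ω).toCols₁ * (R ω).toCols₁ᴴ) ω
        - meanGain P m R ω * (meanGain P m R ω)ᴴ := by
    rw [effNoise, hsplit]
    abel
  exact hvar ▸ posSemidef_sub_mul_conjTranspose hgram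

lemma effNoise_posSemidef [Finite κ] (hm : m ≤ mΩ) (hR : EntryMemLp R 2 P) :
    ∀ᵐ ω ∂P, (effNoise P m R ω).PosSemidef := by
  have hR₂ : EntryMemLp (fun ω => (R ω).toCols₂) 2 P := fun i j => hR i (.inr j)
  filter_upwards [effNoise_sub_posSemidef hm hR, condExpMat_posSemidef (m := m)
    (hR₂.mul hR₂.conjTranspose) (.of_forall fun ω => posSemidef_self_mul_conjTranspose _)]
    with ω h h'
  simpa only [sub_add_cancel] using h.add h'

end PosSemidef

variable [DecidableEq ι]

/-- The matrix that selects the signal `x` from the stacked vector of signal and interference. -/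
def signalPart (ι η : Type*) [DecidableEq ι] : Matrix ι (ι ⊕ η) ℂ := fromCols 1 0

lemma signalPart_mulVec (v : ι ⊕ η → ℂ) :
    signalPart ι η *ᵥ v = v ∘ Sum.inl := by
  rw [signalPart, fromCols_mulVec, one_mulVec, zero_mulVec, add_zero]

lemma mul_conjTranspose_signalPart (R : Matrix κ (ι ⊕ η) ℂ) :
    R * (signalPart ι η)ᴴ = R.toCols₁ := by
  rw [← fromCols_toCols R, signalPart, conjTranspose_fromCols_eq_fromRows_conjTranspose,
    fromCols_mul_fromRows]
  simp

lemma signalPart_mul_conjTranspose (R : Matrix κ (ι ⊕ η) ℂ) :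
    signalPart ι η * Rᴴ = R.toCols₁ᴴ := by
  rw [← mul_conjTranspose_signalPart, conjTranspose_mul, conjTranspose_conjTranspose]

variable [Fintype κ] [DecidableEq κ]

/-- The matrix `I + Υ`, which turns out to be the inverse of the error covariance of the linear
MMSE estimate. It is `I` where the effective noise covariance is singular, because the inverse of a
singular matrix is `0`. -/
noncomputable def precision (P : Measure Ω) (m : MeasurableSpace Ω)
    (R : Ω → Matrix κ (ι ⊕ η) ℂ) : Ω → Matrix ι ι ℂ :=
  fun ω => 1 + (meanGain P m R ω)ᴴ * (effNoise P m R ω)⁻¹ * meanGain P m R ω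

/-- The matrix of the linear MMSE estimate, written in the information form `Q⁻¹ Ḡᴴ Ψ⁻¹` instead
of `Ḡᴴ (Ψ + Ḡ Ḡᴴ)⁻¹`, so that it is `0` where the effective noise covariance `Ψ` is singular. -/
noncomputable def estimator (P : Measure Ω) (m : MeasurableSpace Ω)
    (R : Ω → Matrix κ (ι ⊕ η) ℂ) : Ω → Matrix ι κ ℂ :=
  fun ω => (precision P m R ω)⁻¹ * (meanGain P m R ω)ᴴ * (effNoise P m R ω)⁻¹

/-- The error of the linear MMSE estimate as a linear function of signal and interference. -/
noncomputable def errorMatrix (P : Measure Ω) (m : MeasurableSpace Ω)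
    (R : Ω → Matrix κ (ι ⊕ η) ℂ) : Ω → Matrix ι (ι ⊕ η) ℂ :=
  fun ω => signalPart ι η - estimator P m R ω * R ω

lemma errorMatrix_mulVec (R : Ω → Matrix κ (ι ⊕ η) ℂ) (ω : Ω) (v : ι ⊕ η → ℂ) :
    errorMatrix P m R ω *ᵥ v = v ∘ Sum.inl - estimator P m R ω *ᵥ (R ω *ᵥ v) := by
  rw [errorMatrix, sub_mulVec, signalPart_mulVec, mulVec_mulVec]

lemma entryMeasurable_precision (R : Ω → Matrix κ (ι ⊕ η) ℂ) :
    EntryMeasurable m (precision P m R) :=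
  (EntryMeasurable.const 1).add (((EntryMeasurable.condExpMat P _).conjTranspose.mul
    (entryMeasurable_effNoise R).inv).mul (EntryMeasurable.condExpMat P _))

lemma entryMeasurable_estimator (R : Ω → Matrix κ (ι ⊕ η) ℂ) :
    EntryMeasurable m (estimator P m R) :=
  ((entryMeasurable_precision R).inv.mul (EntryMeasurable.condExpMat P _).conjTranspose).mul
    (entryMeasurable_effNoise R).inv

lemma estimator_eq_zero {ω : Ω} (hdet : (effNoise P m R ω).det = 0) :
    estimator P m R ω = 0 := by
  rw [estimator, nonsing_inv_apply_not_isUnit (effNoise P m R ω) (by simp [hdet]), Matrix.mul_zero]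

open scoped ComplexOrder

variable [IsProbabilityMeasure P]

lemma precision_posDef (hm : m ≤ mΩ) (hR : EntryMemLp R 2 P) :
    ∀ᵐ ω ∂P, (precision P m R ω).PosDef :=
  (effNoise_posSemidef hm hR).mono fun _ h =>
    PosDef.one.add_posSemidef (h.inv.conjTranspose_mul_mul_same _)

lemma estimator_mul_meanGain (hm : m ≤ mΩ) (hR : EntryMemLp R 2 P) :
    ∀ᵐ ω ∂P, estimator P m R ω * meanGain P m R ω = 1 - (precision P m R ω)⁻¹ := by
  filter_upwards [precision_posDef hm hR] with ω hQ
  have hexcess : (meanGain P m R ω)ᴴ * (effNoise P m R ω)⁻¹ * meanGain P m R ω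
      = precision P m R ω - 1 := (add_sub_cancel_left _ _).symm
  rw [estimator, Matrix.mul_assoc (precision P m R ω)⁻¹, Matrix.mul_assoc, hexcess, mul_sub,
    nonsing_inv_mul _ ((isUnit_iff_isUnit_det _).1 hQ.isUnit), mul_one]

lemma estimator_mul_obsCov (hm : m ≤ mΩ) (hR : EntryMemLp R 2 P) :
    ∀ᵐ ω ∂P, (effNoise P m R ω).det ≠ 0 →
      estimator P m R ω * obsCov P m R ω = (meanGain P m R ω)ᴴ := by
  filter_upwards [estimator_mul_meanGain hm hR] with ω hgain hdet
  have hcov : obsCov P m R ω = effNoise P m R ω + meanGain P m R ω * (meanGain P m R ω)ᴴ :=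
    (sub_add_cancel _ _).symm
  rw [hcov, Matrix.mul_add, ← Matrix.mul_assoc (estimator P m R ω), hgain, estimator,
    nonsing_inv_mul_cancel_right _ _ (isUnit_iff_ne_zero.2 hdet), Matrix.sub_mul, Matrix.one_mul,
    add_sub_cancel]

lemma estimator_mul_obsCov_mul (hm : m ≤ mΩ) (hR : EntryMemLp R 2 P) :
    ∀ᵐ ω ∂P, estimator P m R ω * obsCov P m R ω * (estimator P m R ω)ᴴ
      = 1 - (precision P m R ω)⁻¹ := by
  filter_upwards [estimator_mul_meanGain hm hR, estimator_mul_obsCov hm hR,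
    precision_posDef hm hR] with ω hgain hcov hQ
  by_cases hdet : (effNoise P m R ω).det = 0
  · rw [← hgain, estimator_eq_zero hdet, Matrix.zero_mul, Matrix.zero_mul, Matrix.zero_mul]
  · rw [hcov hdet, ← conjTranspose_mul, hgain, conjTranspose_sub, conjTranspose_one,
      hQ.inv.isHermitian]

lemma one_sub_inv_precision_posSemidef (hm : m ≤ mΩ) (hR : EntryMemLp R 2 P) :
    ∀ᵐ ω ∂P, (1 - (precision P m R ω)⁻¹).PosSemidef := by
  filter_upwards [estimator_mul_obsCov_mul hm hR, condExpMat_posSemidef (m := m)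
    (hR.mul hR.conjTranspose) (.of_forall fun ω => posSemidef_self_mul_conjTranspose _)]
    with ω h hcov
  exact h ▸ hcov.mul_mul_conjTranspose_same _

lemma log_det_precision_nonneg (hm : m ≤ mΩ) (hR : EntryMemLp R 2 P) :
    ∀ᵐ ω ∂P, 0 ≤ Real.log (precision P m R ω).det.re := by
  filter_upwards [precision_posDef hm hR, one_sub_inv_precision_posSemidef hm hR] with ω hQ h
  have htrace := trace_re_le_of_posSemidef_sub h
  simp only [trace_one, Complex.natCast_re] at htrace
  linarith [card_sub_trace_inv_le_log_det hQ]

/-- If the gain factors as `R₁ = L B` through a part `L` of the noise, then `Υ ≤ E{Bᴴ B | m}`,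
whatever the size of `L`. -/
lemma log_det_precision_le {ν : Type*} [Fintype ν] (hm : m ≤ mΩ) (hR : EntryMemLp R 2 P)
    {L : Ω → Matrix κ ν ℂ} {B : Ω → Matrix ν ι ℂ} (hL : EntryMemLp L 2 P) (hB : EntryMemLp B 2 P)
    (hLB : ∀ ω, (R ω).toCols₁ = L ω * B ω)
    (hnoise : ∀ ω, ((R ω).toCols₂ * (R ω).toCols₂ᴴ - L ω * (L ω)ᴴ).PosSemidef) :
    ∀ᵐ ω ∂P, Real.log (precision P m R ω).det.re
      ≤ (condExpMat P m (fun ω => (B ω)ᴴ * B ω) ω).trace.re := by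
  have hR₂ : EntryMemLp (fun ω => (R ω).toCols₂) 2 P := fun i j => hR i (.inr j)
  have hNN : EntryMemLp (fun ω => (R ω).toCols₂ * (R ω).toCols₂ᴴ) 1 P := hR₂.mul hR₂.conjTranspose
  have hLL : EntryMemLp (fun ω => L ω * (L ω)ᴴ) 1 P := hL.mul hL.conjTranspose
  filter_upwards [precision_posDef hm hR, effNoise_posSemidef hm hR,
    effNoise_sub_posSemidef hm hR,
    condExpMat_posSemidef (m := m) (hNN.sub hLL) (.of_forall hnoise),
    condExpMat_sub (m := m) hNN hLL, condExpMat_gram_posSemidef (m := m) hL hB.conjTranspose,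
    condExpMat_posSemidef (m := m) (hB.conjTranspose.mul hB)
      (.of_forall fun ω => posSemidef_conjTranspose_mul_self _)]
    with ω hQ hΨ hΨN hNL hsub hgram hBB
  rw [hsub] at hNL
  simp only [conjTranspose_conjTranspose, ← hLB] at hgram
  have hle : (condExpMat P m (fun ω => (B ω)ᴴ * B ω) ω
      - (meanGain P m R ω)ᴴ * (effNoise P m R ω)⁻¹ * meanGain P m R ω).PosSemidef := by
    by_cases hdet : (effNoise P m R ω).det = 0
    · rwa [nonsing_inv_apply_not_isUnit _ (by simp [hdet]), Matrix.mul_zero, Matrix.zero_mul,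
        sub_zero]
    · exact posSemidef_sub_conjTranspose_mul_inv_mul (hΨ.posDef_iff_det_ne_zero.2 hdet)
        (by simpa only [sub_add_sub_cancel] using hΨN.add hNL) hgram
  refine (log_det_le_trace_sub_card hQ).trans ?_
  simpa [precision, trace_add] using trace_re_le_of_posSemidef_sub hle

lemma integrable_log_det_precision {ν : Type*} [Fintype ν] (hm : m ≤ mΩ)
    (hR : EntryMemLp R 2 P) {L : Ω → Matrix κ ν ℂ} {B : Ω → Matrix ν ι ℂ} (hL : EntryMemLp L 2 P)
    (hB : EntryMemLp B 2 P) (hLB : ∀ ω, (R ω).toCols₁ = L ω * B ω)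
    (hnoise : ∀ ω, ((R ω).toCols₂ * (R ω).toCols₂ᴴ - L ω * (L ω)ᴴ).PosSemidef) :
    Integrable (fun ω => Real.log (precision P m R ω).det.re) P := by
  have htrace : Integrable (fun ω => (condExpMat P m (fun ω => (B ω)ᴴ * B ω) ω).trace.re) P :=
    EntryMemLp.condExpMat.integrable_trace.re
  refine htrace.mono' ((entryMeasurable_precision R).mono hm).det.re.log.aestronglyMeasurable ?_
  filter_upwards [log_det_precision_nonneg hm hR, log_det_precision_le hm hR hL hB hLB hnoise]
    with ω hnn hle
  rwa [Real.norm_of_nonneg hnn]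

end LinearMMSE

section WhiteChannel

variable {Ω ι κ η : Type*} {m 𝓢 mΩ : MeasurableSpace Ω} {P : Measure Ω}

lemma EntryMemLp.of_integrable_trace [Fintype ι] [Fintype κ] {X : Ω → Matrix ι κ ℂ}
    (hX : EntryMeasurable mΩ X) (h : Integrable (fun ω => (X ω * (X ω)ᴴ).trace) P) :
    EntryMemLp X 2 P := fun i j => by
  refine (memLp_two_iff_integrable_sq_norm (hX i j).aestronglyMeasurable).2
    (h.re.mono' ((hX i j).norm.pow_const 2).aestronglyMeasurable (.of_forall fun ω => ?_))
  have htrace : (X ω * (X ω)ᴴ).trace.re = ∑ i, ∑ j, ‖X ω i j‖ ^ 2 := by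
    simp [trace, mul_apply, ← Complex.normSq_eq_norm_sq, Complex.normSq_apply]
  calc ‖‖X ω i j‖ ^ 2‖ = ‖X ω i j‖ ^ 2 := Real.norm_of_nonneg (sq_nonneg _)
    _ ≤ ∑ j, ‖X ω i j‖ ^ 2 :=
        Finset.single_le_sum (fun j _ => sq_nonneg ‖X ω i j‖) (Finset.mem_univ j)
    _ ≤ ∑ i, ∑ j, ‖X ω i j‖ ^ 2 :=
        Finset.single_le_sum (fun i _ => Finset.sum_nonneg fun j _ => sq_nonneg ‖X ω i j‖)
          (Finset.mem_univ i)
    _ = RCLike.re (X ω * (X ω)ᴴ).trace := htrace.symm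

/-- The observation `R u` of a white random vector `u`, which stacks the signal and the
interference, through a random channel matrix `R`, given the side information `m`. -/
structure WhiteChannel [DecidableEq ι] [DecidableEq η] (P : Measure Ω) (m 𝓢 : MeasurableSpace Ω)
    (u : Ω → ι ⊕ η → ℂ) (R : Ω → Matrix κ (ι ⊕ η) ℂ) : Prop extends WhiteSource P 𝓢 u where
  side_le : m ≤ 𝓢
  matrix_meas : EntryMeasurable 𝓢 R
  matrix_memLp : EntryMemLp R 2 P

namespace WhiteChannel

variable [Fintype ι] [DecidableEq ι] [Fintype κ] [DecidableEq κ] [Fintype η] [DecidableEq η]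
  [IsProbabilityMeasure P] {u : Ω → ι ⊕ η → ℂ} {R : Ω → Matrix κ (ι ⊕ η) ℂ}

open scoped ComplexOrder

omit [Fintype ι] [Fintype κ] [DecidableEq κ] [Fintype η] [IsProbabilityMeasure P] in
lemma side_le_ambient (h : WhiteChannel P m 𝓢 u R) : m ≤ mΩ := h.side_le.trans h.state_le

lemma entryMemLp_estimator_mul (h : WhiteChannel P m 𝓢 u R) :
    EntryMemLp (fun ω => estimator P m R ω * R ω) 2 P := by
  have hm := h.side_le_ambient
  have hM : EntryMeasurable m (estimator P m R) := entryMeasurable_estimator R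
  have hcyc : ∀ ω (C : Matrix κ κ ℂ), ((estimator P m R ω)ᴴ * estimator P m R ω * C).trace
      = (estimator P m R ω * C * (estimator P m R ω)ᴴ).trace := fun ω C => by
    rw [Matrix.mul_assoc, trace_mul_comm]
  have hbound : Integrable (fun ω => ((estimator P m R ω)ᴴ * estimator P m R ω
      * obsCov P m R ω).trace) P := by
    have hmeas : EntryMeasurable m fun ω => (estimator P m R ω)ᴴ * estimator P m R ω
        * obsCov P m R ω := (hM.conjTranspose.mul hM).mul (.condExpMat P _)
    refine (integrable_const (Fintype.card ι : ℝ)).mono'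
      (hmeas.mono hm).trace.aestronglyMeasurable ?_
    filter_upwards [estimator_mul_obsCov_mul hm h.matrix_memLp,
      one_sub_inv_precision_posSemidef hm h.matrix_memLp,
      precision_posDef hm h.matrix_memLp] with ω hform hpos hQ
    rw [hcyc, hform, ← Complex.re_eq_norm.2 hpos.trace_nonneg, trace_sub, trace_one]
    have htrace := (Complex.nonneg_iff.1 hQ.inv.posSemidef.trace_nonneg).1
    simp only [Complex.sub_re, Complex.natCast_re]
    linarith
  have hgram : ∀ ω, ((estimator P m R ω)ᴴ * estimator P m R ω * (R ω * (R ω)ᴴ)).trace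
      = (estimator P m R ω * R ω * (estimator P m R ω * R ω)ᴴ).trace := fun ω => by
    rw [hcyc, conjTranspose_mul]
    simp only [Matrix.mul_assoc]
  have hint := integrable_trace_mul_of_nonneg hm (hM.conjTranspose.mul hM)
    (h.matrix_memLp.mul h.matrix_memLp.conjTranspose) (.of_forall fun ω => by
      rw [hgram]
      exact (posSemidef_self_mul_conjTranspose _).trace_nonneg) hbound
  simp only [hgram] at hint
  exact .of_integrable_trace ((hM.mono hm).mul (h.matrix_meas.mono h.state_le)) hint

lemma condExpMat_errorMatrix_mul_conjTranspose (h : WhiteChannel P m 𝓢 u R) :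
    condExpMat P m (fun ω => errorMatrix P m R ω * (errorMatrix P m R ω)ᴴ)
      =ᵐ[P] fun ω => (precision P m R ω)⁻¹ := by
  have hm := h.side_le_ambient
  have hM : EntryMeasurable m (estimator P m R) := entryMeasurable_estimator R
  have hMR := h.entryMemLp_estimator_mul
  have hMR₁ : EntryMemLp (fun ω => estimator P m R ω * (R ω).toCols₁) 1 P :=
    fun i j => (hMR i (.inl j)).mono_exponent one_le_two
  have hR₁ : EntryMemLp (fun ω => (R ω).toCols₁) 1 P :=
    fun i j => (h.matrix_memLp i (.inl j)).mono_exponent one_le_two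
  have hsq : EntryMemLp (fun ω => estimator P m R ω * (R ω * (R ω)ᴴ) * (estimator P m R ω)ᴴ) 1 P :=
    by simpa only [Matrix.mul_assoc, conjTranspose_mul] using hMR.mul hMR.conjTranspose
  have hexpand : ∀ ω, errorMatrix P m R ω * (errorMatrix P m R ω)ᴴ
      = 1 - estimator P m R ω * (R ω).toCols₁ - (estimator P m R ω * (R ω).toCols₁)ᴴ
        + estimator P m R ω * (R ω * (R ω)ᴴ) * (estimator P m R ω)ᴴ := fun ω => by
    have hunit : signalPart ι η * (signalPart ι η)ᴴ = (1 : Matrix ι ι ℂ) := by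
      rw [mul_conjTranspose_signalPart, signalPart, toCols₁_fromCols]
    rw [errorMatrix, conjTranspose_sub, Matrix.sub_mul, Matrix.mul_sub, Matrix.mul_sub, hunit,
      Matrix.mul_assoc _ (R ω) (signalPart ι η)ᴴ, mul_conjTranspose_signalPart, conjTranspose_mul,
      ← Matrix.mul_assoc (signalPart ι η), signalPart_mul_conjTranspose, conjTranspose_mul]
    simp only [Matrix.mul_assoc]
    abel
  simp only [hexpand]
  have hone : EntryMemLp (fun _ : Ω => (1 : Matrix ι ι ℂ)) 1 P := .const 1
  filter_upwards [condExpMat_add (m := m) ((hone.sub hMR₁).sub hMR₁.conjTranspose) hsq,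
    condExpMat_sub (m := m) (hone.sub hMR₁) hMR₁.conjTranspose, condExpMat_sub (m := m) hone hMR₁,
    condExpMat_conjTranspose (m := m) hMR₁, condExpMat_mul_left hM hR₁ hMR₁,
    condExpMat_mul_mul hM (h.matrix_memLp.mul h.matrix_memLp.conjTranspose) hM.conjTranspose hsq,
    estimator_mul_meanGain hm h.matrix_memLp, estimator_mul_obsCov_mul hm h.matrix_memLp,
    precision_posDef hm h.matrix_memLp]
    with ω hadd hsub₂ hsub₁ hstar hlin hquad hgain hcov hQ
  rw [hadd, hsub₂, hsub₁, hstar, hlin, hquad, condExpMat_const hm]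
  rw [meanGain] at hgain
  rw [obsCov] at hcov
  rw [hgain, hcov, conjTranspose_sub, conjTranspose_one, hQ.inv.isHermitian]
  abel

omit [IsProbabilityMeasure P] in
lemma entryMeasurable_errorMatrix (h : WhiteChannel P m 𝓢 u R) :
    EntryMeasurable 𝓢 (errorMatrix P m R) :=
  (EntryMeasurable.const _).sub (((entryMeasurable_estimator R).mono h.side_le).mul h.matrix_meas)

lemma entryMemLp_errorMatrix (h : WhiteChannel P m 𝓢 u R) :
    EntryMemLp (errorMatrix P m R) 2 P :=
  (EntryMemLp.const _).sub h.entryMemLp_estimator_mul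

lemma entryMemLp_vecMulVec_error (h : WhiteChannel P m 𝓢 u R) :
    EntryMemLp (fun ω => vecMulVec (errorMatrix P m R ω *ᵥ u ω)
      (star (errorMatrix P m R ω *ᵥ u ω))) 1 P :=
  h.entryMemLp_vecMulVec_mulVec h.entryMeasurable_errorMatrix h.entryMemLp_errorMatrix
    h.entryMeasurable_errorMatrix h.entryMemLp_errorMatrix

lemma condExpMat_vecMulVec_error (h : WhiteChannel P m 𝓢 u R) :
    condExpMat P m (fun ω => vecMulVec (errorMatrix P m R ω *ᵥ u ω)
      (star (errorMatrix P m R ω *ᵥ u ω))) =ᵐ[P] fun ω => (precision P m R ω)⁻¹ :=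
  (h.condExpMat_vecMulVec_mulVec h.side_le h.entryMeasurable_errorMatrix h.entryMemLp_errorMatrix
    h.entryMeasurable_errorMatrix h.entryMemLp_errorMatrix).trans
    h.condExpMat_errorMatrix_mul_conjTranspose

lemma integrable_quadraticForm_error (h : WhiteChannel P m 𝓢 u R) :
    Integrable (fun ω => star (errorMatrix P m R ω *ᵥ u ω)
      ⬝ᵥ (precision P m R ω *ᵥ (errorMatrix P m R ω *ᵥ u ω))) P
    ∧ ∫ ω, star (errorMatrix P m R ω *ᵥ u ω)
      ⬝ᵥ (precision P m R ω *ᵥ (errorMatrix P m R ω *ᵥ u ω)) ∂P = Fintype.card ι := by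
  have hm := h.side_le_ambient
  have hQ : EntryMeasurable m (precision P m R) := entryMeasurable_precision R
  have hquad : ∀ ω (e : ι → ℂ), star e ⬝ᵥ (precision P m R ω *ᵥ e)
      = (precision P m R ω * vecMulVec e (star e)).trace := fun ω e => by
    rw [mul_vecMulVec, trace_vecMulVec, dotProduct_comm]
  have hcard : (fun ω => (precision P m R ω * condExpMat P m (fun ω =>
      vecMulVec (errorMatrix P m R ω *ᵥ u ω) (star (errorMatrix P m R ω *ᵥ u ω))) ω).trace)
      =ᵐ[P] fun _ => (Fintype.card ι : ℂ) := by
    filter_upwards [h.condExpMat_vecMulVec_error, precision_posDef hm h.matrix_memLp]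
      with ω herr hpos
    rw [herr, mul_nonsing_inv _ ((isUnit_iff_isUnit_det _).1 hpos.isUnit), trace_one]
  have hint : Integrable (fun ω => (precision P m R ω * vecMulVec (errorMatrix P m R ω *ᵥ u ω)
      (star (errorMatrix P m R ω *ᵥ u ω))).trace) P := by
    refine integrable_trace_mul_of_nonneg hm hQ h.entryMemLp_vecMulVec_error ?_
      ((integrable_const _).congr hcard.symm)
    filter_upwards [precision_posDef hm h.matrix_memLp] with ω hpos
    rw [← hquad]
    exact hpos.posSemidef.dotProduct_mulVec_nonneg _
  simp only [hquad]
  refine ⟨hint, ?_⟩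
  rw [← integral_condExp hm, integral_congr_ae
    ((condExp_trace_mul hQ h.entryMemLp_vecMulVec_error hint).trans hcard)]
  simp

omit [Fintype κ] [DecidableEq κ] in
lemma condExpMat_vecMulVec_signal_obs [Finite κ] (h : WhiteChannel P m 𝓢 u R) :
    condExpMat P m (fun ω => vecMulVec (u ω ∘ Sum.inl) (star (R ω *ᵥ u ω)))
      =ᵐ[P] fun ω => (meanGain P m R ω)ᴴ := by
  have hR₁ : EntryMemLp (fun ω => (R ω).toCols₁) 1 P :=
    fun i j => (h.matrix_memLp i (.inl j)).mono_exponent one_le_two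
  simp only [← signalPart_mulVec]
  refine (h.condExpMat_vecMulVec_mulVec h.side_le (.const _) (.const _) h.matrix_meas
    h.matrix_memLp).trans ?_
  simp only [signalPart_mul_conjTranspose]
  exact condExpMat_conjTranspose hR₁

section Rates

variable {k : ℕ} {u : Ω → Fin k ⊕ η → ℂ}

lemma integral_posteriorLogRatio {R : Ω → Matrix κ (Fin k ⊕ η) ℂ} (h : WhiteChannel P m 𝓢 u R)
    (hlog : Integrable (fun ω => Real.log (precision P m R ω).det.re) P) :
    Integrable (fun ω => posteriorLogRatio (precision P m R ω) (estimator P m R ω *ᵥ (R ω *ᵥ u ω))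
      (u ω ∘ Sum.inl)) P
    ∧ ∫ ω, posteriorLogRatio (precision P m R ω) (estimator P m R ω *ᵥ (R ω *ᵥ u ω))
      (u ω ∘ Sum.inl) ∂P = ∫ ω, Real.log (precision P m R ω).det.re ∂P := by
  obtain ⟨hquad, hcard⟩ := h.integrable_quadraticForm_error
  have hquad_re : Integrable (fun ω => (star (errorMatrix P m R ω *ᵥ u ω)
      ⬝ᵥ (precision P m R ω *ᵥ (errorMatrix P m R ω *ᵥ u ω))).re) P := hquad.re
  have hcard_re : ∫ ω, (star (errorMatrix P m R ω *ᵥ u ω)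
      ⬝ᵥ (precision P m R ω *ᵥ (errorMatrix P m R ω *ᵥ u ω))).re ∂P = k := by
    refine (integral_re hquad).trans ?_
    rw [hcard, Fintype.card_fin, RCLike.re_eq_complex_re, Complex.natCast_re]
  have hdiff : Integrable (fun ω => Real.log (precision P m R ω).det.re
      - (star (errorMatrix P m R ω *ᵥ u ω)
        ⬝ᵥ (precision P m R ω *ᵥ (errorMatrix P m R ω *ᵥ u ω))).re) P := hlog.sub hquad_re
  have hnorm : Integrable (fun ω => ∑ i, ‖u ω (Sum.inl i)‖ ^ 2) P :=
    integrable_finsetSum _ fun i _ => h.integrable_norm_sq _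
  have hsignal : ∫ ω, ∑ i, ‖u ω (Sum.inl i)‖ ^ 2 ∂P = k := by
    rw [integral_finsetSum _ fun i _ => h.integrable_norm_sq _]
    simp [h.integral_norm_sq]
  simp only [posteriorLogRatio, ← errorMatrix_mulVec, Function.comp_apply]
  refine ⟨hdiff.add hnorm, ?_⟩
  rw [integral_add hdiff hnorm, integral_sub hlog hquad_re, hcard_re, hsignal,
    sub_add_cancel]

variable {T : Type*} [mT : MeasurableSpace T] {Θ : Ω → T} {R : Ω → Matrix (Fin k) (Fin k ⊕ η) ℂ}

lemma mmseEstimate_eq (h : WhiteChannel P (mT.comap Θ) 𝓢 u R) :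
    ∀ᵐ ω ∂P, (effNoise P (mT.comap Θ) R ω).det ≠ 0 →
      mmseEstimate P Θ (fun ω => u ω ∘ Sum.inl) (fun ω => R ω *ᵥ u ω) ω
        = estimator P (mT.comap Θ) R ω *ᵥ (R ω *ᵥ u ω) := by
  have hm := h.side_le_ambient
  filter_upwards [h.condExpMat_vecMulVec_signal_obs, h.condExpMat_vecMulVec_mulVec h.side_le
    h.matrix_meas h.matrix_memLp h.matrix_meas h.matrix_memLp,
    effNoise_posSemidef hm h.matrix_memLp, estimator_mul_obsCov hm h.matrix_memLp]
    with ω hcross hobs hΨ hM hdet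
  have hcov : (obsCov P (mT.comap Θ) R ω).PosDef := by
    have := (hΨ.posDef_iff_det_ne_zero.2 hdet).add_posSemidef
      (posSemidef_self_mul_conjTranspose (meanGain P (mT.comap Θ) R ω))
    rwa [effNoise, sub_add_cancel] at this
  have hunit := (isUnit_iff_isUnit_det _).1 hcov.isUnit
  change (condExpMat P (mT.comap Θ) _ ω * (condExpMat P (mT.comap Θ) _ ω)⁻¹) *ᵥ _ = _
  unfold outer
  rw [hcross, hobs, ← hM hdet]
  exact congrArg (· *ᵥ _) (mul_nonsing_inv_cancel_right _ _ hunit)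

lemma mmseErrorCov_eq (h : WhiteChannel P (mT.comap Θ) 𝓢 u R)
    (hdet : ∀ᵐ ω ∂P, (effNoise P (mT.comap Θ) R ω).det ≠ 0) :
    mmseErrorCov P Θ (fun ω => u ω ∘ Sum.inl) (fun ω => R ω *ᵥ u ω)
      =ᵐ[P] fun ω => (precision P (mT.comap Θ) R ω)⁻¹ := by
  refine (condExpMat_congr_ae ?_).trans h.condExpMat_vecMulVec_error
  filter_upwards [h.mmseEstimate_eq, hdet] with ω hest hω
  rw [hest hω, ← errorMatrix_mulVec, outer]

lemma log2det_smul_one_sub_log2det_smul_inv {c : ℝ} (hc : 0 < c) {Q : Matrix (Fin k) (Fin k) ℂ}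
    (hQ : Q.PosDef) :
    log2det ((c : ℂ) • (1 : Matrix (Fin k) (Fin k) ℂ)) - log2det ((c : ℂ) • Q⁻¹) = log2det Q := by
  have hsmul : ∀ X : Matrix (Fin k) (Fin k) ℂ, ((c : ℂ) • X).det.re = c ^ k * X.det.re :=
    fun X => by rw [det_smul, Fintype.card_fin, ← Complex.ofReal_pow, Complex.re_ofReal_mul]
  have hdet := det_re_pos hQ
  rw [log2det, log2det, hsmul, hsmul, det_inv_re hQ.isHermitian, det_one, Complex.one_re, mul_one,
    Real.logb_mul (by positivity) (by positivity), Real.logb_inv, sub_add_cancel_left, neg_neg,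
    log2det]

lemma mmseSE_eq (h : WhiteChannel P (mT.comap Θ) 𝓢 u R)
    (hdet : ∀ᵐ ω ∂P, (effNoise P (mT.comap Θ) R ω).det ≠ 0) (f : ℝ) :
    mmseSE P f Θ (fun ω => u ω ∘ Sum.inl) (fun ω => R ω *ᵥ u ω)
      = f * ∫ ω, log2det (precision P (mT.comap Θ) R ω) ∂P := by
  refine congrArg (f * ·) (integral_congr_ae ?_)
  filter_upwards [h.mmseErrorCov_eq hdet, precision_posDef h.side_le_ambient h.matrix_memLp]
    with ω hcov hQ
  rw [hcov]
  exact log2det_smul_one_sub_log2det_smul_inv (by positivity) hQ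

omit [IsProbabilityMeasure P] in
lemma measurable_mmseEstimate (hΘ : Measurable Θ) (x : Ω → Fin k → ℂ) {y : Ω → Fin k → ℂ}
    (hy : Measurable y) : Measurable (mmseEstimate P Θ x y) :=
  have hcond : ∀ X : Ω → Matrix (Fin k) (Fin k) ℂ, EntryMeasurable mΩ (condMat P Θ X) := fun X =>
    (EntryMeasurable.condExpMat (m := mT.comap Θ) P X).mono hΘ.comap_le
  ((hcond _).mul (hcond _).inv).mulVec hy

omit [IsProbabilityMeasure P] in
lemma measurable_obs (h : WhiteChannel P m 𝓢 u R) : Measurable[mΩ] fun ω => R ω *ᵥ u ω :=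
  (h.matrix_meas.mono h.state_le).mulVec h.measurable

omit [Fintype η] [IsProbabilityMeasure P] in
lemma measurable_signal (h : WhiteChannel P m 𝓢 u R) : Measurable[mΩ] fun ω => u ω ∘ Sum.inl :=
  measurable_pi_iff.2 fun i => (measurable_pi_apply (Sum.inl i)).comp h.measurable

/-- The auxiliary posterior in the Donsker–Varadhan bound is a function of `U` only, so `U` has to
determine the side information and the linear MMSE estimate. -/
lemma isAchievableSE_of_recoverable (h : WhiteChannel P (mT.comap Θ) 𝓢 u R)
    (hlaw : P.map (fun ω => u ω ∘ Sum.inl) = stdCNVec k)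
    (hlog : Integrable (fun ω => Real.log (precision P (mT.comap Θ) R ω).det.re) P)
    {f : ℝ} (hf : 0 ≤ f) {𝒰 : Type*} [MeasurableSpace 𝒰] {U : Ω → 𝒰} (hU : Measurable U)
    {t : 𝒰 → T} (ht : Measurable t) (htU : ∀ ω, t (U ω) = Θ ω) {c : 𝒰 → Fin k → ℂ}
    (hc : Measurable c)
    (hcU : ∀ᵐ ω ∂P, c (U ω) = estimator P (mT.comap Θ) R ω *ᵥ (R ω *ᵥ u ω)) :
    IsAchievableSE f (mutualInfo P (fun ω => u ω ∘ Sum.inl) U)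
      (f * ∫ ω, log2det (precision P (mT.comap Θ) R ω) ∂P) := by
  obtain ⟨Q, hQm, hQ⟩ := (entryMeasurable_precision (P := P) (m := mT.comap Θ) R).exists_eq_comp
  have hQU : ∀ ω, Q (t (U ω)) = precision P (mT.comap Θ) R ω := fun ω => by
    rw [htU]
    exact (congrFun hQ ω).symm
  obtain ⟨hint, hval⟩ := h.integral_posteriorLogRatio hlog
  have hratio : (fun ω => posteriorLogRatio (precision P (mT.comap Θ) R ω)
      (estimator P (mT.comap Θ) R ω *ᵥ (R ω *ᵥ u ω)) (u ω ∘ Sum.inl))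
      =ᵐ[P] fun ω => posteriorLogRatio (Q (t (U ω))) (c (U ω)) (u ω ∘ Sum.inl) := by
    filter_upwards [hcU] with ω hω
    rw [hQU, hω]
  have hkl := ofReal_integral_posteriorLogRatio_le_klDiv h.measurable_signal hlaw hU
    (Q := fun v => Q (t v)) (fun i j => (hQm i j).comp ht) hc
    ((precision_posDef h.side_le_ambient h.matrix_memLp).mono fun ω hω => (hQU ω).symm ▸ hω)
    (hint.congr hratio)
  rw [← integral_congr_ae hratio, hval] at hkl
  have hbits : ∫ ω, log2det (precision P (mT.comap Θ) R ω) ∂P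
      = (∫ ω, Real.log (precision P (mT.comap Θ) R ω).det.re ∂P) / Real.log 2 :=
    integral_div _ _
  rw [IsAchievableSE, mutualInfo, ENNReal.ofReal_mul hf, hbits,
    ENNReal.ofReal_div_of_pos (Real.log_pos one_lt_two)]
  gcongr

lemma isAchievableSE_estimate (h : WhiteChannel P (mT.comap Θ) 𝓢 u R) (hΘ : Measurable Θ)
    (hlaw : P.map (fun ω => u ω ∘ Sum.inl) = stdCNVec k)
    (hlog : Integrable (fun ω => Real.log (precision P (mT.comap Θ) R ω).det.re) P)
    {f : ℝ} (hf : 0 ≤ f) :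
    IsAchievableSE f (mutualInfo P (fun ω => u ω ∘ Sum.inl) fun ω =>
        (mmseEstimate P Θ (fun ω => u ω ∘ Sum.inl) (fun ω => R ω *ᵥ u ω) ω, Θ ω))
      (f * ∫ ω, log2det (precision P (mT.comap Θ) R ω) ∂P) := by
  classical
  obtain ⟨Ψ, hΨm, hΨ⟩ := (entryMeasurable_effNoise (P := P) (m := mT.comap Θ) R).exists_eq_comp
  have hsingular : MeasurableSet {q : (Fin k → ℂ) × T | (Ψ q.2).det = 0} :=
    (hΨm.det.comp measurable_snd) (measurableSet_singleton 0)
  -- The estimate reveals nothing where `Ψ` is singular, so the guess there is `0`.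
  refine h.isAchievableSE_of_recoverable hlaw hlog hf
    ((measurable_mmseEstimate hΘ _ h.measurable_obs).prodMk hΘ) measurable_snd (fun _ => rfl)
    (c := fun q => if (Ψ q.2).det = 0 then 0 else q.1)
    (Measurable.ite hsingular measurable_const measurable_fst) ?_
  filter_upwards [h.mmseEstimate_eq] with ω hest
  have hΨω : Ψ (Θ ω) = effNoise P (mT.comap Θ) R ω := (congrFun hΨ ω).symm
  split_ifs with hdet
  · rw [estimator_eq_zero (hΨω ▸ hdet), zero_mulVec]
  · exact hest (hΨω ▸ hdet)

lemma isAchievableSE_obs (h : WhiteChannel P (mT.comap Θ) 𝓢 u R) (hΘ : Measurable Θ)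
    (hlaw : P.map (fun ω => u ω ∘ Sum.inl) = stdCNVec k)
    (hlog : Integrable (fun ω => Real.log (precision P (mT.comap Θ) R ω).det.re) P)
    {f : ℝ} (hf : 0 ≤ f) :
    IsAchievableSE f (mutualInfo P (fun ω => u ω ∘ Sum.inl) fun ω => (R ω *ᵥ u ω, Θ ω))
      (f * ∫ ω, log2det (precision P (mT.comap Θ) R ω) ∂P) := by
  obtain ⟨A, hA, hAΘ⟩ := (entryMeasurable_estimator (P := P) (m := mT.comap Θ) R).exists_eq_comp
  refine h.isAchievableSE_of_recoverable hlaw hlog hf (h.measurable_obs.prodMk hΘ) measurable_snd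
    (fun _ => rfl) (c := fun q => A q.2 *ᵥ q.1)
    (EntryMeasurable.mulVec (fun i j => (hA i j).comp measurable_snd) measurable_fst)
    (.of_forall fun ω => ?_)
  rw [hAΘ, Function.comp_apply]

end Rates

end WhiteChannel

end WhiteChannel

section AllMoments

variable {Ω ι κ η : Type*} {mΩ : MeasurableSpace Ω} {P : Measure Ω}

/-- A random matrix whose entries have finite moments of all orders. Unlike `EntryMemLp`, this is
preserved by products. -/
def AllMoments (X : Ω → Matrix ι κ ℂ) (P : Measure Ω) : Prop :=
  ∀ p : ℝ≥0∞, p ≠ ∞ → EntryMemLp X p P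

namespace AllMoments

lemma const [IsFiniteMeasure P] (A : Matrix ι κ ℂ) : AllMoments (fun _ => A) P :=
  fun _ _ => .const A

lemma of_bounded [IsFiniteMeasure P] {X : Ω → Matrix ι κ ℂ} (hX : EntryMeasurable mΩ X)
    (c : ℝ) (hc : ∀ ω i j, ‖X ω i j‖ ≤ c) : AllMoments X P := fun _ _ i j =>
  MemLp.of_bound (hX i j).aestronglyMeasurable c (.of_forall fun ω => hc ω i j)

lemma add {X Y : Ω → Matrix ι κ ℂ} (hX : AllMoments X P) (hY : AllMoments Y P) :
    AllMoments (fun ω => X ω + Y ω) P := fun p hp => (hX p hp).add (hY p hp)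

lemma smul {X : Ω → Matrix ι κ ℂ} (hX : AllMoments X P) (c : ℂ) :
    AllMoments (fun ω => c • X ω) P := fun p hp => (hX p hp).smul c

lemma conjTranspose {X : Ω → Matrix ι κ ℂ} (hX : AllMoments X P) :
    AllMoments (fun ω => (X ω)ᴴ) P := fun p hp => (hX p hp).conjTranspose

lemma mul [Fintype κ] {X : Ω → Matrix ι κ ℂ} {Y : Ω → Matrix κ η ℂ} (hX : AllMoments X P)
    (hY : AllMoments Y P) : AllMoments (fun ω => X ω * Y ω) P := fun p hp =>
  have h2p : 2 * p ≠ ∞ := ENNReal.mul_ne_top (by simp) hp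
  have : ENNReal.HolderTriple (2 * p) (2 * p) p := ⟨by
    rw [← two_mul, ENNReal.mul_inv (by simp) (by simp), ← mul_assoc,
      ENNReal.mul_inv_cancel (by simp) (by simp), one_mul]⟩
  (hX _ h2p).mul (hY _ h2p)

lemma sum {ν : Type*} (s : Finset ν) {X : ν → Ω → Matrix ι κ ℂ}
    (hX : ∀ a, AllMoments (X a) P) : AllMoments (fun ω => ∑ a ∈ s, X a ω) P :=
  fun p hp => .sum s fun a => hX a p hp

lemma memLp_one {X : Ω → Matrix ι κ ℂ} (hX : AllMoments X P) : EntryMemLp X 1 P :=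
  hX 1 ENNReal.one_ne_top

lemma memLp_two {X : Ω → Matrix ι κ ℂ} (hX : AllMoments X P) : EntryMemLp X 2 P :=
  hX 2 ENNReal.ofNat_ne_top

end AllMoments

end AllMoments

section GaussianMoments

lemma memLp_id_stdCN {p : ℝ≥0∞} (hp : p ≠ ∞) : MemLp (fun z : ℂ => z) p stdCN := by
  refine (memLp_map_measure_iff (by fun_prop) measurable_complex_mk.aemeasurable).2 ?_
  have hcoord := memLp_id_gaussianReal' (μ := 0) (v := 1 / 2) p hp
  have hre : MemLp (fun q : ℝ × ℝ => (q.1 : ℂ)) p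
      ((gaussianReal 0 (1 / 2)).prod (gaussianReal 0 (1 / 2))) :=
    (hcoord.comp_measurePreserving measurePreserving_fst).ofReal
  have him : MemLp (fun q : ℝ × ℝ => (q.2 : ℂ)) p
      ((gaussianReal 0 (1 / 2)).prod (gaussianReal 0 (1 / 2))) :=
    (hcoord.comp_measurePreserving measurePreserving_snd).ofReal
  refine (hre.add (him.mul_const Complex.I)).ae_eq (.of_forall fun q => ?_)
  exact (Complex.mk_eq_add_mul_I _ _).symm

lemma integral_id_stdCN : ∫ z, z ∂stdCN = 0 := by
  have hsymm : stdCN.map (fun z => -z) = stdCN := by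
    have hneg : (fun z : ℂ => -z) ∘ (fun q : ℝ × ℝ => (⟨q.1, q.2⟩ : ℂ))
        = (fun q : ℝ × ℝ => (⟨q.1, q.2⟩ : ℂ)) ∘ Prod.map (fun a => -a) (fun a => -a) := rfl
    unfold stdCN
    rw [Measure.map_map (by fun_prop) measurable_complex_mk, hneg,
      ← Measure.map_map measurable_complex_mk (by fun_prop),
      ← Measure.map_prod_map _ _ (by fun_prop) (by fun_prop), gaussianReal_map_neg, neg_zero]
  have hint : ∫ z, z ∂stdCN = ∫ z, -z ∂stdCN := by
    conv_lhs => rw [← hsymm]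
    exact integral_map (by fun_prop) (by fun_prop)
  rw [integral_neg] at hint
  exact self_eq_neg.1 hint

lemma integral_sq_gaussianReal (v : NNReal) : ∫ a, a ^ 2 ∂(gaussianReal 0 v) = v := by
  have hvar := variance_of_integral_eq_zero (X := fun a : ℝ => a) (μ := gaussianReal 0 v)
    aemeasurable_id integral_id_gaussianReal
  exact hvar.symm.trans variance_fun_id_gaussianReal

lemma integral_mul_star_stdCN : ∫ z, z * star z ∂stdCN = 1 := by
  have hsq : Integrable (fun a : ℝ => a ^ 2) (gaussianReal 0 (1 / 2)) :=
    (memLp_id_gaussianReal 2).integrable_sq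
  have hmul : ∀ q : ℝ × ℝ, (⟨q.1, q.2⟩ : ℂ) * star (⟨q.1, q.2⟩ : ℂ)
      = ((q.1 ^ 2 + q.2 ^ 2 : ℝ) : ℂ) := fun q => by
    rw [Complex.star_def, Complex.mul_conj, Complex.normSq_mk, sq, sq]
  unfold stdCN
  rw [integral_map measurable_complex_mk.aemeasurable (by fun_prop)]
  simp only [hmul]
  rw [integral_complex_ofReal, integral_add (hsq.comp_fst _) (hsq.comp_snd _),
    integral_fun_fst (fun a : ℝ => a ^ 2), integral_fun_snd (fun a : ℝ => a ^ 2),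
    integral_sq_gaussianReal]
  norm_num [measureReal_def]

variable {Ω : Type*} [MeasurableSpace Ω] {P : Measure Ω}

lemma allMoments_of_law {a b : ℕ} {X : Ω → Matrix (Fin a) (Fin b) ℂ} (hX : Measurable X)
    (hlaw : P.map X = stdCNMat a b) : AllMoments X P := fun _ hp i j =>
  have hentry : MeasurePreserving (fun A : Matrix (Fin a) (Fin b) ℂ => A i j)
      (stdCNMat a b) stdCN :=
    (measurePreserving_eval (fun _ : Fin b => stdCN) j).comp
      (measurePreserving_eval (fun _ : Fin a => Measure.pi fun _ : Fin b => stdCN) i)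
  (memLp_id_stdCN hp).comp_measurePreserving (hentry.comp ⟨hX, hlaw⟩)

variable {k : ℕ} {x : Ω → Fin k → ℂ}

lemma measurePreserving_apply_of_law (hx : Measurable x) (hlaw : P.map x = stdCNVec k)
    (i : Fin k) : MeasurePreserving (fun ω => x ω i) P stdCN :=
  (measurePreserving_eval (fun _ : Fin k => stdCN) i).comp ⟨hx, hlaw⟩

lemma integral_apply_of_law (hx : Measurable x) (hlaw : P.map x = stdCNVec k) (i : Fin k) :
    ∫ ω, x ω i ∂P = 0 := by
  have h := measurePreserving_apply_of_law hx hlaw i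
  rw [← integral_id_stdCN, ← h.map_eq, integral_map h.measurable.aemeasurable (by fun_prop)]

lemma integral_mul_star_of_indepFun {f g : Ω → ℂ} (h : IndepFun f g P) (hf : Measurable f)
    (hg : Measurable g) (h0 : ∫ ω, f ω ∂P = 0 ∨ ∫ ω, g ω ∂P = 0) :
    ∫ ω, f ω * star (g ω) ∂P = 0 := by
  have hstar : Measurable (star : ℂ → ℂ) := Complex.continuous_conj.measurable
  have hconj : ∫ ω, star (g ω) ∂P = star (∫ ω, g ω ∂P) := integral_conj
  have hindep : IndepFun f (fun ω => star (g ω)) P := h.comp measurable_id hstar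
  rw [hindep.integral_fun_mul_eq_mul_integral hf.aestronglyMeasurable
    (hstar.comp hg).aestronglyMeasurable, hconj]
  rcases h0 with h0 | h0 <;> rw [h0]
  · rw [zero_mul]
  · rw [star_zero, mul_zero]

lemma isWhite_of_law [IsProbabilityMeasure P] (hx : Measurable x)
    (hlaw : P.map x = stdCNVec k) : IsWhite P x := by
  intro i j
  have hcoord := measurePreserving_apply_of_law hx hlaw
  obtain rfl | hij := eq_or_ne i j
  · rw [one_apply_eq, ← integral_mul_star_stdCN, ← (hcoord i).map_eq,
      integral_map (hcoord i).measurable.aemeasurable (by fun_prop)]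
  · have hindep : iIndepFun (fun i ω => x ω i) P := by
      rw [iIndepFun_iff_map_fun_eq_pi_map fun i => (hcoord i).measurable.aemeasurable]
      simp only [(hcoord _).map_eq]
      exact hlaw
    rw [one_apply_ne hij]
    exact integral_mul_star_of_indepFun (hindep.indepFun hij) (hcoord i).measurable
      (hcoord j).measurable (.inl (integral_apply_of_law hx hlaw i))

end GaussianMoments

section Independence

variable {Ω : Type*} [MeasurableSpace Ω] {P : Measure Ω}
  {A B C D E : Type*} [MeasurableSpace A] [MeasurableSpace B] [MeasurableSpace C]
  [MeasurableSpace D] [MeasurableSpace E] {X : Ω → A} {J : Ω → B} {N : Ω → C} {S : Ω → D}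

lemma indepFun_prodMk_of_chain [IsProbabilityMeasure P] (hX : Measurable X) (hJ : Measurable J)
    (hN : Measurable N) (h₁ : IndepFun X (fun ω => (J ω, N ω)) P) (h₂ : IndepFun J N P) :
    IndepFun (fun ω => (X ω, J ω)) N P := by
  have := Measure.isProbabilityMeasure_map (μ := P) hX.aemeasurable
  have := Measure.isProbabilityMeasure_map (μ := P) hJ.aemeasurable
  have := Measure.isProbabilityMeasure_map (μ := P) hN.aemeasurable
  have hXJ : IndepFun X J P := h₁.comp measurable_id measurable_fst
  rw [indepFun_iff_map_prod_eq_prod_map_map (by fun_prop) (by fun_prop)] at h₁ h₂ hXJ ⊢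
  refine MeasurableEquiv.map_measurableEquiv_injective MeasurableEquiv.prodAssoc ?_
  rw [hXJ, Measure.prodAssoc_prod, ← h₂, ← h₁,
    Measure.map_map MeasurableEquiv.prodAssoc.measurable (by fun_prop)]
  rfl

lemma MutuallyIndep.indepFun_source [IsProbabilityMeasure P] (h : MutuallyIndep P X J N S)
    (hX : Measurable X) (hJ : Measurable J) (hN : Measurable N) (hS : Measurable S) :
    IndepFun (fun ω => (X ω, J ω, N ω)) S P := by
  obtain ⟨h₁, h₂, h₃⟩ := h
  refine indepFun_prodMk_of_chain hX (hJ.prodMk hN) hS ?_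
    (indepFun_prodMk_of_chain hJ hN hS h₂ h₃)
  exact h₁.comp (ψ := fun q : B × C × D => ((q.1, q.2.1), q.2.2)) measurable_id (by fun_prop)

lemma MutuallyIndep.comp_noise (h : MutuallyIndep P X J N S) {g : C → E} (hg : Measurable g) :
    MutuallyIndep P X J (fun ω => g (N ω)) S := by
  obtain ⟨h₁, h₂, h₃⟩ := h
  exact ⟨h₁.comp (ψ := fun q : B × C × D => (q.1, g q.2.1, q.2.2)) measurable_id (by fun_prop),
    h₂.comp (ψ := fun q : C × D => (g q.1, q.2)) measurable_id (by fun_prop),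
    h₃.comp hg measurable_id⟩

end Independence

section SourceVector

variable {Ω ι κ η E : Type*} [mΩ : MeasurableSpace Ω] {P : Measure Ω} [mE : MeasurableSpace E]

/-- The stacked vector of signal, interference and noise. -/
def sourceVec (x : Ω → ι → ℂ) (v : Ω → κ → ℂ) (w : Ω → η → ℂ) (ω : Ω) : ι ⊕ (κ ⊕ η) → ℂ :=
  Sum.elim (x ω) (Sum.elim (v ω) (w ω))

lemma measurable_sumElim : Measurable fun q : (ι → ℂ) × (κ → ℂ) => Sum.elim q.1 q.2 :=
  measurable_pi_iff.2 fun
    | .inl i => (measurable_pi_apply i).comp measurable_fst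
    | .inr j => (measurable_pi_apply j).comp measurable_snd

variable [DecidableEq ι] [DecidableEq κ] [DecidableEq η]

lemma IsWhite.sumElim {u : Ω → ι → ℂ} {v : Ω → κ → ℂ} (hu : IsWhite P u) (hv : IsWhite P v)
    (hum : Measurable u) (hvm : Measurable v) (hindep : IndepFun u v P)
    (h0 : (∀ i, ∫ ω, u ω i ∂P = 0) ∨ ∀ j, ∫ ω, v ω j ∂P = 0) :
    IsWhite P fun ω => Sum.elim (u ω) (v ω) := by
  have hui := fun i => (measurable_pi_apply i).comp hum
  have hvj := fun j => (measurable_pi_apply j).comp hvm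
  have hij : ∀ i j, IndepFun (fun ω => u ω i) (fun ω => v ω j) P := fun i j =>
    hindep.comp (measurable_pi_apply i) (measurable_pi_apply j)
  rintro (i | i) (j | j)
  · exact (hu i j).trans (by simp [one_apply])
  · exact (integral_mul_star_of_indepFun (hij i j) (hui i) (hvj j)
      (h0.imp (· i) (· j))).trans (one_apply_ne Sum.inl_ne_inr).symm
  · exact (integral_mul_star_of_indepFun (hij j i).symm (hvj i) (hui j)
      (h0.symm.imp (· i) (· j))).trans (one_apply_ne Sum.inr_ne_inl).symm
  · exact (hv i j).trans (by simp [one_apply])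

lemma whiteSource_sourceVec [IsProbabilityMeasure P] {x : Ω → ι → ℂ} {v : Ω → κ → ℂ}
    {w : Ω → η → ℂ} {Z : Ω → E} (hx : Measurable x) (hv : Measurable v) (hw : Measurable w)
    (hZ : Measurable Z) (hindep : MutuallyIndep P x v w Z) (hxwhite : IsWhite P x)
    (hvwhite : IsWhite P v) (hwwhite : IsWhite P w) (hxmean : ∀ i, ∫ ω, x ω i ∂P = 0)
    (hwmean : ∀ a, ∫ ω, w ω a ∂P = 0) :
    WhiteSource P (mE.comap Z) (sourceVec x v w) where
  state_le := hZ.comap_le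
  measurable := measurable_sumElim.comp (hx.prodMk (measurable_sumElim.comp (hv.prodMk hw)))
  indep := by
    have hsource : IndepFun (sourceVec x v w) Z P :=
      (hindep.indepFun_source hx hv hw hZ).comp
        (φ := fun q : (ι → ℂ) × (κ → ℂ) × (η → ℂ) => Sum.elim q.1 (Sum.elim q.2.1 q.2.2))
        (measurable_sumElim.comp (measurable_fst.prodMk (measurable_sumElim.comp measurable_snd)))
        measurable_id
    exact (IndepFun_iff_Indep _ _ _).1 hsource
  white := by
    have hvw : IndepFun v w P := hindep.2.1.comp measurable_id measurable_fst
    have hxvw : IndepFun x (fun ω => Sum.elim (v ω) (w ω)) P :=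
      hindep.1.comp (ψ := fun q : (κ → ℂ) × (η → ℂ) × E => Sum.elim q.1 q.2.1)
        measurable_id (measurable_sumElim.comp (measurable_fst.prodMk measurable_snd.fst))
    exact hxwhite.sumElim (hvwhite.sumElim hwwhite hv hw hvw (.inr hwmean)) hx
      (measurable_sumElim.comp (hv.prodMk hw)) hxvw (.inl hxmean)

end SourceVector

section ChannelMatrix

variable {Ω ι κ η ν : Type*}

/-- The matrix of the channel `y = L (B x + w) + J v` with signal `x`, interference `v` and
noise `w`. -/
noncomputable def channelMatrix [Fintype ν] (L : Ω → Matrix κ ν ℂ) (B : Ω → Matrix ν ι ℂ)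
    (J : Ω → Matrix κ η ℂ) (ω : Ω) : Matrix κ (ι ⊕ (η ⊕ ν)) ℂ :=
  fromCols (L ω * B ω) (fromCols (J ω) (L ω))

variable {m 𝓢 mΩ : MeasurableSpace Ω} {P : Measure Ω} [Fintype ν] {L : Ω → Matrix κ ν ℂ}
  {B : Ω → Matrix ν ι ℂ} {J : Ω → Matrix κ η ℂ}

lemma meanGain_channelMatrix (ω : Ω) :
    meanGain P m (channelMatrix L B J) ω = condExpMat P m (fun ω => L ω * B ω) ω := by
  simp only [meanGain, channelMatrix, toCols₁_fromCols]

lemma entryMeasurable_channelMatrix (hL : EntryMeasurable m L) (hB : EntryMeasurable m B)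
    (hJ : EntryMeasurable m J) : EntryMeasurable m (channelMatrix L B J) := fun i => fun
  | .inl j => hL.mul hB i j
  | .inr (.inl j) => hJ i j
  | .inr (.inr j) => hL i j

lemma allMoments_channelMatrix (hL : AllMoments L P) (hB : AllMoments B P)
    (hJ : AllMoments J P) : AllMoments (channelMatrix L B J) P := fun p hp i => fun
  | .inl j => (hL.mul hB) p hp i j
  | .inr (.inl j) => hJ p hp i j
  | .inr (.inr j) => hL p hp i j

lemma whiteChannel_channelMatrix [DecidableEq ι] [DecidableEq η] [DecidableEq ν]
    {u : Ω → ι ⊕ (η ⊕ ν) → ℂ} (h : WhiteSource P 𝓢 u) (hm : m ≤ 𝓢) (hLm : EntryMeasurable 𝓢 L)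
    (hBm : EntryMeasurable 𝓢 B) (hJm : EntryMeasurable 𝓢 J) (hL : AllMoments L P)
    (hB : AllMoments B P) (hJ : AllMoments J P) :
    WhiteChannel P m 𝓢 u (channelMatrix L B J) where
  toWhiteSource := h
  side_le := hm
  matrix_meas := entryMeasurable_channelMatrix hLm hBm hJm
  matrix_memLp := (allMoments_channelMatrix hL hB hJ).memLp_two

variable [Fintype η]

lemma toCols₂_channelMatrix_mul_conjTranspose (ω : Ω) :
    (channelMatrix L B J ω).toCols₂ * (channelMatrix L B J ω).toCols₂ᴴ
      = J ω * (J ω)ᴴ + L ω * (L ω)ᴴ := by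
  rw [channelMatrix, toCols₂_fromCols, conjTranspose_fromCols_eq_fromRows_conjTranspose,
    fromCols_mul_fromRows]

variable [Fintype ι]

lemma channelMatrix_mulVec_sourceVec (x : Ω → ι → ℂ) (v : Ω → η → ℂ) (w : Ω → ν → ℂ) (ω : Ω) :
    channelMatrix L B J ω *ᵥ sourceVec x v w ω
      = (L ω * B ω) *ᵥ x ω + (J ω *ᵥ v ω + L ω *ᵥ w ω) := by
  simp only [channelMatrix, sourceVec, fromCols_mulVec_sumElim]

lemma channelMatrix_mul_conjTranspose (ω : Ω) :
    channelMatrix L B J ω * (channelMatrix L B J ω)ᴴ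
      = L ω * B ω * (L ω * B ω)ᴴ + (J ω * (J ω)ᴴ + L ω * (L ω)ᴴ) := by
  simp only [channelMatrix, conjTranspose_fromCols_eq_fromRows_conjTranspose,
    fromCols_mul_fromRows]

lemma effNoise_channelMatrix [Finite κ] (hL : AllMoments L P) (hB : AllMoments B P)
    (hJ : AllMoments J P) :
    effNoise P m (channelMatrix L B J) =ᵐ[P] fun ω =>
      condExpMat P m (fun ω => L ω * B ω * (L ω * B ω)ᴴ) ω
        + (condExpMat P m (fun ω => J ω * (J ω)ᴴ) ω + condExpMat P m (fun ω => L ω * (L ω)ᴴ) ω)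
        - condExpMat P m (fun ω => L ω * B ω) ω * (condExpMat P m (fun ω => L ω * B ω) ω)ᴴ := by
  have hLB := ((hL.mul hB).mul (hL.mul hB).conjTranspose).memLp_one
  have hJJ := (hJ.mul hJ.conjTranspose).memLp_one
  have hLL := (hL.mul hL.conjTranspose).memLp_one
  filter_upwards [condExpMat_add (m := m) hLB (hJJ.add hLL), condExpMat_add (m := m) hJJ hLL]
    with ω hsum hnoise
  rw [effNoise, meanGain_channelMatrix, obsCov, funext channelMatrix_mul_conjTranspose, hsum,
    hnoise]

variable [Fintype κ] [DecidableEq κ] [DecidableEq ι] [IsProbabilityMeasure P]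

open scoped ComplexOrder

lemma integrable_log_det_precision_channelMatrix (hm : m ≤ mΩ) (hL : AllMoments L P)
    (hB : AllMoments B P) (hJ : AllMoments J P) :
    Integrable (fun ω => Real.log (precision P m (channelMatrix L B J) ω).det.re) P := by
  refine integrable_log_det_precision hm (allMoments_channelMatrix hL hB hJ).memLp_two
    hL.memLp_two hB.memLp_two (fun ω => toCols₁_fromCols _ _) fun ω => ?_
  rw [toCols₂_channelMatrix_mul_conjTranspose, add_sub_cancel_right]
  exact posSemidef_self_mul_conjTranspose _

omit [DecidableEq ι] in
lemma effNoise_channelMatrix_one_posDef {B : Ω → Matrix κ ι ℂ} (hm : m ≤ mΩ)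
    (hB : AllMoments B P) (hJ : AllMoments J P) :
    ∀ᵐ ω ∂P, (effNoise P m (channelMatrix (fun _ => 1) B J) ω).PosDef := by
  have hJJ := (hJ.mul hJ.conjTranspose).memLp_one
  filter_upwards [effNoise_sub_posSemidef hm (allMoments_channelMatrix (.const 1) hB hJ).memLp_two,
    condExpMat_add (m := m) hJJ (AllMoments.const 1).memLp_one,
    condExpMat_posSemidef (m := m) hJJ
      (.of_forall fun ω => posSemidef_self_mul_conjTranspose (J ω))] with ω hsub hadd hpos
  simp only [toCols₂_channelMatrix_mul_conjTranspose, conjTranspose_one, Matrix.mul_one] at hsub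
  rw [hadd, condExpMat_const hm] at hsub
  have hsplit : 1 + (effNoise P m (channelMatrix (fun _ => 1) B J) ω
      - (condExpMat P m (fun ω => J ω * (J ω)ᴴ) ω + 1) + condExpMat P m (fun ω => J ω * (J ω)ᴴ) ω)
      = effNoise P m (channelMatrix (fun _ => 1) B J) ω := by abel
  exact hsplit ▸ PosDef.one.add_posSemidef (hsub.add hpos)

end ChannelMatrix

section PowerScaling

variable {Ω ι κ η ν : Type*} {m mΩ : MeasurableSpace Ω} {P : Measure Ω}

lemma ofReal_sqrt_mul_self {a : ℝ} (ha : 0 ≤ a) :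
    ((Real.sqrt a : ℝ) : ℂ) * ((Real.sqrt a : ℝ) : ℂ) = (a : ℂ) := by
  rw [← Complex.ofReal_mul, Real.mul_self_sqrt ha]

lemma sqrt_smul_mul_conjTranspose [Fintype κ] {a : ℝ} (ha : 0 ≤ a) (X : Matrix ι κ ℂ)
    (Y : Matrix η κ ℂ) :
    ((Real.sqrt a : ℝ) : ℂ) • X * (((Real.sqrt a : ℝ) : ℂ) • Y)ᴴ = (a : ℂ) • (X * Yᴴ) := by
  rw [conjTranspose_smul, Complex.star_def, Complex.conj_ofReal, Matrix.smul_mul, Matrix.mul_smul,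
    smul_smul, ofReal_sqrt_mul_self ha]

variable [Fintype ι] [Fintype η] [Fintype ν] {L : Ω → Matrix κ ν ℂ} {B : Ω → Matrix ν ι ℂ}
  {C : Ω → Matrix κ ι ℂ} {J : Ω → Matrix κ η ℂ} {ρ : ℝ}

lemma precision_channelMatrix_of_gain [Fintype κ] [DecidableEq κ] [DecidableEq ι] (hρ : 0 ≤ ρ)
    (hC : AllMoments C P) (hLB : ∀ ω, L ω * B ω = ((Real.sqrt ρ : ℝ) : ℂ) • C ω) :
    precision P m (channelMatrix L B J) =ᵐ[P] fun ω =>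
      1 + (ρ : ℂ) • (condExpMat P m (fun ω => (C ω)ᴴ) ω
        * (effNoise P m (channelMatrix L B J) ω)⁻¹ * condExpMat P m C ω) := by
  filter_upwards [condExpMat_conjTranspose (m := m) hC.memLp_one,
    condExpMat_smul (P := P) (m := m) ((Real.sqrt ρ : ℝ) : ℂ) C] with ω hstar hsmul
  rw [precision, meanGain_channelMatrix, funext hLB, hsmul, hstar, conjTranspose_smul,
    Complex.star_def, Complex.conj_ofReal, Matrix.smul_mul, Matrix.smul_mul, Matrix.mul_smul,
    smul_smul, ofReal_sqrt_mul_self hρ]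

lemma effNoise_channelMatrix_of_gain [Finite κ] {σ : ℝ} (hρ : 0 ≤ ρ) (hσ : 0 ≤ σ)
    (hL : AllMoments L P) (hB : AllMoments B P) (hJ : AllMoments J P)
    (hLB : ∀ ω, L ω * B ω = ((Real.sqrt ρ : ℝ) : ℂ) • C ω) :
    effNoise P m (channelMatrix L B fun ω => ((Real.sqrt σ : ℝ) : ℂ) • J ω) =ᵐ[P] fun ω =>
      (ρ : ℂ) • condExpMat P m (fun ω => C ω * (C ω)ᴴ) ω
        + ((σ : ℂ) • condExpMat P m (fun ω => J ω * (J ω)ᴴ) ω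
          + condExpMat P m (fun ω => L ω * (L ω)ᴴ) ω)
        - (ρ : ℂ) • (condExpMat P m C ω * (condExpMat P m C ω)ᴴ) := by
  filter_upwards [effNoise_channelMatrix (m := m) hL hB (hJ.smul ((Real.sqrt σ : ℝ) : ℂ)),
    condExpMat_smul (P := P) (m := m) ((Real.sqrt ρ : ℝ) : ℂ) C,
    condExpMat_smul (P := P) (m := m) (ρ : ℂ) fun ω => C ω * (C ω)ᴴ,
    condExpMat_smul (P := P) (m := m) (σ : ℂ) fun ω => J ω * (J ω)ᴴ]
    with ω hnoise hgain hsignal hjam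
  rw [hnoise]
  simp only [hLB, sqrt_smul_mul_conjTranspose hρ, sqrt_smul_mul_conjTranspose hσ]
  rw [hgain, hsignal, hjam, sqrt_smul_mul_conjTranspose hρ]

end PowerScaling

section Measurability

variable {Ω : Type*} {m : MeasurableSpace Ω} {k l : ℕ}

lemma measurable_entry (i : Fin k) (j : Fin l) :
    Measurable fun A : Matrix (Fin k) (Fin l) ℂ => A i j :=
  (measurable_pi_apply (X := fun _ : Fin l => ℂ) j).comp
    (measurable_pi_apply (X := fun _ : Fin k => Fin l → ℂ) i)

lemma EntryMeasurable.measurable {X : Ω → Matrix (Fin k) (Fin l) ℂ} (hX : EntryMeasurable m X) :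
    Measurable X :=
  measurable_pi_iff.2 fun i => measurable_pi_iff.2 fun j => hX i j

lemma entryMeasurable_of_measurable {X : Ω → Matrix (Fin k) (Fin l) ℂ} (hX : Measurable X) :
    EntryMeasurable m X :=
  fun i j => (measurable_entry i j).comp hX

lemma EntryMeasurable.normalizeCols {X : Ω → Matrix (Fin k) (Fin l) ℂ}
    (hX : EntryMeasurable m X) : EntryMeasurable m fun ω => normalizeCols (X ω) := fun i j =>
  (hX i j).div (Complex.measurable_ofReal.comp (Real.continuous_sqrt.measurable.comp
    (Finset.measurable_fun_sum _ fun i' _ => (hX i' j).norm.pow_const 2)))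

lemma EntryMeasurable.star_row {ι κ : Type*} {X : Ω → Matrix ι κ ℂ} (hX : EntryMeasurable m X)
    (i : ι) : Measurable fun ω => star (X ω i) :=
  measurable_pi_iff.2 fun j => Complex.continuous_conj.measurable.comp (hX i j)

end Measurability

section Bounds

open scoped ComplexOrder

lemma norm_normalizeCols_apply_le {k l : ℕ} (X : Matrix (Fin k) (Fin l) ℂ) (i : Fin k)
    (j : Fin l) : ‖normalizeCols X i j‖ ≤ 1 := by
  have hle : ‖X i j‖ ≤ Real.sqrt (∑ i', ‖X i' j‖ ^ 2) := Real.le_sqrt_of_sq_le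
    (Finset.single_le_sum (fun i' _ => sq_nonneg ‖X i' j‖) (Finset.mem_univ i))
  rw [normalizeCols, of_apply, norm_div, Complex.norm_real,
    Real.norm_of_nonneg (Real.sqrt_nonneg _)]
  exact div_le_one_of_le₀ hle (Real.sqrt_nonneg _)

variable {ι κ : Type*} [Fintype ι]

lemma norm_apply_le_sqrt_of_posSemidef [DecidableEq κ] {V : Matrix ι κ ℂ} {c : ℝ}
    (h : ((c : ℂ) • (1 : Matrix κ κ ℂ) - Vᴴ * V).PosSemidef) (i : ι) (j : κ) :
    ‖V i j‖ ≤ Real.sqrt c := by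
  have hcol : (Vᴴ * V) j j = ((∑ i', ‖V i' j‖ ^ 2 : ℝ) : ℂ) := by
    simp [mul_apply, Complex.conj_mul']
  have hdiag : 0 ≤ ((c - ∑ i', ‖V i' j‖ ^ 2 : ℝ) : ℂ) := by
    simpa [hcol] using h.diag_nonneg (i := j)
  refine Real.le_sqrt_of_sq_le ((Finset.single_le_sum (fun i' _ => sq_nonneg ‖V i' j‖)
    (Finset.mem_univ i)).trans (sub_nonneg.1 (Complex.zero_le_real.1 hdiag)))

variable [DecidableEq κ]

lemma posDef_gram_add_smul_one [Finite κ] (B : Matrix ι κ ℂ) {r : ℝ} (hr : 0 < r) :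
    (Bᴴ * B + (r : ℂ) • (1 : Matrix κ κ ℂ)).PosDef :=
  (PosDef.one.smul (Complex.zero_lt_real.2 hr)).posSemidef_add
    (posSemidef_conjTranspose_mul_self B)

variable [Fintype κ]

lemma conjTranspose_mul_self_regularized (B : Matrix ι κ ℂ) {r : ℝ} (hr : 0 < r) :
    (B * (Bᴴ * B + (r : ℂ) • (1 : Matrix κ κ ℂ))⁻¹)ᴴ * (B * (Bᴴ * B + (r : ℂ) • 1)⁻¹)
      = (Bᴴ * B + (r : ℂ) • 1)⁻¹
        - (r : ℂ) • ((Bᴴ * B + (r : ℂ) • 1)⁻¹ * (Bᴴ * B + (r : ℂ) • 1)⁻¹) := by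
  have hG := posDef_gram_add_smul_one B hr
  set G : Matrix κ κ ℂ := Bᴴ * B + (r : ℂ) • 1 with hGdef
  have hinv : G⁻¹ * G = 1 := nonsing_inv_mul _ ((isUnit_iff_isUnit_det _).1 hG.isUnit)
  calc (B * G⁻¹)ᴴ * (B * G⁻¹) = G⁻¹ * (Bᴴ * B) * G⁻¹ := by
        rw [conjTranspose_mul, hG.inv.1]
        simp only [Matrix.mul_assoc]
    _ = G⁻¹ * (G - (r : ℂ) • 1) * G⁻¹ := by rw [hGdef, add_sub_cancel_right]
    _ = G⁻¹ - (r : ℂ) • (G⁻¹ * G⁻¹) := by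
        simp only [Matrix.mul_sub, hinv, Matrix.sub_mul, Matrix.one_mul, Matrix.mul_smul,
          Matrix.mul_one, Matrix.smul_mul]

-- `1 / (4 r)` is the maximum of `t ↦ t - r t²`, attained at `t = 1 / (2 r)`.
lemma posSemidef_smul_one_sub_sub_smul_sq {K : Matrix κ κ ℂ} (hK : K.IsHermitian) {r : ℝ}
    (hr : 0 < r) :
    (((1 / (4 * r) : ℝ) : ℂ) • (1 : Matrix κ κ ℂ) - (K - (r : ℂ) • (K * K))).PosSemidef := by
  set d : ℂ := ((1 / (2 * r) : ℝ) : ℂ) with hd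
  have hrc : (r : ℂ) ≠ 0 := Complex.ofReal_ne_zero.2 hr.ne'
  have hlin : 2 * ((r : ℂ) * d) = 1 := by rw [hd]; push_cast; field_simp
  have hquad : ((1 / (4 * r) : ℝ) : ℂ) = (r : ℂ) * (d * d) := by
    rw [hd]; push_cast; field_simp; norm_num
  have hsquare : ((1 / (4 * r) : ℝ) : ℂ) • (1 : Matrix κ κ ℂ) - (K - (r : ℂ) • (K * K))
      = (r : ℂ) • ((K - d • 1)ᴴ * (K - d • 1)) := by
    have hstar : star d = d := Complex.conj_ofReal _
    have hK1 : K = (2 * ((r : ℂ) * d)) • K := by rw [hlin, one_smul]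
    rw [conjTranspose_sub, hK, conjTranspose_smul, conjTranspose_one, hstar, hquad]
    nth_rewrite 1 [hK1]
    simp only [Matrix.sub_mul, Matrix.mul_sub, Matrix.smul_mul, Matrix.mul_smul, Matrix.one_mul,
      Matrix.mul_one]
    module
  exact hsquare ▸ (posSemidef_conjTranspose_mul_self _).smul (Complex.zero_le_real.2 hr.le)

lemma norm_regularized_apply_le (B : Matrix ι κ ℂ) {r : ℝ} (hr : 0 < r) (i : ι) (j : κ) :
    ‖(B * (Bᴴ * B + (r : ℂ) • (1 : Matrix κ κ ℂ))⁻¹) i j‖ ≤ Real.sqrt (1 / (4 * r)) :=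
  norm_apply_le_sqrt_of_posSemidef (conjTranspose_mul_self_regularized B hr ▸
    posSemidef_smul_one_sub_sub_smul_sq (posDef_gram_add_smul_one B hr).inv.1 hr) i j

end Bounds

namespace Params

variable {M N Nt Nr τt τr : ℕ} (p : Params M N Nt Nr τt τr)

lemma star_α (m : Fin M) : star (p.α m) = p.α m := by
  unfold α; split_ifs <;> simp

lemma α_mul_self (m : Fin M) : p.α m * p.α m = p.α m := by
  unfold α; split_ifs <;> simp

lemma prelog_nonneg : 0 ≤ p.prelog :=
  sub_nonneg.2 (div_le_one_of_le₀ (by exact_mod_cast p.training_le) p.τ.cast_nonneg)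

lemma conjTranspose_sqrtLam : p.sqrtLamᴴ = p.sqrtLam := by
  rw [sqrtLam, sqrtDiag, diagonal_conjTranspose]
  exact congrArg diagonal (funext fun n => Complex.conj_ofReal _)

lemma sqrtLam_mul_sqrtLam : p.sqrtLam * p.sqrtLam = p.Lam := by
  rw [sqrtLam, sqrtDiag, diagonal_mul_diagonal]
  exact congrArg diagonal (funext fun n => ofReal_sqrt_mul_self (p.lam_nonneg n))

end Params

lemma isWhite_of_expMat {Ω : Type*} [MeasurableSpace Ω] {P : Measure Ω} {k : ℕ}
    {v : Ω → Fin k → ℂ} (h : expMat P (fun ω => outer (v ω) (v ω)) = 1) : IsWhite P v :=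
  fun i j => congrFun (congrFun h i) j

lemma comap_comp_le {Ω A B : Type*} [mA : MeasurableSpace A] [mB : MeasurableSpace B] {g : A → B}
    (hg : Measurable g) (Z : Ω → A) : mB.comap (fun ω => g (Z ω)) ≤ mA.comap Z :=
  (hg.comp (comap_measurable Z)).comap_le

namespace Model

section Measurability

variable {Ω : Type*} [mΩ : MeasurableSpace Ω] {P : Measure Ω} {M N Nt Nr τt τr : ℕ}
  (S : Model P M N Nt Nr τt τr) (p : Params M N Nt Nr τt τr)

lemma measurable_state : Measurable S.state :=
  S.Htr_meas.prodMk (S.Hmr_meas.prodMk (S.Htm_meas.prodMk (S.Hmm_meas.prodMk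
    (S.Wt_meas.prodMk (S.Wul_meas.prodMk S.Wdl_meas)))))

/-- The events determined by the channels and the training noise. The gains and combiners of both
receivers are measurable with respect to this σ-algebra. -/
noncomputable abbrev stateAlgebra : MeasurableSpace Ω := MeasurableSpace.comap S.state inferInstance

lemma stateAlgebra_le : S.stateAlgebra ≤ mΩ := S.measurable_state.comap_le

lemma entryMeasurable_Gtr : EntryMeasurable S.stateAlgebra (S.Gtr p) :=
  .smul _ (entryMeasurable_of_measurable (measurable_fst.comp (comap_measurable S.state)))

lemma entryMeasurable_Gmr (m : Fin M) : EntryMeasurable S.stateAlgebra (S.Gmr p m) :=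
  .smul _ (entryMeasurable_of_measurable
    ((measurable_pi_apply m).comp (measurable_snd.fst.comp (comap_measurable S.state))))

lemma entryMeasurable_Gtm (m : Fin M) : EntryMeasurable S.stateAlgebra (S.Gtm p m) :=
  .smul _ (entryMeasurable_of_measurable
    ((measurable_pi_apply m).comp (measurable_snd.snd.fst.comp (comap_measurable S.state))))

lemma entryMeasurable_Gmm (m m' : Fin M) : EntryMeasurable S.stateAlgebra (S.Gmm p m m') := by
  unfold Gmm
  split_ifs
  · exact .const _
  · exact .smul _ (entryMeasurable_of_measurable ((measurable_pi_apply m').comp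
      ((measurable_pi_apply m).comp
        (measurable_snd.snd.snd.fst.comp (comap_measurable S.state)))))

lemma entryMeasurable_Wt : EntryMeasurable S.stateAlgebra S.Wt :=
  entryMeasurable_of_measurable
    (measurable_snd.snd.snd.snd.fst.comp (comap_measurable S.state))

lemma entryMeasurable_Wul (m : Fin M) : EntryMeasurable S.stateAlgebra fun ω => S.Wul ω m :=
  entryMeasurable_of_measurable ((measurable_pi_apply m).comp
    (measurable_snd.snd.snd.snd.snd.fst.comp (comap_measurable S.state)))

lemma entryMeasurable_Wdl (m : Fin M) : EntryMeasurable S.stateAlgebra fun ω => S.Wdl ω m :=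
  entryMeasurable_of_measurable ((measurable_pi_apply m).comp
    (measurable_snd.snd.snd.snd.snd.snd.comp (comap_measurable S.state)))

lemma entryMeasurable_Gtrhat : EntryMeasurable S.stateAlgebra (S.Gtrhat p) :=
  (((((S.entryMeasurable_Gtr p).mul (.const _)).smul _).add S.entryMeasurable_Wt).mul
    (.const _)).smul _

lemma entryMeasurable_Gmrhat (m : Fin M) : EntryMeasurable S.stateAlgebra (S.Gmrhat p m) :=
  (((((S.entryMeasurable_Gmr p m).mul (.const _)).smul _).add (S.entryMeasurable_Wul m)).mul
    (.const _)).smul _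

lemma entryMeasurable_W : EntryMeasurable S.stateAlgebra (S.W p) :=
  (entryMeasurable_of_measurable
    (p.precoder_meas.comp (S.entryMeasurable_Gtrhat p).measurable)).normalizeCols

lemma entryMeasurable_A : EntryMeasurable S.stateAlgebra (S.A p) :=
  (S.entryMeasurable_Gtr p).conjTranspose.mul (S.entryMeasurable_W p)

lemma entryMeasurable_B (m : Fin M) : EntryMeasurable S.stateAlgebra (S.B p m) :=
  (S.entryMeasurable_Gtm p m).conjTranspose.mul (S.entryMeasurable_W p)

lemma entryMeasurable_Ymt (m : Fin M) : EntryMeasurable S.stateAlgebra (S.Ymt p m) :=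
  ((((S.entryMeasurable_B p m).mul (.const _)).smul _).add (S.entryMeasurable_Wdl m)).mul
    (.const _)

lemma measurable_bhat (m : Fin M) (i : Fin N) : Measurable[S.stateAlgebra] (S.bhat p m i) := by
  have haffine : Continuous fun y : Fin Nr → ℂ =>
      S.bMean p m i + ((p.ampDL : ℝ) : ℂ) •
        ((S.bCov p m i * (((τt * p.ρt : ℝ) : ℂ) • S.bCov p m i + 1)⁻¹) *ᵥ
          (y - ((p.ampDL : ℝ) : ℂ) • S.bMean p m i)) := by fun_prop
  exact haffine.measurable.comp ((S.entryMeasurable_Ymt p m).star_row i)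

lemma entryMeasurable_Bhat (m : Fin M) : EntryMeasurable S.stateAlgebra (S.Bhat p m) :=
  fun i j => Complex.continuous_conj.measurable.comp
    ((measurable_pi_apply j).comp (S.measurable_bhat p m i))

lemma entryMeasurable_V (m : Fin M) : EntryMeasurable S.stateAlgebra (S.V p m) :=
  (S.entryMeasurable_Bhat p m).mul
    (((S.entryMeasurable_Bhat p m).conjTranspose.mul (S.entryMeasurable_Bhat p m)).add
      (.const _)).inv

lemma entryMeasurable_FJr : EntryMeasurable S.stateAlgebra (S.FJr p) :=
  EntryMeasurable.sum _ fun m => (((S.entryMeasurable_Gmr p m).conjTranspose.mul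
    (S.entryMeasurable_Gmrhat p m)).mul (.const _)).smul _

lemma entryMeasurable_FJm (m : Fin M) : EntryMeasurable S.stateAlgebra (S.FJm p m) :=
  EntryMeasurable.sum _ fun m' => (((S.entryMeasurable_Gmm p m m').conjTranspose.mul
    (S.entryMeasurable_Gmrhat p m')).mul (.const _)).smul _

end Measurability

section Moments

variable {Ω : Type*} [mΩ : MeasurableSpace Ω] {P : Measure Ω} [IsProbabilityMeasure P]
  {M N Nt Nr τt τr : ℕ} (S : Model P M N Nt Nr τt τr) (p : Params M N Nt Nr τt τr)

lemma allMoments_W : AllMoments (S.W p) P :=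
  .of_bounded ((S.entryMeasurable_W p).mono S.stateAlgebra_le) 1
    fun _ => norm_normalizeCols_apply_le _

lemma allMoments_V (m : Fin M) : AllMoments (S.V p m) P :=
  .of_bounded ((S.entryMeasurable_V p m).mono S.stateAlgebra_le) _
    fun _ => norm_regularized_apply_le _ p.reg_pos

omit [IsProbabilityMeasure P] in
lemma allMoments_Gtr : AllMoments (S.Gtr p) P := (allMoments_of_law S.Htr_meas S.Htr_law).smul _

omit [IsProbabilityMeasure P] in
lemma allMoments_Gmr (m : Fin M) : AllMoments (S.Gmr p m) P :=
  (allMoments_of_law ((measurable_pi_apply m).comp S.Hmr_meas) (S.Hmr_law m)).smul _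

omit [IsProbabilityMeasure P] in
lemma allMoments_Gtm (m : Fin M) : AllMoments (S.Gtm p m) P :=
  (allMoments_of_law ((measurable_pi_apply m).comp S.Htm_meas) (S.Htm_law m)).smul _

lemma allMoments_Gmm (m m' : Fin M) : AllMoments (S.Gmm p m m') P := by
  unfold Gmm
  split_ifs with h
  · exact .const _
  · exact (allMoments_of_law ((measurable_pi_apply m').comp
      ((measurable_pi_apply m).comp S.Hmm_meas)) (S.Hmm_law m m' h)).smul _

lemma allMoments_Gmrhat (m : Fin M) : AllMoments (S.Gmrhat p m) P :=
  (((((S.allMoments_Gmr p m).mul (.const _)).smul _).add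
    (allMoments_of_law ((measurable_pi_apply m).comp S.Wul_meas) (S.Wul_law m))).mul
    (.const _)).smul _

lemma allMoments_A_mul_sqrtLam : AllMoments (fun ω => S.A p ω * p.sqrtLam) P :=
  ((S.allMoments_Gtr p).conjTranspose.mul (S.allMoments_W p)).mul (.const _)

lemma allMoments_B (m : Fin M) : AllMoments (S.B p m) P :=
  (S.allMoments_Gtm p m).conjTranspose.mul (S.allMoments_W p)

lemma allMoments_FJr : AllMoments (S.FJr p) P :=
  AllMoments.sum _ fun m => (((S.allMoments_Gmr p m).conjTranspose.mul
    (S.allMoments_Gmrhat p m)).mul (.const _)).smul _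

lemma allMoments_FJm (m : Fin M) : AllMoments (S.FJm p m) P :=
  AllMoments.sum _ fun m' => (((S.allMoments_Gmm p m m').conjTranspose.mul
    (S.allMoments_Gmrhat p m')).mul (.const _)).smul _

lemma allMoments_D : AllMoments (S.D p) P :=
  AllMoments.sum _ fun m => (((S.allMoments_V p m).conjTranspose.mul
    (S.allMoments_B p m)).mul (.const _)).smul _

end Moments

variable {Ω : Type*} [mΩ : MeasurableSpace Ω] {P : Measure Ω} [IsProbabilityMeasure P]
  {M N Nt Nr τt τr : ℕ} (S : Model P M N Nt Nr τt τr) (p : Params M N Nt Nr τt τr)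
  {T : Type*} [mT : MeasurableSpace T] {Θ : Ω → T}

/-- The events determined by the channels, the training noise and the side information `Θ`. -/
noncomputable abbrev jointAlgebra (Θ : Ω → T) : MeasurableSpace Ω :=
  MeasurableSpace.comap (fun ω => (S.state ω, Θ ω)) inferInstance

omit [IsProbabilityMeasure P] in
lemma stateAlgebra_le_jointAlgebra (Θ : Ω → T) : S.stateAlgebra ≤ S.jointAlgebra Θ :=
  comap_comp_le measurable_fst fun ω => (S.state ω, Θ ω)

lemma whiteSource {η : Type*} [DecidableEq η] {w : Ω → η → ℂ} (hΘ : Measurable Θ)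
    (hindep : MutuallyIndep P S.x S.xJ w fun ω => (S.state ω, Θ ω)) (hw : Measurable w)
    (hwwhite : IsWhite P w) (hwmean : ∀ a, ∫ ω, w ω a ∂P = 0) :
    WhiteSource P (S.jointAlgebra Θ) (sourceVec S.x S.xJ w) :=
  whiteSource_sourceVec S.x_meas S.xJ_meas hw (S.measurable_state.prodMk hΘ) hindep
    (isWhite_of_law S.x_meas S.x_law) (isWhite_of_expMat S.xJ_cov) hwwhite
    (integral_apply_of_law S.x_meas S.x_law) hwmean

omit [IsProbabilityMeasure P] in
lemma whiteChannel {η : Type*} [Fintype η] [DecidableEq η] {w : Ω → η → ℂ}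
    {L : Ω → Matrix (Fin Nr) η ℂ} {B : Ω → Matrix η (Fin Nr) ℂ}
    {J : Ω → Matrix (Fin Nr) (Fin Nr) ℂ}
    (h : WhiteSource P (S.jointAlgebra Θ) (sourceVec S.x S.xJ w))
    (hLm : EntryMeasurable S.stateAlgebra L) (hBm : EntryMeasurable S.stateAlgebra B)
    (hJm : EntryMeasurable S.stateAlgebra J) (hL : AllMoments L P) (hB : AllMoments B P)
    (hJ : AllMoments J P) :
    WhiteChannel P (mT.comap Θ) (S.jointAlgebra Θ) (sourceVec S.x S.xJ w)
      (channelMatrix L B J) :=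
  have hle := S.stateAlgebra_le_jointAlgebra Θ
  whiteChannel_channelMatrix h (comap_comp_le measurable_snd fun ω => (S.state ω, Θ ω))
    (hLm.mono hle) (hBm.mono hle) (hJm.mono hle) hL hB hJ

section Receiver

/-- The channel from signal, jamming and noise to the untrusted receiver. -/
noncomputable def receiverChannel : Ω → Matrix (Fin Nr) (Fin Nr ⊕ (Fin Nr ⊕ Fin Nr)) ℂ :=
  channelMatrix (fun _ => 1) (fun ω => ((Real.sqrt p.ρt : ℝ) : ℂ) • (S.A p ω * p.sqrtLam))
    fun ω => ((Real.sqrt p.ρJ : ℝ) : ℂ) • S.FJr p ω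

omit [IsProbabilityMeasure P] in
lemma conjTranspose_mulVec_sJ {k : ℕ} (m : Fin M) (G : Matrix (Fin N) (Fin k) ℂ) (ω : Ω) :
    Gᴴ *ᵥ S.sJ p m ω = ((Real.sqrt p.ρJ : ℝ) : ℂ) •
      (((1 - p.α m) • (Gᴴ * S.Gmrhat p m ω * p.sqrtPow m)) *ᵥ S.xJ ω) := by
  rw [sJ, mulVec_smul, mulVec_mulVec, smul_mulVec, smul_smul, mul_comm, Matrix.mul_assoc]

omit [IsProbabilityMeasure P] in
lemma yr_eq :
    S.yr p = fun ω => S.receiverChannel p ω *ᵥ sourceVec S.x S.xJ S.wr ω := by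
  funext ω
  have hsignal : (S.Gtr p ω)ᴴ *ᵥ S.st p ω
      = (((Real.sqrt p.ρt : ℝ) : ℂ) • (S.A p ω * p.sqrtLam)) *ᵥ S.x ω := by
    rw [st, A, mulVec_smul, mulVec_mulVec, smul_mulVec, Matrix.mul_assoc]
  have hjam : ∑ m, (S.Gmr p m ω)ᴴ *ᵥ S.sJ p m ω
      = (((Real.sqrt p.ρJ : ℝ) : ℂ) • S.FJr p ω) *ᵥ S.xJ ω := by
    simp only [conjTranspose_mulVec_sJ, FJr, smul_mulVec, sum_mulVec, Finset.smul_sum]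
  rw [receiverChannel, channelMatrix_mulVec_sourceVec, yr, hsignal, hjam, Matrix.one_mul,
    Matrix.one_mulVec, add_assoc]

lemma whiteChannel_receiver (hΘ : Measurable Θ)
    (hindep : MutuallyIndep P S.x S.xJ S.wr fun ω => (S.state ω, Θ ω)) :
    WhiteChannel P (mT.comap Θ) (S.jointAlgebra Θ) (sourceVec S.x S.xJ S.wr)
      (S.receiverChannel p) :=
  S.whiteChannel (S.whiteSource hΘ hindep S.wr_meas (isWhite_of_expMat S.wr_cov) S.wr_mean)
    (.const 1) (((S.entryMeasurable_A p).mul (.const _)).smul _)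
    ((S.entryMeasurable_FJr p).smul _) (.const 1) ((S.allMoments_A_mul_sqrtLam p).smul _)
    ((S.allMoments_FJr p).smul _)

lemma integrable_log_det_precision_receiver (hΘ : Measurable Θ) :
    Integrable (fun ω => Real.log
      (precision P (mT.comap Θ) (S.receiverChannel p) ω).det.re) P :=
  integrable_log_det_precision_channelMatrix hΘ.comap_le (.const 1)
    ((S.allMoments_A_mul_sqrtLam p).smul _) ((S.allMoments_FJr p).smul _)

lemma Psir_ae_eq_effNoise (hΘ : Measurable Θ) :
    S.Psir p Θ =ᵐ[P] effNoise P (mT.comap Θ) (S.receiverChannel p) := by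
  have hgain : ∀ ω, S.A p ω * p.sqrtLam * (S.A p ω * p.sqrtLam)ᴴ
      = S.A p ω * p.Lam * (S.A p ω)ᴴ := fun ω => by
    rw [conjTranspose_mul, p.conjTranspose_sqrtLam, ← p.sqrtLam_mul_sqrtLam]
    simp only [Matrix.mul_assoc]
  filter_upwards [effNoise_channelMatrix_of_gain (m := mT.comap Θ) p.ρt_nonneg p.ρJ_nonneg
    (.const 1) ((S.allMoments_A_mul_sqrtLam p).smul _) (S.allMoments_FJr p)
    fun ω => Matrix.one_mul _] with ω hnoise
  rw [receiverChannel, hnoise]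
  simp only [hgain, conjTranspose_one, Matrix.mul_one]
  rw [condExpMat_const hΘ.comap_le, Psir]
  simp only [condMat, condExpMat]
  abel

lemma one_add_Upsilonr_ae_eq (hΘ : Measurable Θ) :
    ∀ᵐ ω ∂P, 1 + S.Upsilonr p Θ ω = precision P (mT.comap Θ) (S.receiverChannel p) ω := by
  filter_upwards [precision_channelMatrix_of_gain (m := mT.comap Θ)
    (J := fun ω => ((Real.sqrt p.ρJ : ℝ) : ℂ) • S.FJr p ω) p.ρt_nonneg
    (S.allMoments_A_mul_sqrtLam p) fun ω => Matrix.one_mul _, S.Psir_ae_eq_effNoise p hΘ]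
    with ω hprec hnoise
  rw [receiverChannel, hprec, Upsilonr, hnoise]
  simp only [conjTranspose_mul, p.conjTranspose_sqrtLam]
  rfl

open scoped ComplexOrder in
lemma isUnit_det_Psir (hΘ : Measurable Θ) : ∀ᵐ ω ∂P, IsUnit (S.Psir p Θ ω).det := by
  filter_upwards [S.Psir_ae_eq_effNoise p hΘ, effNoise_channelMatrix_one_posDef hΘ.comap_le
    ((S.allMoments_A_mul_sqrtLam p).smul _) ((S.allMoments_FJr p).smul _)] with ω hΨ hpos
  rw [hΨ]
  exact (isUnit_iff_isUnit_det _).1 hpos.isUnit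

lemma Psir_ae_eq_PsirUncond (hΘ : Measurable Θ) (hindep : IndepFun (S.FJr p) Θ P) :
    S.Psir p Θ =ᵐ[P] S.PsirUncond p Θ := by
  have hF : Measurable (S.FJr p) :=
    ((S.entryMeasurable_FJr p).mono S.stateAlgebra_le).measurable
  have hFcomap : EntryMeasurable ((inferInstance : MeasurableSpace
      (Matrix (Fin Nr) (Fin Nr) ℂ)).comap (S.FJr p)) (S.FJr p) :=
    entryMeasurable_of_measurable (comap_measurable _)
  filter_upwards [ae_all_iff.2 fun i => ae_all_iff.2 fun j =>
    condExp_indep_eq hF.comap_le hΘ.comap_le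
      (hFcomap.mul hFcomap.conjTranspose i j).stronglyMeasurable
      ((IndepFun_iff_Indep _ _ _).1 hindep)] with ω hω
  have hjam : condMat P Θ (fun ω' => S.FJr p ω' * (S.FJr p ω')ᴴ) ω
      = expMat P (fun ω' => S.FJr p ω' * (S.FJr p ω')ᴴ) := by
    ext i j
    exact hω i j
  rw [Psir, PsirUncond, hjam]

lemma integrable_log2det_one_add_Upsilonr (hΘ : Measurable Θ) :
    Integrable (fun ω => log2det (1 + S.Upsilonr p Θ ω)) P := by
  refine ((S.integrable_log_det_precision_receiver p hΘ).div_const (Real.log 2)).congr ?_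
  filter_upwards [S.one_add_Upsilonr_ae_eq p hΘ] with ω hω
  rw [hω, log2det, Real.logb]

lemma SEr_eq (hΘ : Measurable Θ) : S.SEr p Θ
    = p.prelog * ∫ ω, log2det (precision P (mT.comap Θ) (S.receiverChannel p) ω) ∂P :=
  congrArg (p.prelog * ·) (integral_congr_ae
    ((S.one_add_Upsilonr_ae_eq p hΘ).mono fun _ hω => congrArg log2det hω))

variable (hΘ : Measurable Θ)
  (hindep : MutuallyIndep P S.x S.xJ S.wr fun ω => (S.state ω, Θ ω))
include hΘ hindep

lemma mmseSE_yr : mmseSE P p.prelog Θ S.x (S.yr p) = S.SEr p Θ := by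
  have hdet : ∀ᵐ ω ∂P, (effNoise P (mT.comap Θ) (S.receiverChannel p) ω).det ≠ 0 := by
    filter_upwards [S.Psir_ae_eq_effNoise p hΘ, S.isUnit_det_Psir p hΘ] with ω hΨ hunit
    exact hΨ ▸ hunit.ne_zero
  rw [SEr_eq S p hΘ, yr_eq]
  exact (S.whiteChannel_receiver p hΘ hindep).mmseSE_eq hdet p.prelog

lemma isAchievableSE_estimate_yr :
    IsAchievableSE p.prelog
      (mutualInfo P S.x fun ω => (mmseEstimate P Θ S.x (S.yr p) ω, Θ ω)) (S.SEr p Θ) := by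
  rw [SEr_eq S p hΘ, yr_eq]
  exact (S.whiteChannel_receiver p hΘ hindep).isAchievableSE_estimate hΘ S.x_law
    (S.integrable_log_det_precision_receiver p hΘ) p.prelog_nonneg

lemma isAchievableSE_yr :
    IsAchievableSE p.prelog (mutualInfo P S.x fun ω => (S.yr p ω, Θ ω)) (S.SEr p Θ) := by
  rw [SEr_eq S p hΘ, yr_eq]
  exact (S.whiteChannel_receiver p hΘ hindep).isAchievableSE_obs hΘ S.x_law
    (S.integrable_log_det_precision_receiver p hΘ) p.prelog_nonneg

end Receiver

section CPU

/-- The weighted combining matrices of all monitoring nodes, side by side. -/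
noncomputable def combiner (ω : Ω) : Matrix (Fin Nr) (Fin M × Fin N) ℂ :=
  Matrix.of fun i a => p.α a.1 * star (S.V p a.1 ω a.2 i)

/-- The effective channels from the symbols to all monitoring nodes, on top of each other. -/
noncomputable def stackedGain (ω : Ω) : Matrix (Fin M × Fin N) (Fin Nr) ℂ :=
  Matrix.of fun a j => (S.B p a.1 ω * p.sqrtLam) a.2 j

/-- The effective jamming channel to the CPU. -/
noncomputable def FJc (ω : Ω) : Matrix (Fin Nr) (Fin Nr) ℂ :=
  ∑ m, p.α m • ((S.V p m ω)ᴴ * S.FJm p m ω)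

/-- The noise at all monitoring nodes as one vector. -/
def stackedNoise (ω : Ω) (a : Fin M × Fin N) : ℂ := S.wm ω a.1 a.2

/-- The channel from signal, jamming and noise to the CPU. -/
noncomputable def cpuChannel : Ω → Matrix (Fin Nr) (Fin Nr ⊕ (Fin Nr ⊕ (Fin M × Fin N))) ℂ :=
  channelMatrix (S.combiner p) (fun ω => ((Real.sqrt p.ρt : ℝ) : ℂ) • S.stackedGain p ω)
    fun ω => ((Real.sqrt p.ρJ : ℝ) : ℂ) • S.FJc p ω

section Algebra

omit [IsProbabilityMeasure P]

lemma combiner_mul_smul_stackedGain (ω : Ω) :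
    S.combiner p ω * (((Real.sqrt p.ρt : ℝ) : ℂ) • S.stackedGain p ω)
      = ((Real.sqrt p.ρt : ℝ) : ℂ) • S.D p ω := by
  rw [Matrix.mul_smul]
  congr 1
  ext i j
  simp only [D, mul_apply, Fintype.sum_prod_type, Matrix.sum_apply, Matrix.smul_apply, smul_eq_mul,
    combiner, stackedGain, of_apply, Finset.mul_sum, Matrix.mul_assoc, conjTranspose_apply,
    mul_assoc]

lemma combiner_mul_conjTranspose (ω : Ω) :
    S.combiner p ω * (S.combiner p ω)ᴴ = ∑ m, p.α m • ((S.V p m ω)ᴴ * S.V p m ω) := by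
  ext i j
  simp only [mul_apply, Fintype.sum_prod_type, Matrix.sum_apply, Matrix.smul_apply, smul_eq_mul,
    combiner, of_apply, Finset.mul_sum, conjTranspose_apply, star_mul', star_star, p.star_α]
  refine Finset.sum_congr rfl fun m _ => Finset.sum_congr rfl fun n _ => ?_
  rw [mul_mul_mul_comm, p.α_mul_self]

lemma combiner_mulVec_stackedNoise (ω : Ω) :
    S.combiner p ω *ᵥ S.stackedNoise ω = ∑ m, p.α m • ((S.V p m ω)ᴴ *ᵥ S.wm ω m) := by
  ext i
  simp only [mulVec, dotProduct, Fintype.sum_prod_type, Finset.sum_apply, Pi.smul_apply,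
    smul_eq_mul, combiner, stackedNoise, of_apply, Finset.mul_sum, conjTranspose_apply, mul_assoc]

lemma FJc_mul_conjTranspose (ω : Ω) :
    S.FJc p ω * (S.FJc p ω)ᴴ = ∑ m, ∑ l, (p.α m * p.α l) •
      ((S.V p m ω)ᴴ * S.FJm p m ω * (S.FJm p l ω)ᴴ * S.V p l ω) := by
  simp only [FJc, conjTranspose_sum, Finset.sum_mul, Finset.mul_sum, conjTranspose_smul,
    smul_mul_smul_comm, p.star_α, conjTranspose_mul, conjTranspose_conjTranspose, Matrix.mul_assoc]
  exact Finset.sum_comm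

lemma ym_eq (m : Fin M) (ω : Ω) :
    S.ym p m ω = p.α m • (((Real.sqrt p.ρt : ℝ) : ℂ) • ((S.B p m ω * p.sqrtLam) *ᵥ S.x ω))
      + ((Real.sqrt p.ρJ : ℝ) : ℂ) • (S.FJm p m ω *ᵥ S.xJ ω) + S.wm ω m := by
  have hsignal : (S.Gtm p m ω)ᴴ *ᵥ S.st p ω
      = ((Real.sqrt p.ρt : ℝ) : ℂ) • ((S.B p m ω * p.sqrtLam) *ᵥ S.x ω) := by
    rw [st, mulVec_smul, mulVec_mulVec, B, Matrix.mul_assoc]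
  have hjam : ∑ m', (S.Gmm p m m' ω)ᴴ *ᵥ S.sJ p m' ω
      = ((Real.sqrt p.ρJ : ℝ) : ℂ) • (S.FJm p m ω *ᵥ S.xJ ω) := by
    simp only [conjTranspose_mulVec_sJ, FJm, sum_mulVec, Finset.smul_sum]
  rw [ym, hsignal, hjam]

lemma zc_eq : S.zc p = fun ω => S.cpuChannel p ω *ᵥ sourceVec S.x S.xJ S.stackedNoise ω := by
  funext ω
  rw [cpuChannel, channelMatrix_mulVec_sourceVec, combiner_mul_smul_stackedGain,
    combiner_mulVec_stackedNoise, zc, D, FJc]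
  simp only [smul_mulVec, sum_mulVec, Finset.smul_sum, ← Finset.sum_add_distrib]
  refine Finset.sum_congr rfl fun m _ => ?_
  rw [ym_eq, mulVec_add, mulVec_add, smul_add, smul_add, add_assoc, mulVec_smul, smul_smul,
    p.α_mul_self]
  simp only [mulVec_smul, mulVec_mulVec, Matrix.mul_assoc, smul_comm (p.α m)]

lemma entryMeasurable_combiner : EntryMeasurable S.stateAlgebra (S.combiner p) :=
  fun i a => ((S.entryMeasurable_V p a.1).conjTranspose i a.2).const_mul _

lemma entryMeasurable_stackedGain : EntryMeasurable S.stateAlgebra (S.stackedGain p) :=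
  fun a j => ((S.entryMeasurable_B p a.1).mul (.const _)) a.2 j

lemma entryMeasurable_FJc : EntryMeasurable S.stateAlgebra (S.FJc p) :=
  EntryMeasurable.sum _ fun m =>
    ((S.entryMeasurable_V p m).conjTranspose.mul (S.entryMeasurable_FJm p m)).smul _

lemma measurable_stackedNoise : Measurable S.stackedNoise :=
  measurable_pi_iff.2 fun a =>
    (measurable_pi_apply a.2).comp ((measurable_pi_apply a.1).comp S.wm_meas)

lemma isWhite_stackedNoise : IsWhite P S.stackedNoise := by
  rintro ⟨m, n⟩ ⟨l, q⟩
  obtain rfl | hml := eq_or_ne m l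
  · refine (isWhite_of_expMat (S.wm_cov m) n q).trans ?_
    simp only [one_apply, Prod.mk.injEq, true_and]
  · rw [one_apply_ne fun h => hml (congrArg Prod.fst h)]
    exact congrFun (congrFun (S.wm_uncorr m l hml) n) q

end Algebra

lemma allMoments_combiner : AllMoments (S.combiner p) P := fun r hr i a =>
  ((S.allMoments_V p a.1).conjTranspose.smul (p.α a.1)) r hr i a.2

lemma allMoments_stackedGain : AllMoments (S.stackedGain p) P := fun r hr a j =>
  ((S.allMoments_B p a.1).mul (.const _)) r hr a.2 j

lemma allMoments_FJc : AllMoments (S.FJc p) P :=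
  AllMoments.sum _ fun m => ((S.allMoments_V p m).conjTranspose.mul (S.allMoments_FJm p m)).smul _

lemma whiteChannel_cpu (hΘ : Measurable Θ)
    (hindep : MutuallyIndep P S.x S.xJ S.wm fun ω => (S.state ω, Θ ω)) :
    WhiteChannel P (mT.comap Θ) (S.jointAlgebra Θ) (sourceVec S.x S.xJ S.stackedNoise)
      (S.cpuChannel p) :=
  have hindep' : MutuallyIndep P S.x S.xJ S.stackedNoise fun ω => (S.state ω, Θ ω) :=
    hindep.comp_noise (g := fun (w : Fin M → Fin N → ℂ) (a : Fin M × Fin N) => w a.1 a.2)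
      (by fun_prop)
  S.whiteChannel (S.whiteSource hΘ hindep' S.measurable_stackedNoise S.isWhite_stackedNoise
      fun a => S.wm_mean a.1 a.2)
    (S.entryMeasurable_combiner p) ((S.entryMeasurable_stackedGain p).smul _)
    ((S.entryMeasurable_FJc p).smul _) (S.allMoments_combiner p)
    ((S.allMoments_stackedGain p).smul _) ((S.allMoments_FJc p).smul _)

lemma integrable_log_det_precision_cpu (hΘ : Measurable Θ) :
    Integrable (fun ω => Real.log (precision P (mT.comap Θ) (S.cpuChannel p) ω).det.re) P :=
  integrable_log_det_precision_channelMatrix hΘ.comap_le (S.allMoments_combiner p)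
    ((S.allMoments_stackedGain p).smul _) ((S.allMoments_FJc p).smul _)

lemma Psic_ae_eq_effNoise :
    S.Psic p Θ =ᵐ[P] effNoise P (mT.comap Θ) (S.cpuChannel p) := by
  filter_upwards [effNoise_channelMatrix_of_gain (m := mT.comap Θ) p.ρt_nonneg p.ρJ_nonneg
    (S.allMoments_combiner p) ((S.allMoments_stackedGain p).smul _)
    (S.allMoments_FJc p) (S.combiner_mul_smul_stackedGain p),
    condExpMat_conjTranspose (m := mT.comap Θ) (S.allMoments_D p).memLp_one] with ω hnoise hstar
  rw [cpuChannel, hnoise, ← hstar]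
  simp only [FJc_mul_conjTranspose, combiner_mul_conjTranspose]
  rw [Psic]
  simp only [condMat, condExpMat]
  abel

lemma one_add_Upsilonc_ae_eq :
    ∀ᵐ ω ∂P, 1 + S.Upsilonc p Θ ω = precision P (mT.comap Θ) (S.cpuChannel p) ω := by
  filter_upwards [precision_channelMatrix_of_gain (m := mT.comap Θ)
    (J := fun ω => ((Real.sqrt p.ρJ : ℝ) : ℂ) • S.FJc p ω) p.ρt_nonneg (S.allMoments_D p)
    (S.combiner_mul_smul_stackedGain p), S.Psic_ae_eq_effNoise p (Θ := Θ)] with ω hprec hnoise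
  rw [cpuChannel, hprec, Upsilonc, hnoise]
  rfl

lemma integrable_log2det_one_add_Upsilonc (hΘ : Measurable Θ) :
    Integrable (fun ω => log2det (1 + S.Upsilonc p Θ ω)) P := by
  refine ((S.integrable_log_det_precision_cpu p hΘ).div_const (Real.log 2)).congr ?_
  filter_upwards [S.one_add_Upsilonc_ae_eq p (Θ := Θ)] with ω hω
  rw [hω, log2det, Real.logb]

lemma SEc_eq : S.SEc p Θ
    = p.prelog * ∫ ω, log2det (precision P (mT.comap Θ) (S.cpuChannel p) ω) ∂P :=
  congrArg (p.prelog * ·) (integral_congr_ae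
    ((S.one_add_Upsilonc_ae_eq p).mono fun _ hω => congrArg log2det hω))

variable (hΘ : Measurable Θ)
  (hindep : MutuallyIndep P S.x S.xJ S.wm fun ω => (S.state ω, Θ ω))
include hΘ hindep

lemma mmseSE_zc (hunit : ∀ᵐ ω ∂P, IsUnit (S.Psic p Θ ω).det) :
    mmseSE P p.prelog Θ S.x (S.zc p) = S.SEc p Θ := by
  have hdet : ∀ᵐ ω ∂P, (effNoise P (mT.comap Θ) (S.cpuChannel p) ω).det ≠ 0 := by
    filter_upwards [S.Psic_ae_eq_effNoise p (Θ := Θ), hunit] with ω hΨ hω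
    exact hΨ ▸ hω.ne_zero
  rw [SEc_eq, zc_eq]
  exact (S.whiteChannel_cpu p hΘ hindep).mmseSE_eq hdet p.prelog

lemma isAchievableSE_estimate_zc :
    IsAchievableSE p.prelog
      (mutualInfo P S.x fun ω => (mmseEstimate P Θ S.x (S.zc p) ω, Θ ω)) (S.SEc p Θ) := by
  rw [SEc_eq, zc_eq]
  exact (S.whiteChannel_cpu p hΘ hindep).isAchievableSE_estimate hΘ S.x_law
    (S.integrable_log_det_precision_cpu p hΘ) p.prelog_nonneg

lemma isAchievableSE_zc :
    IsAchievableSE p.prelog (mutualInfo P S.x fun ω => (S.zc p ω, Θ ω)) (S.SEc p Θ) := by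
  rw [SEc_eq, zc_eq]
  exact (S.whiteChannel_cpu p hΘ hindep).isAchievableSE_obs hΘ S.x_law
    (S.integrable_log_det_precision_cpu p hΘ) p.prelog_nonneg

end CPU

end Model

end Surveillance

theorem proposition2 {Ω : Type*} [MeasurableSpace Ω] (P : Measure Ω) [IsProbabilityMeasure P]
    {M N Nt Nr τt τr : ℕ} (p : Surveillance.Params M N Nt Nr τt τr)
    (S : Surveillance.Model P M N Nt Nr τt τr)
    {Tr Tc : Type*} [MeasurableSpace Tr] [MeasurableSpace Tc]
    (Θr : Ω → Tr) (Θc : Ω → Tc) (hΘr : Measurable Θr) (hΘc : Measurable Θc)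
    (hr : Surveillance.MutuallyIndep P S.x S.xJ S.wr (fun ω => (S.state ω, Θr ω)))
    (hc : Surveillance.MutuallyIndep P S.x S.xJ S.wm (fun ω => (S.state ω, Θc ω))) :
    -- the untrusted receiver
    ((∀ᵐ ω ∂P, IsUnit (S.Psir p Θr ω).det) ∧
      (IndepFun (S.FJr p) Θr P → S.Psir p Θr =ᵐ[P] S.PsirUncond p Θr) ∧
      Integrable (fun ω => Surveillance.log2det (1 + S.Upsilonr p Θr ω)) P ∧
      Surveillance.mmseSE P p.prelog Θr S.x (S.yr p) = S.SEr p Θr ∧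
      Surveillance.IsAchievableSE p.prelog (Surveillance.mutualInfo P S.x
        (fun ω => (Surveillance.mmseEstimate P Θr S.x (S.yr p) ω, Θr ω))) (S.SEr p Θr) ∧
      Surveillance.IsAchievableSE p.prelog (Surveillance.mutualInfo P S.x
        (fun ω => (S.yr p ω, Θr ω))) (S.SEr p Θr)) ∧
    -- the CPU
    (Integrable (fun ω => Surveillance.log2det (1 + S.Upsilonc p Θc ω)) P ∧
      ((∀ᵐ ω ∂P, IsUnit (S.Psic p Θc ω).det) →
        Surveillance.mmseSE P p.prelog Θc S.x (S.zc p) = S.SEc p Θc) ∧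
      Surveillance.IsAchievableSE p.prelog (Surveillance.mutualInfo P S.x
        (fun ω => (Surveillance.mmseEstimate P Θc S.x (S.zc p) ω, Θc ω))) (S.SEc p Θc) ∧
      Surveillance.IsAchievableSE p.prelog (Surveillance.mutualInfo P S.x
        (fun ω => (S.zc p ω, Θc ω))) (S.SEc p Θc)) :=
  ⟨⟨S.isUnit_det_Psir p hΘr, S.Psir_ae_eq_PsirUncond p hΘr,
      S.integrable_log2det_one_add_Upsilonr p hΘr, S.mmseSE_yr p hΘr hr,
      S.isAchievableSE_estimate_yr p hΘr hr, S.isAchievableSE_yr p hΘr hr⟩,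
    S.integrable_log2det_one_add_Upsilonc p hΘc, S.mmseSE_zc p hΘc hc,
    S.isAchievableSE_estimate_zc p hΘc hc, S.isAchievableSE_zc p hΘc hc⟩
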